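/- **Theorem (the two goal-directed methods agree on ground programs).** Let $P$ be a finite normal logic program without variables and let $Q$ be a query (a finite list of goals) without variables. Then the execution of $Q$ on $P$ by the s(ASP) predicate method and its execution by the propositional goal-directed method, in which the ground atoms of $P$ and $Q$ are treated as propositional atoms and the ground built-in operations ((dis)unification, arithmetic) as truth values, behave identically: they produce the same answers (candidate partial models, i.e. lists of ground literals) in the same order, and one of them stops, by exhausting its search space or with an error, if and only if the other stops in the same way. This holds for all such $P$, in particular for all legal ones, and for either convention for the nodes of the call graph (one node per ground atom, or one node per predicate symbol and arity), the same convention being used for both methods. *Both methods.* Clauses have the form $p \leftarrow B$ or $\leftarrow B$, with $B$ a list of literals $a$, $\mathtt{not}\ a$ and built-in operations, where atoms may carry a classical negation sign "-". Execution is depth-first search with backtracking, clauses and goals being taken in textual order. A clause is an OLON rule if it is headless or contributes an edge to a simple cycle of the call graph that has an odd number of negations. For each OLON rule there is a sub-check: append $\mathtt{not}\ p$ to the body, where $p$ is the head (unless there is no head or it is present already), and negate the resulting body. All sub-checks (the NMR check) are appended to the query. A call fails if it conflicts with ($p$ against $\mathtt{not}\ p$, or $p$ against $\mathtt{-}p$)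 an entry of the coinductive hypothesis set (CHS) or of the call stack; otherwise it succeeds if it is in the CHS; otherwise, if it recurs in the call stack, it fails if there are no negations in between and succeeds if their number is even and non-zero; otherwise it is expanded by its clauses and, upon success, added to the CHS. The negations in between are the edges of weight 1 of the call graph that are followed, i.e. the changes of sign between consecutive calls. An answer consists of the program literals in the CHS. *The propositional method.* Calls are compared by equality. A call $\mathtt{not}\ p$ is expanded to the duals of all clauses with head $p$, the dual of a clause being the disjunction of the negations of its goals. *The predicate method.* Variables carry lists of prohibited values; calls are compared by constructive unification and by exact match (unification that alters no list), and the conflict test constrains the variables of the call. Non-variable or repeated arguments in the head of a clause are replaced by new variables together with unifications in the body; the dual of a predicate is the conjunction of the duals of all its clauses, each universally quantified over the body variables by the for-all mechanism; in the dual of a clause a negated goal is preceded by all goals before it, except that the goals in the body of a clause without variables are negated independently by De Morgan's laws. Sub-checks are universally quantified over all their variables. Variables that occur both in a call and in its ancestor in an even loop are loop variables; at the end their domains in the infinite universe (ground terms, with infinitely many constants added to the language) must be non-empty. -/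

import Mathlib

namespace SASP

noncomputable section

open scoped Classical

universe u v w

/-! ### Depth-first search

A run of a goal-directed method is a depth-first search with backtracking.  Its outcome is the list
of the answers in the order in which they are found, and the way in which the search stops:
the search space is exhausted, execution halts with an error, or the bound on the depth of the
recursion (which makes all functions below total) was too small. -/

inductive Status
  | done
  | error
  | timeout

structure Outcome (α : Type u) where
  answers : List α
  status : Status

namespace Outcome

variable {α : Type u} {β : Type v} {γ : Type w}

def halt (s : Status) : Outcome α := ⟨[], s⟩

def fail : Outcome α := halt .done

def pure (a : α) : Outcome α := ⟨[a], .done⟩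

/-- First the answers of `o`, then, upon backtracking, those of `o'`. -/
def orElse (o o' : Outcome α) : Outcome α :=
  match o.status with
  | .done => ⟨o.answers ++ o'.answers, o'.status⟩
  | s => ⟨o.answers, s⟩

/-- The alternatives are tried one after the other. -/
def alts (os : List (Outcome α)) : Outcome α := os.foldr orElse fail

/-- Each answer of `o` is continued by `f`. -/
def bind (o : Outcome α) (f : α → Outcome β) : Outcome β :=
  orElse (alts (o.answers.map f)) (halt o.status)

def map (f : α → β) (o : Outcome α) : Outcome β := ⟨o.answers.map f, o.status⟩

def filter (p : α → Prop) (o : Outcome α) : Outcome α := ⟨o.answers.filter (fun a => p a), o.status⟩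

/-- If-then-else with commitment to the first answer of the test `o`. -/
def ifAny (o : Outcome α) (yes : α → Outcome β) (no : Outcome β) : Outcome β :=
  match o.answers, o.status with
  | a :: _, _ => yes a
  | [], .done => no
  | [], s => halt s

/-- The conjunction of a list of goals, executed in order. -/
def seq (f : γ → α → Outcome α) : List γ → α → Outcome α
  | [], a => pure a
  | g :: gs, a => (f g a).bind (seq f gs)

end Outcome

open Outcome

/-! ### Terms -/

/-- Terms over function symbols `F` (constants are function symbols without arguments).  The
constructor `special` adjoins infinitely many further constants to the language, so that the ground
terms form an infinite proper superset of the Herbrand universe. -/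
inductive Term (F : Type u) : Type u
  | var (x : ℕ)
  | num (z : ℤ)
  | special (k : ℕ)
  | app (f : F) {k : ℕ} (args : Fin k → Term F)

namespace Term

variable {F : Type u}

def vars : Term F → List ℕ
  | var x => [x]
  | num _ => []
  | special _ => []
  | app _ args => (List.ofFn fun i => (args i).vars).flatten

def subst (σ : ℕ → Term F) : Term F → Term F
  | var x => σ x
  | num z => num z
  | special k => special k
  | app f args => app f fun i => (args i).subst σ

def IsGround (t : Term F) : Prop := t.vars = []

/-- The substitution that replaces `x` by `t`. -/
def single (x : ℕ) (t : Term F) : ℕ → Term F := Function.update var x t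

end Term

/-- The s(ASP) universe. -/
def Universe (F : Type u) : Set (Term F) := {t | t.IsGround}

/-- Arithmetic expressions. -/
inductive AExpr (F : Type u) : Type u
  | val (t : Term F)
  | plus (a b : AExpr F)
  | minus (a b : AExpr F)
  | times (a b : AExpr F)

namespace AExpr

variable {F : Type u}

def vars : AExpr F → List ℕ
  | val t => t.vars
  | plus a b => a.vars ++ b.vars
  | minus a b => a.vars ++ b.vars
  | times a b => a.vars ++ b.vars

def subst (σ : ℕ → Term F) : AExpr F → AExpr F
  | val t => val (t.subst σ)
  | plus a b => plus (a.subst σ) (b.subst σ)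
  | minus a b => minus (a.subst σ) (b.subst σ)
  | times a b => times (a.subst σ) (b.subst σ)

/-- The value of a ground expression, if it is a number. -/
def eval : AExpr F → Option ℤ
  | val (.num z) => some z
  | val _ => none
  | plus a b => do let x ← a.eval; let y ← b.eval; return x + y
  | minus a b => do let x ← a.eval; let y ← b.eval; return x - y
  | times a b => do let x ← a.eval; let y ← b.eval; return x * y

end AExpr

/-- Built-in operations: unification, evaluation `s is e`, and comparison of numbers. -/
inductive Builtin (F : Type u) : Type u
  | eq (s t : Term F)
  | is (s : Term F) (e : AExpr F)
  | lt (a b : AExpr F)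
  | le (a b : AExpr F)

namespace Builtin

variable {F : Type u}

def vars : Builtin F → List ℕ
  | eq s t => s.vars ++ t.vars
  | is s e => s.vars ++ e.vars
  | lt a b => a.vars ++ b.vars
  | le a b => a.vars ++ b.vars

def subst (σ : ℕ → Term F) : Builtin F → Builtin F
  | eq s t => eq (s.subst σ) (t.subst σ)
  | is s e => is (s.subst σ) (e.subst σ)
  | lt a b => lt (a.subst σ) (b.subst σ)
  | le a b => le (a.subst σ) (b.subst σ)

/-- The truth of a ground built-in operation. -/
def Holds : Builtin F → Prop
  | eq s t => s = t
  | is s e => ∃ z, e.eval = some z ∧ s = .num z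
  | lt a b => ∃ x y, a.eval = some x ∧ b.eval = some y ∧ x < y
  | le a b => ∃ x y, a.eval = some x ∧ b.eval = some y ∧ x ≤ y

end Builtin

/-! ### Programs -/

/-- Positive literals over predicate symbols `R`; `hyphen` is the optional prefix of classical
negation. -/
structure Atom (R : Type v) (F : Type u) where
  hyphen : Bool
  rel : R
  args : List (Term F)

/-- Goals of the body of a clause, or of a query.  `lit true a` is the negative literal `not a`;
`test true b` is the negation of a built-in operation, so that `test true (.eq s t)` is the
disunification of `s` and `t`. -/
inductive BodyGoal (R : Type v) (F : Type u)
  | lit (naf : Bool) (a : Atom R F)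
  | test (naf : Bool) (b : Builtin F)

/-- A clause; the head of a headless rule is `none`. -/
structure Clause (R : Type v) (F : Type u) where
  head : Option (Atom R F)
  body : List (BodyGoal R F)

/-- A (finite) normal logic program: the list of its clauses in textual order. -/
abbrev Program (R : Type v) (F : Type u) := List (Clause R F)

section Programs

variable {R : Type v} {F : Type u}

def Atom.vars (a : Atom R F) : List ℕ := a.args.flatMap Term.vars

def BodyGoal.vars : BodyGoal R F → List ℕ
  | .lit _ a => a.vars
  | .test _ b => b.vars

/-- The negation of a goal. -/
def BodyGoal.neg : BodyGoal R F → BodyGoal R F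
  | .lit s a => .lit (!s) a
  | .test s b => .test (!s) b

/-- The arguments of the head. -/
def Clause.headArgs (c : Clause R F) : List (Term F) := (c.head.map Atom.args).getD []

def Clause.vars (c : Clause R F) : List ℕ :=
  c.headArgs.flatMap Term.vars ++ c.body.flatMap BodyGoal.vars

/-- A ground clause contains no variables. -/
def Clause.IsGround (c : Clause R F) : Prop := c.vars = []

/-- A ground program contains no variables. -/
def Program.IsGround (P : Program R F) : Prop := ∀ c ∈ P, c.IsGround

/-- A ground query contains no variables. -/
def IsGroundQuery (Q : List (BodyGoal R F)) : Prop := ∀ g ∈ Q, g.vars = []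

end Programs

/-- A strict upper bound of a list of variables. -/
def varBound (l : List ℕ) : ℕ := l.foldr (fun x m => max (x + 1) m) 0

/-! ### The call graph

The two methods share the classification of rules.  A clause is given here by its head and by the
list of the literals in its body, `(true, a)` standing for `not a`.  The relation `same` says
that two positive literals are the same node of the call graph. -/

/-- An edge of the call graph, with the index of the clause that produced it; the weight is `1` if
`neg` holds and `0` otherwise. -/
structure Edge (α : Type u) where
  rule : ℕ
  src : α
  neg : Bool
  tgt : α

section CallGraph

variable {α : Type u}

def IsEdge (cs : List (Option α × List (Bool × α))) (e : Edge α) : Prop :=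
  ∃ body, cs[e.rule]? = some (some e.src, body) ∧ (e.neg, e.tgt) ∈ body

/-- An odd loop over negation: a cycle of the call graph, passing through every node at most once,
with an odd number of negations. -/
def IsOddLoop (same : α → α → Prop) (cs : List (Option α × List (Bool × α)))
    (cyc : List (Edge α)) : Prop :=
  cyc ≠ [] ∧ (∀ e ∈ cyc, IsEdge cs e) ∧
  List.IsChain (fun e e' => same e.tgt e'.src) (cyc ++ cyc.take 1) ∧
  cyc.Pairwise (fun e e' => ¬ same e.src e'.src) ∧
  Odd (cyc.countP fun e => e.neg)

/-- The `k`-th clause is an OLON rule: it is headless or produces an edge of an odd loop. -/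
def IsOLON (same : α → α → Prop) (cs : List (Option α × List (Bool × α))) (k : ℕ) : Prop :=
  (∃ body, cs[k]? = some (none, body)) ∨
  ∃ cyc, IsOddLoop same cs cyc ∧ ∃ e ∈ cyc, e.rule = k

/-- The indices of the OLON rules, in textual order. -/
def olonRules (same : α → α → Prop) (cs : List (Option α × List (Bool × α))) : List ℕ :=
  (List.range cs.length).filter fun k => IsOLON same cs k

end CallGraph

/-- For each entry of a call stack (most recent call first): the number of calls below it, the number
of negations on the way from it to the current call, and the entry.  The negations are the edges of
weight `1` of the call graph that have been followed, that is, the changes of sign between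
consecutive calls.  `s` is the sign of the current call and `c` counts the negations seen so far. -/
def negCounts {β : Type u} (sgn : β → Bool) (s : Bool) (c : ℕ) : List β → List (ℕ × ℕ × β)
  | [] => []
  | d :: rest =>
    let c' := if sgn d = s then c else c + 1
    (rest.length, c', d) :: negCounts sgn (sgn d) c' rest

/-! ### The propositional method

Atoms are elements of a type `α`.  The relation `comp` says that two atoms are `p` and `-p`. -/

namespace Propositional

/-- A goal is a literal or a truth value (a ground built-in operation). -/
inductive Goal (α : Type u)
  | lit (naf : Bool) (a : α)
  | truth (b : Prop)

structure Clause (α : Type u) where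
  head : Option α
  body : List (Goal α)

/-- Atoms of the program, the auxiliary atom for the dual of the `k`-th clause, and the
head of the sub-check for the `k`-th clause. -/
inductive Sym (α : Type u)
  | atom (a : α)
  | dual (k : ℕ)
  | chk (k : ℕ)

variable {α : Type u}

/-- Literals; the first component is `true` for negative literals. -/
abbrev Lit (α : Type u) := Bool × Sym α

def Goal.neg : Goal α → Goal α
  | .lit s a => .lit (!s) a
  | .truth b => .truth (¬ b)

def Goal.toInternal : Goal α → Goal (Sym α)
  | .lit s a => .lit s (.atom a)
  | .truth b => .truth b

/-- The negation of the head is appended to the body, if not already present. -/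
def Clause.checkBody (c : Clause α) : List (Goal α) :=
  match c.head with
  | none => c.body
  | some a => if Goal.lit true a ∈ c.body then c.body else c.body ++ [.lit true a]

/-- The bodies of the clauses for a literal.  `not a` has one clause, which calls the auxiliary
atom of each clause for `a`; that atom, and likewise the head of a sub-check, has one clause for the
negation of each goal in the body. -/
def bodies (P : List (Clause α)) : Lit α → List (List (Goal (Sym α)))
  | (false, .atom a) =>
    (P.filter fun c => c.head = some a).map fun c => c.body.map Goal.toInternal
  | (true, .atom a) =>
    [((List.range P.length).filter fun k => ∃ c, P[k]? = some c ∧ c.head = some a).map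
      fun k => .lit false (.dual k)]
  | (false, .dual k) =>
    match P[k]? with
    | none => []
    | some c => c.body.map fun g => [g.neg.toInternal]
  | (false, .chk k) =>
    match P[k]? with
    | none => []
    | some c => c.checkBody.map fun g => [g.neg.toInternal]
  | (true, _) => []

/-- Literals that exclude each other: `p` and `not p`, and also `p` and `-p`. -/
def Conflict (comp : α → α → Prop) (l d : Lit α) : Prop :=
  (l.1 ≠ d.1 ∧ l.2 = d.2) ∨
  (l.1 = false ∧ d.1 = false ∧ ∃ a b, comp a b ∧ l.2 = .atom a ∧ d.2 = .atom b)

def sign : Lit α → Bool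
  | (s, .atom _) => s
  | (_, .dual _) => true
  | (_, .chk _) => false

/-- Execution of a goal with call stack `stk` (most recent call first) and coinductive hypothesis
set `chs`; each answer is the coinductive hypothesis set after a success of the goal. -/
def exec (comp : α → α → Prop) (P : List (Clause α)) :
    ℕ → List (Lit α) → Goal (Sym α) → List (Lit α) → Outcome (List (Lit α))
  | 0, _, _, _ => halt .timeout
  | _ + 1, _, .truth b, chs => if b then pure chs else fail
  | n + 1, stk, .lit s a, chs =>
    if ∃ d ∈ chs ++ stk, Conflict comp (s, a) d then fail
    else if (s, a) ∈ chs then pure chs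
    else if ∃ e ∈ negCounts sign (sign (s, a)) 0 stk, e.2.2 = (s, a) ∧ e.2.1 = 0 then fail
    else if ∃ e ∈ negCounts sign (sign (s, a)) 0 stk,
        e.2.2 = (s, a) ∧ e.2.1 ≠ 0 ∧ Even e.2.1 then pure chs
    else alts ((bodies P (s, a)).map fun body =>
      (seq (exec comp P n ((s, a) :: stk)) body chs).map fun chs' => (s, a) :: chs')

def Goal.literal? : Goal α → Option (Bool × α)
  | .lit s a => some (s, a)
  | .truth _ => none

def skeleton (P : List (Clause α)) : List (Option α × List (Bool × α)) :=
  P.map fun c => (c.head, c.body.filterMap Goal.literal?)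

/-- The literals of the program in a coinductive hypothesis set. -/
def model (chs : List (Lit α)) : List (Bool × α) :=
  chs.filterMap fun l => match l.2 with
    | .atom a => some (l.1, a)
    | _ => none

/-- The propositional method: the NMR check is appended to the query and the resulting goals are
executed in order; the answers are the candidate models. -/
def run (comp same : α → α → Prop) (P : List (Clause α)) (Q : List (Goal α)) (n : ℕ) :
    Outcome (List (Bool × α)) :=
  (seq (exec comp P n [])
    (Q.map Goal.toInternal ++ (olonRules same (skeleton P)).map fun k => .lit false (.chk k))
    []).map model

end Propositional

/-! ### Variable stores, constructive unification and disunification -/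

/-- The variables at run time.  `sub` is the current (idempotent) substitution, `proh x` is the
prohibited value list of the variable `x`, the variables from `next` on are fresh, and `loop` lists
the loop variables. -/
structure Store (F : Type u) where
  sub : ℕ → Term F
  proh : ℕ → List (Term F)
  next : ℕ
  loop : List ℕ

namespace Store

variable {F : Type u}

def walk (st : Store F) (t : Term F) : Term F := t.subst st.sub

/-- The variable `x` is bound to `t`. -/
def bind (st : Store F) (x : ℕ) (t : Term F) : Store F :=
  { st with sub := fun y => (st.sub y).subst (Term.single x t) }

/-- `t` is added to the prohibited value list of `x`. -/
def prohibit (st : Store F) (x : ℕ) (t : Term F) : Store F :=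
  { st with proh := Function.update st.proh x
              (if t ∈ st.proh x then st.proh x else st.proh x ++ [t]) }

/-- The variables `x` and `y` are identified; the prohibited value list is the union of theirs. -/
def merge (st : Store F) (x y : ℕ) : Store F :=
  ({ st with proh := Function.update st.proh y
               (st.proh y ++ (st.proh x).filter fun t => t ∉ st.proh y) } : Store F).bind x (.var y)

def IsLoop (st : Store F) (x : ℕ) : Prop := ∃ y ∈ st.loop, st.sub y = .var x

/-- A variable and a non-variable: occurs check, then the value must not constructively unify (by
`unif`) with a prohibited value. -/
def bindValue (unif : Store F → Term F → Term F → Outcome (Store F)) (st : Store F)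
    (x : ℕ) (t : Term F) : Outcome (Store F) :=
  if x ∈ t.vars then fail
  else ifAny (alts ((st.proh x).map fun c => unif st t c)) (fun _ => fail) (pure (st.bind x t))

end Store

section Unification

variable {F : Type u}

def argPairs {k l : ℕ} (a : Fin k → Term F) (b : Fin l → Term F) : List (Term F × Term F) :=
  (List.ofFn a).zip (List.ofFn b)

/-- Constructive unification. -/
def unify : ℕ → Store F → Term F → Term F → Outcome (Store F)
  | 0, _, _, _ => halt .timeout
  | n + 1, st, s, t =>
    if (st.walk s).IsGround ∧ (st.walk t).IsGround then
      if st.walk s = st.walk t then pure st else fail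
    else match st.walk s, st.walk t with
      | .var x, .var y => if x = y then pure st else pure (st.merge x y)
      | .var x, t' => st.bindValue (unify n) x t'
      | s', .var y => st.bindValue (unify n) y s'
      | .app (k := i) f a, .app (k := j) g b =>
        if f = g ∧ i = j then seq (fun p st' => unify n st' p.1 p.2) (argPairs a b) st else fail
      | _, _ => fail

/-- Constructive disunification.  The disunification of two negatively constrained (possibly unbound)
variables is an error. -/
def disunify : ℕ → Store F → Term F → Term F → Outcome (Store F)
  | 0, _, _, _ => halt .timeout
  | n + 1, st, s, t =>
    if (st.walk s).IsGround ∧ (st.walk t).IsGround then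
      if st.walk s = st.walk t then fail else pure st
    else match st.walk s, st.walk t with
      | .var _, .var _ => halt .error
      | .var x, t' => pure (st.prohibit x t')
      | s', .var y => pure (st.prohibit y s')
      | .app (k := i) f a, .app (k := j) g b =>
        if f = g ∧ i = j then alts ((argPairs a b).map fun p => disunify n st p.1 p.2) else pure st
      | _, _ => pure st

/-- The ways to constrain the argument `a` of a call such that it no longer unifies with the argument
`e` of an earlier call, without touching the variables of the latter: a value must be prohibited for
`e`, or `e` is made a prohibited value for `a`.  Loop variables of `e` are left alone here, as they
can be constrained later. -/
def avoid : ℕ → Store F → Term F → Term F → Outcome (Store F)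
  | 0, _, _, _ => halt .timeout
  | n + 1, st, a, e =>
    if (st.walk a).IsGround ∧ (st.walk e).IsGround then
      if st.walk a = st.walk e then fail else pure st
    else match st.walk a, st.walk e with
      | a', .var x =>
        if st.IsLoop x then pure st else alts ((st.proh x).map fun c => unify n st a' c)
      | .var y, e' => pure (st.prohibit y e')
      | .app (k := i) f b, .app (k := j) g c =>
        if f = g ∧ i = j then alts ((argPairs b c).map fun p => avoid n st p.1 p.2) else pure st
      | _, _ => pure st

/-- The ways to constrain a loop variable in the argument `e` of an earlier call against the
corresponding part of the argument `a`. -/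
def avoidLoop : ℕ → Store F → Term F → Term F → Outcome (Store F)
  | 0, _, _, _ => halt .timeout
  | n + 1, st, a, e =>
    match st.walk a, st.walk e with
    | a', .var x => if st.IsLoop x then pure (st.prohibit x a') else fail
    | .app (k := i) f b, .app (k := j) g c =>
      if f = g ∧ i = j then alts ((argPairs b c).map fun p => avoidLoop n st p.1 p.2) else fail
    | _, _ => fail

/-- Constructive unification of lists of arguments. -/
def unifyArgs (n : ℕ) (st : Store F) (as bs : List (Term F)) : Outcome (Store F) :=
  if as.length = bs.length then seq (fun p st' => unify n st' p.1 p.2) (as.zip bs) st else fail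

/-- None of the variables `vs` has been bound to a value or got another prohibited value list on
the way from `st` to `st'`. -/
def Unaltered (st st' : Store F) (vs : List ℕ) : Prop :=
  ∀ x ∈ vs, ∃ y, st'.sub x = .var y ∧
    ∀ c, c ∈ (st.proh x).map st'.walk ↔ c ∈ (st'.proh y).map st'.walk

/-- Test for an exact match: constructive unification that alters no prohibited value list. -/
def exactMatch (n : ℕ) (st : Store F) (as bs : List (Term F)) : Outcome (Store F) :=
  (unifyArgs n st as bs).filter fun st' =>
    Unaltered st st' ((as ++ bs).flatMap fun t => (st.walk t).vars)

/-- Execution of a built-in operation (`naf`: of its negation).  It is an error if an operand of an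
arithmetic operation is not ground. -/
def evalTest (n : ℕ) (naf : Bool) (b : Builtin F) (st : Store F) : Outcome (Store F) :=
  match b.subst st.sub with
  | .eq s t => if naf then disunify n st s t else unify n st s t
  | .is s e =>
    if e.vars ≠ [] then halt .error
    else match e.eval with
      | some z => if naf then disunify n st s (.num z) else unify n st s (.num z)
      | none => if naf then pure st else fail
  | b' =>
    if b'.vars ≠ [] then halt .error
    else if (b'.Holds ↔ naf = false) then pure st else fail

/-- The domain of a variable in the s(ASP) universe is not empty: it can be constructively unified
with some element of the universe. -/
def DomainNonempty (st : Store F) (x : ℕ) : Prop :=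
  ∃ t ∈ Universe F, ∃ n, (unify n st (.var x) t).answers ≠ []

end Unification

/-! ### The rules of the s(ASP) method -/

/-- The predicates called at run time: those of the program (with the hyphen, if any), the auxiliary
predicate for the dual of the `k`-th clause, and the head of the sub-check for the `k`-th clause. -/
inductive Sym (R : Type v)
  | user (hyphen : Bool) (rel : R)
  | dual (k : ℕ)
  | chk (k : ℕ)

/-- Literals at run time. -/
structure Lit (R : Type v) (F : Type u) where
  naf : Bool
  sym : Sym R
  args : List (Term F)

/-- Goals at run time; `all x g` is `forall(x, g)`. -/
inductive Goal (R : Type v) (F : Type u)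
  | lit (l : Lit R F)
  | test (naf : Bool) (b : Builtin F)
  | all (x : ℕ) (g : Goal R F)

/-- A rule at run time, without the predicate of its head. -/
structure Rule (R : Type v) (F : Type u) where
  params : List (Term F)
  body : List (Goal R F)

section Rules

variable {R : Type v} {F : Type u}

def Lit.subst (σ : ℕ → Term F) (l : Lit R F) : Lit R F :=
  { l with args := l.args.map (Term.subst σ) }

def Goal.vars : Goal R F → List ℕ
  | .lit l => l.args.flatMap Term.vars
  | .test _ b => b.vars
  | .all x g => x :: g.vars

/-- Replacement of the free occurrences of `x`. -/
def Goal.inst (x : ℕ) (t : Term F) : Goal R F → Goal R F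
  | .lit l => .lit (l.subst (Term.single x t))
  | .test s b => .test s (b.subst (Term.single x t))
  | .all y g => if y = x then .all y g else .all y (g.inst x t)

/-- Renaming of all variables. -/
def Goal.shift (m : ℕ) : Goal R F → Goal R F
  | .lit l => .lit (l.subst fun x => .var (x + m))
  | .test s b => .test s (b.subst fun x => .var (x + m))
  | .all y g => .all (y + m) (g.shift m)

def Rule.bound (r : Rule R F) : ℕ :=
  varBound (r.params.flatMap Term.vars ++ r.body.flatMap Goal.vars)

def Rule.shift (m : ℕ) (r : Rule R F) : Rule R F :=
  ⟨r.params.map (Term.subst fun x => .var (x + m)), r.body.map (Goal.shift m)⟩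

def BodyGoal.toGoal : BodyGoal R F → Goal R F
  | .lit s a => .lit ⟨s, .user a.hyphen a.rel, a.args⟩
  | .test s b => .test s b

/-- Abstraction of the head: an argument that is not a variable, or that is a variable which already
occurred as an argument, is replaced by a new variable (`m`, `m + 1`, …) and a unification of the new
variable with the argument.  The result is the list of the variables in the new head, and the list
of the unifications. -/
def abstractArgs (m : ℕ) (seen : List ℕ) : List (Term F) → List ℕ × List (BodyGoal R F)
  | [] => ([], [])
  | t :: ts =>
    match t with
    | .var x =>
      if x ∈ seen then
        let r := abstractArgs (m + 1) seen ts
        (m :: r.1, .test false (.eq (.var m) (.var x)) :: r.2)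
      else
        let r := abstractArgs m (x :: seen) ts
        (x :: r.1, r.2)
    | t =>
      let r := abstractArgs (m + 1) seen ts
      (m :: r.1, .test false (.eq (.var m) t) :: r.2)

/-- The variables in the head of a clause, after abstraction. -/
def Clause.headVars (c : Clause R F) : List ℕ :=
  (abstractArgs (R := R) (varBound c.vars) [] c.headArgs).1

/-- The unifications abstracted from the head of a clause. -/
def Clause.headGoals (c : Clause R F) : List (BodyGoal R F) :=
  (abstractArgs (varBound c.vars) [] c.headArgs).2

/-- The variables of the abstracted clause that occur in its body, but not in its head. -/
def Clause.bodyVars (c : Clause R F) : List ℕ :=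
  (((c.headGoals ++ c.body).flatMap BodyGoal.vars).dedup).filter fun x => x ∉ c.headVars

/-- One conjunction for each goal of a list: the goals before it, and then its negation. -/
def negations (gs : List (BodyGoal R F)) : List (List (BodyGoal R F)) :=
  gs.mapIdx fun i g => gs.take i ++ [g.neg]

/-- The negation of the body of an abstracted clause, as a list of conjunctions.  For a clause
without variables the goals of the body are independent of each other, and De Morgan's laws apply to
them; otherwise each negated goal is preceded by all the goals before it. -/
def Clause.dualBodies (c : Clause R F) : List (List (BodyGoal R F)) :=
  if c.IsGround then negations c.headGoals ++ c.body.map fun g => c.headGoals ++ [g.neg]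
  else negations (c.headGoals ++ c.body)

/-- The rules of the auxiliary predicate for the dual of a clause, whose arguments are the variables
of the head and the body variables. -/
def Clause.dualRules (c : Clause R F) : List (Rule R F) :=
  c.dualBodies.map fun gs => ⟨(c.headVars ++ c.bodyVars).map .var, gs.map BodyGoal.toGoal⟩

/-- The clause from which a sub-check is made: the negation of the head is appended to the body, if
not already present. -/
def Clause.toCheck (c : Clause R F) : Clause R F :=
  match c.head with
  | none => c
  | some a =>
    if BodyGoal.lit true a ∈ c.body then c else ⟨c.head, c.body ++ [.lit true a]⟩

/-- The call of `sym` with the arguments `0, …, m + r - 1`, the last `r` of which are universally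
quantified. -/
def quantified (sym : Sym R) (m r : ℕ) : Goal R F :=
  (List.range r).foldr (fun i g => .all (m + i) g)
    (.lit ⟨false, sym, (List.range (m + r)).map .var⟩)

/-- The clause has the predicate `hyphen`, `rel` with `arity` arguments in its head. -/
def Clause.Defines (hyphen : Bool) (rel : R) (arity : ℕ) (c : Clause R F) : Prop :=
  ∃ a, c.head = some a ∧ a.hyphen = hyphen ∧ a.rel = rel ∧ a.args.length = arity

/-- The dual rule of a predicate: the duals of all its clauses must succeed, for all values of their
body variables. -/
def dualRule (P : Program R F) (hyphen : Bool) (rel : R) (arity : ℕ) : Rule R F :=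
  ⟨(List.range arity).map .var,
    ((List.range P.length).filterMap fun k => match P[k]? with
      | none => none
      | some c =>
        if c.Defines hyphen rel arity then some (quantified (.dual k) arity c.bodyVars.length)
        else none)⟩

/-- The rules for a literal. -/
def rulesFor (P : Program R F) (l : Lit R F) : List (Rule R F) :=
  match l.naf, l.sym with
  | false, .user h r =>
    (P.filter fun c => c.Defines h r l.args.length).map
      fun c => ⟨c.headArgs, c.body.map BodyGoal.toGoal⟩
  | true, .user h r => [dualRule P h r l.args.length]
  | false, .dual k => (P[k]?.map Clause.dualRules).getD []
  | false, .chk k => (P[k]?.map fun c => c.toCheck.dualRules).getD []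
  | true, _ => []

end Rules

/-! ### The s(ASP) method -/

/-- The state of an execution: the store, the coinductive hypothesis set, and the coinductive
successes of calls whose ancestor (given by its depth in the call stack) is still being executed. -/
structure State (R : Type v) (F : Type u) extends Store F where
  chs : List (Lit R F)
  pending : List (ℕ × Lit R F)

section Method

variable {R : Type v} {F : Type u}

/-- Two literals are instances of the same literal. -/
def Lit.Same (l d : Lit R F) : Prop :=
  l.naf = d.naf ∧ l.sym = d.sym ∧ l.args.length = d.args.length

/-- The predicates of two literals exclude each other (`p` and `not p`, and also `p` and `-p`) for
the same arguments. -/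
def Lit.Conflict (l d : Lit R F) : Prop :=
  l.args.length = d.args.length ∧
  ((l.naf ≠ d.naf ∧ l.sym = d.sym) ∨
   (l.naf = false ∧ d.naf = false ∧ ∃ h r, l.sym = .user h r ∧ d.sym = .user (!h) r))

def Lit.sign (l : Lit R F) : Bool :=
  match l.sym with
  | .user _ _ => l.naf
  | .dual _ => true
  | .chk _ => false

def conflicts (l : Lit R F) (ds : List (Lit R F)) : List (Lit R F) :=
  ds.filter fun d => l.Conflict d

/-- Coinductive failure as a filter: one argument of the call `l` (the first one first) is
constrained such that no literal in `ds` still unifies with the negation of `l`. -/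
def restrict (n : ℕ) (l : Lit R F) (ds : List (Lit R F)) (st : Store F) : Outcome (Store F) :=
  ifAny (alts (ds.map fun d => unifyArgs n st l.args d.args))
    (fun _ => alts ((List.range l.args.length).map fun i =>
      seq (fun d st' => ifAny (unifyArgs n st' l.args d.args)
        (fun _ => alts (((l.args.zip d.args)[i]?.toList).map fun p => avoid n st' p.1 p.2))
        (pure st')) ds st))
    (pure st)

/-- The call `l` has succeeded coinductively by its ancestor at depth `d`. -/
def State.record (st : State R F) (d : ℕ) (l : Lit R F) : State R F :=
  { st with pending := (d, l) :: st.pending }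

def State.setStore (st : State R F) (s : Store F) : State R F := { st with toStore := s }

/-- Examination of the call stack for cycles through the call `l`, and expansion by `expand` if
none of them decides the call. -/
def checkStack (n : ℕ) (stk : List (Lit R F)) (l : Lit R F) (st : State R F)
    (expand : Outcome (State R F)) : Outcome (State R F) :=
  let cycles := (negCounts Lit.sign l.sign 0 stk).filter fun e => l.Same e.2.2
  let positive := cycles.filter fun e => e.2.1 = 0
  let even := cycles.filter fun e => e.2.1 ≠ 0 ∧ Even e.2.1
  ifAny (alts (positive.map fun e => exactMatch n st.toStore l.args e.2.2.args))
    (fun _ => fail)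
    (ifAny (alts (even.map fun e => (exactMatch n st.toStore l.args e.2.2.args).map fun _ => e.1))
      (fun d => pure (st.record d l))
      (orElse
        (alts (even.map fun e => (unifyArgs n st.toStore l.args e.2.2.args).map
          fun s => (st.setStore s).record e.1 l))
        expand))

/-- The check of a call against the coinductive hypothesis set, followed by that against the call
stack. -/
def call (n : ℕ) (stk : List (Lit R F)) (l : Lit R F) (st : State R F)
    (expand : State R F → Outcome (State R F)) : Outcome (State R F) :=
  let ds := conflicts l (st.chs ++ stk)
  ifAny (alts (ds.map fun d => exactMatch n st.toStore l.args d.args))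
    (fun _ => fail)
    (ifAny (alts ((st.chs.filter fun d => l.Same d).map
        fun d => exactMatch n st.toStore l.args d.args))
      (fun _ => pure st)
      ((restrict n l ds st.toStore).bind fun s =>
        checkStack n stk l (st.setStore s) (expand (st.setStore s))))

/-- The variables that occur in the call `l` and in a recursive call that succeeded coinductively by
it; `d` is the depth of `l`. -/
def loopVars (d : ℕ) (l : Lit R F) (st : State R F) : List ℕ :=
  (l.args.flatMap fun t => (st.walk t).vars).filter fun x =>
    ∃ p ∈ st.pending, p.1 = d ∧ x ∈ p.2.args.flatMap fun t => (st.walk t).vars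

/-- The call `l` at depth `d` has succeeded by expansion: loop variables of entries of the
coinductive hypothesis set which contradict `l` are constrained, the new loop variables are
determined, and `l` is added to the coinductive hypothesis set. -/
def close (n : ℕ) (d : ℕ) (l : Lit R F) (st : State R F) : Outcome (State R F) :=
  (seq (fun e s =>
      if ∃ t ∈ e.args, ∃ x ∈ (s.walk t).vars, s.IsLoop x then
        ifAny (unifyArgs n s l.args e.args)
          (fun _ => alts ((l.args.zip e.args).map fun p => avoidLoop n s p.1 p.2))
          (pure s)
      else pure s)
    (conflicts l st.chs) st.toStore).map fun s =>
      { toStore := { s with loop := loopVars d l (st.setStore s) ++ s.loop }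
        chs := l :: st.chs
        pending := st.pending.filter fun p => p.1 ≠ d }

/-- A goal that is a literal is added to the coinductive hypothesis set. -/
def State.addGoal (st : State R F) : Goal R F → State R F
  | .lit l => { st with chs := l :: st.chs }
  | _ => st

/-- The for-all over `y` has succeeded: `y` is no longer a loop variable, and `g x` is added to the
coinductive hypothesis set for an unbound variable `x`. -/
def State.closeAll (st : State R F) (y : ℕ) (g : Term F → Goal R F) : State R F :=
  State.addGoal
    { st with
      next := st.next + 1
      loop := st.loop.filter fun x => st.sub x ≠ .var y }
    (g (.var st.next))

/-- Execution of a goal with call stack `stk` (most recent call first); each answer is the state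
after a success of the goal. -/
def exec (P : Program R F) :
    ℕ → List (Lit R F) → Goal R F → State R F → Outcome (State R F)
  | 0, _, _, _ => halt .timeout
  | n + 1, _, .test s b, st => (evalTest n s b st.toStore).map st.setStore
  | n + 1, stk, .all x g, st =>
    (exec P n stk (g.inst x (.var st.next)) { st with next := st.next + 1 }).bind fun st' =>
      match st'.sub st.next with
      | .var y =>
        (seq (exec P n stk) ((st'.proh y).map fun c => g.inst x (st'.walk c))
          (st'.addGoal (g.inst x (.var st.next)))).map fun st'' =>
            st''.closeAll y fun t => g.inst x t
      | _ => fail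
  | n + 1, stk, .lit l, st =>
    call n stk l st fun st₀ =>
      alts ((rulesFor P l).map fun r =>
        (unifyArgs n { st₀.toStore with next := st₀.next + r.bound } l.args
            (r.shift st₀.next).params).bind fun s =>
          (seq (exec P n (l :: stk)) (r.shift st₀.next).body (st₀.setStore s)).bind
            (close n stk.length l))

/-- How positive literals are identified with the nodes of the call graph. -/
inductive Granularity
  /-- Literals with the same predicate symbol and the same number of arguments are one node. -/
  | predicates
  /-- Different ground literals are different nodes; generally, a goal leads to the rules whose head
  unifies with it, variables being renamed apart. -/
  | atoms

/-- Identification of literals in the call graph. -/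
def Granularity.Same (γ : Granularity) (a b : Atom R F) : Prop :=
  a.hyphen = b.hyphen ∧ a.rel = b.rel ∧
  match γ with
  | .predicates => a.args.length = b.args.length
  | .atoms => ∃ σ τ : ℕ → Term F, a.args.map (Term.subst σ) = b.args.map (Term.subst τ)

def BodyGoal.literal? : BodyGoal R F → Option (Bool × Atom R F)
  | .lit s a => some (s, a)
  | .test _ _ => none

def skeleton (P : Program R F) : List (Option (Atom R F) × List (Bool × Atom R F)) :=
  P.map fun c => (c.head, c.body.filterMap BodyGoal.literal?)

/-- The body of the NMR check: the sub-checks for all OLON rules, for all values of their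
variables. -/
def nmrCheck (γ : Granularity) (P : Program R F) : List (Goal R F) :=
  (olonRules γ.Same (skeleton P)).filterMap fun k => P[k]?.map fun c =>
    quantified (.chk k) 0 (c.toCheck.headVars.length + c.toCheck.bodyVars.length)

/-- The goals to be executed for a query: the body of the NMR check (with variables renamed apart from
those of the query) is appended to the query. -/
def initialGoals (γ : Granularity) (P : Program R F) (Q : List (BodyGoal R F)) : List (Goal R F) :=
  Q.map BodyGoal.toGoal ++ (nmrCheck γ P).map (Goal.shift (varBound (Q.flatMap BodyGoal.vars)))

def State.initial (gs : List (Goal R F)) : State R F :=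
  { sub := .var
    proh := fun _ => []
    next := varBound (gs.flatMap Goal.vars)
    loop := []
    chs := []
    pending := [] }

/-- An answer of the s(ASP) method: the literals of the program in the coinductive hypothesis set,
the prohibited value lists of their variables, and the loop variables among them. -/
structure Answer (R : Type v) (F : Type u) where
  lits : List (Bool × Atom R F)
  proh : ℕ → List (Term F)
  loop : Set ℕ

def State.lits (st : State R F) : List (Bool × Atom R F) :=
  st.chs.filterMap fun l => match l.sym with
    | .user h r => some (l.naf, ⟨h, r, l.args.map st.walk⟩)
    | _ => none

def State.toAnswer (st : State R F) : Answer R F :=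
  let vs := st.lits.flatMap fun l => l.2.vars
  { lits := st.lits
    proh := fun x => if x ∈ vs then (st.proh x).map st.walk else []
    loop := {x | x ∈ vs ∧ st.IsLoop x} }

/-- The s(ASP) method: the NMR check is appended to the query, the resulting goals are executed in
order, and finally the domains of the loop variables are checked. -/
def sasp (γ : Granularity) (P : Program R F) (Q : List (BodyGoal R F)) (n : ℕ) :
    Outcome (Answer R F) :=
  ((seq (exec P n []) (initialGoals γ P Q) (State.initial (initialGoals γ P Q))).filter
    fun st => ∀ x, st.IsLoop x → DomainNonempty st.toStore x).map State.toAnswer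

/-! ### Ground programs as propositional programs -/

/-- `p` and `-p`. -/
def Atom.Complementary (a b : Atom R F) : Prop :=
  a.hyphen = !b.hyphen ∧ a.rel = b.rel ∧ a.args = b.args

/-- Identification of propositional atoms in the call graph. -/
def Granularity.SameProp (γ : Granularity) (a b : Atom R F) : Prop :=
  match γ with
  | .predicates => a.hyphen = b.hyphen ∧ a.rel = b.rel ∧ a.args.length = b.args.length
  | .atoms => a = b

def BodyGoal.toProp : BodyGoal R F → Propositional.Goal (Atom R F)
  | .lit s a => .lit s a
  | .test s b => .truth (b.Holds ↔ s = false)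

def Clause.toProp (c : Clause R F) : Propositional.Clause (Atom R F) :=
  ⟨c.head, c.body.map BodyGoal.toProp⟩

/-- The propositional method for a ground program: the ground literals are the atoms, and the ground
built-in operations are truth values. -/
def propositional (γ : Granularity) (P : Program R F) (Q : List (BodyGoal R F)) (n : ℕ) :
    Outcome (List (Bool × Atom R F)) :=
  Propositional.run Atom.Complementary γ.SameProp (P.map Clause.toProp) (Q.map BodyGoal.toProp) n

/-- A candidate model of a ground program as an answer: there are no variables. -/
def Answer.ofGround (M : List (Bool × Atom R F)) : Answer R F := ⟨M, fun _ => [], ∅⟩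

end Method

/-! ### Behaviour of a method -/

section Behaviour

variable {α : Type u} {β : Type v}

/-- The `i`-th answer of an execution is `a`. -/
def HasAnswer (run : ℕ → Outcome α) (i : ℕ) (a : α) : Prop :=
  ∀ᶠ n in Filter.atTop, (run n).answers[i]? = some a

/-- The execution stops (by exhausting the search space, or by an error). -/
def Stops (run : ℕ → Outcome α) (s : Status) : Prop :=
  s ≠ .timeout ∧ ∀ᶠ n in Filter.atTop, (run n).status = s

/-- Two executions behave in the same way, up to the translation `f` of answers: they have the same
answers in the same order, and the one stops if and only if the other does, in the same way. -/
def SameBehaviour (f : β → α) (run : ℕ → Outcome α) (run' : ℕ → Outcome β) : Prop :=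
  (∀ i a, HasAnswer run i a ↔ ∃ b, HasAnswer run' i b ∧ f b = a) ∧
  ∀ s, Stops run s ↔ Stops run' s

end Behaviour

end

end SASP

/-! On ground data constructive unification degenerates. Unification and exact match of ground
arguments are tests for equality, so `restrict` has nothing to constrain once the exact matches have
been excluded. Ground built-in operations are truth values and raise no error. No loop variables
arise, because all calls recorded as pending are ground (`close_eq`). Hence a ground call undergoes
the same tests as its propositional image under `absLit` (`conflict_iff_absLit`, `same_iff_absLit`).

The proof is a simulation. The two methods need different recursion depths, so runs are not compared
bound by bound: `Simulates` says that both outcomes are eventually constant and exhaust the search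
space, and that the answers are related one by one in the same order. This notion is closed under
alternatives and sequencing. Both executions therefore terminate, and errors do not occur on either
side.

Termination comes from the loop tests. Between two occurrences of the same literal in a call stack
the number of sign changes is even (`even_of_mem_negCounts`), so a recurring call fails when this
number is zero and succeeds otherwise. An expanded call is thus not on the stack. The literals that
can be called form a finite set, and `simulatesCalls` is an induction on the number of those not yet
on the stack.

The methods differ in two places. The first is the call of `not p`: the predicate method calls the
duals of all clauses for the predicate, the propositional method only those of the clauses with head
`p`. A surplus call has arguments different from those in the head of its clause, and it succeeds
exactly once, by the rule for the first argument that differs (`simulates_dual_of_ne`). Its entry in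
the CHS is not an image of any propositional literal and is invisible to later propositional tests.

The second is the NMR check, where a sub-check is quantified over all head arguments. Let `t₀, t₁,
…` be the arguments in the head. When the first arguments have these values and the next one is a
new variable, the first answer merely prohibits the prescribed value for that variable and leaves
the later ones unconstrained, so the inner for-alls succeed at once, and the for-all over it retries
with the prescribed value itself. Iterating this, one arrives at the ground sub-check, which is what
the propositional method executes. All other answers bind a quantified variable to a value or retry
some later argument; either way they fail in the end at a for-all whose variable is bound. Sub-check
entries left behind in the CHS cannot match the later calls, because the prohibited value stands in
the way (`Blocked`). This is `chkSpec_allFrom`, by induction on the number of for-alls. -/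

namespace SASP

noncomputable section

open scoped Classical

universe u v w

open Outcome

/-! ### Outcomes form a monad: laws of alternatives, sequencing and committed choice. -/

namespace Outcome

variable {α : Type u} {β : Type v} {γ : Type w}

theorem orElse_fail (o : Outcome α) : orElse o fail = o := by
  rcases o with ⟨l, s⟩
  cases s <;> simp [orElse, fail, halt]

theorem fail_orElse (o : Outcome α) : orElse fail o = o := by
  rcases o with ⟨l, s⟩
  simp [orElse, fail, halt]

theorem alts_nil : alts ([] : List (Outcome α)) = fail := rfl

theorem alts_cons (o : Outcome α) (os : List (Outcome α)) :
    alts (o :: os) = orElse o (alts os) := rfl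

theorem orElse_assoc (o₁ o₂ o₃ : Outcome α) :
    (o₁.orElse o₂).orElse o₃ = o₁.orElse (o₂.orElse o₃) := by
  rcases o₁ with ⟨l, s⟩
  rcases o₂ with ⟨l', s'⟩
  cases s <;> cases s' <;> simp [orElse]

theorem alts_append (os os' : List (Outcome α)) :
    alts (os ++ os') = orElse (alts os) (alts os') := by
  induction os with
  | nil => simp [alts_nil, fail_orElse]
  | cons o os ih => rw [List.cons_append, alts_cons, alts_cons, ih, orElse_assoc]

theorem alts_eq_fail {os : List (Outcome α)} (h : ∀ o ∈ os, o = fail) : alts os = fail := by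
  induction os with
  | nil => rfl
  | cons o os ih =>
    rw [alts_cons, h o (by simp), fail_orElse, ih fun o ho => h o (by simp [ho])]

theorem pure_bind (a : α) (f : α → Outcome β) : (pure a).bind f = f a := by
  change orElse (orElse (f a) fail) fail = _
  rw [orElse_fail, orElse_fail]

theorem fail_bind (f : α → Outcome β) : (fail : Outcome α).bind f = fail := by
  simp [Outcome.bind, fail, halt, alts, orElse]

theorem fail_map (f : α → β) : (fail : Outcome α).map f = fail := rfl

theorem pure_map (f : α → β) (a : α) : (pure a).map f = pure (f a) := rfl

theorem bind_done (l : List α) (f : α → Outcome β) :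
    (⟨l, .done⟩ : Outcome α).bind f = alts (l.map f) :=
  orElse_fail _

theorem halt_orElse {s : Status} (hs : s ≠ .done) (o : Outcome α) :
    (halt s).orElse o = halt s := by
  cases s <;> simp_all [orElse, halt]

theorem orElse_bind (o o' : Outcome α) (f : α → Outcome β) :
    (o.orElse o').bind f = (o.bind f).orElse (o'.bind f) := by
  rcases o with ⟨l, s⟩
  by_cases hs : s = .done
  · subst hs
    rw [bind_done]
    simp only [orElse, Outcome.bind, List.map_append, alts_append]
    exact orElse_assoc _ _ _
  · rw [show (⟨l, s⟩ : Outcome α).orElse o' = ⟨l, s⟩ by cases s <;> simp_all [orElse]]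
    simp only [Outcome.bind]
    rw [orElse_assoc, halt_orElse hs]

theorem halt_bind (s : Status) (f : α → Outcome β) : (halt s).bind f = halt s :=
  fail_orElse _

theorem alts_bind (os : List (Outcome α)) (f : α → Outcome β) :
    (alts os).bind f = alts (os.map fun o => o.bind f) := by
  induction os with
  | nil => exact fail_bind f
  | cons o os ih => rw [alts_cons, orElse_bind, ih, List.map_cons, alts_cons]

theorem bind_assoc (o : Outcome α) (f : α → Outcome β) (g : β → Outcome γ) :
    (o.bind f).bind g = o.bind fun a => (f a).bind g := by
  rw [show o.bind f = orElse (alts (o.answers.map f)) (halt o.status) from rfl, orElse_bind,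
    alts_bind, halt_bind, List.map_map]
  rfl

theorem map_eq_bind (f : α → β) (o : Outcome α) : o.map f = o.bind fun a => pure (f a) := by
  have h : ∀ l : List α, alts (l.map fun a => pure (f a)) = ⟨l.map f, .done⟩ := by
    intro l
    induction l with
    | nil => rfl
    | cons a l ih => rw [List.map_cons, alts_cons, ih]; rfl
  rw [Outcome.bind, h]
  simp [Outcome.map, orElse, halt]

theorem seq_nil (f : γ → α → Outcome α) (a : α) : seq f [] a = pure a := rfl

theorem seq_cons (f : γ → α → Outcome α) (g : γ) (gs : List γ) (a : α) :
    seq f (g :: gs) a = (f g a).bind (seq f gs) := rfl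

theorem seq_append (f : γ → α → Outcome α) (gs gs' : List γ) (a : α) :
    seq f (gs ++ gs') a = (seq f gs a).bind (seq f gs') := by
  induction gs generalizing a with
  | nil => rw [List.nil_append, seq_nil, pure_bind]
  | cons g gs ih =>
    rw [List.cons_append, seq_cons, seq_cons, bind_assoc]
    congr 1
    funext b
    exact ih b

/-- The alternatives selected by a decidable test. -/
theorem alts_ite (ds : List γ) (p : γ → Prop) (f : γ → α) :
    alts (ds.map fun d => if p d then pure (f d) else fail) =
      ⟨(ds.filter fun d => p d).map f, .done⟩ := by
  induction ds with
  | nil => rfl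
  | cons d ds ih =>
    rw [List.map_cons, alts_cons, ih]
    by_cases h : p d <;> simp [h, orElse, Outcome.pure, fail, halt]

/-- Tests on ground terms have this shape: each succeeds exactly once or fails. As neither branch
depends on the answer committed to, only the existence of a successful test matters. -/
theorem ifAny_alts_const (ds : List γ) (o : γ → Outcome α) (p : γ → Prop) (f : γ → α)
    (ho : ∀ d ∈ ds, (p d → o d = pure (f d)) ∧ (¬ p d → o d = fail)) (y no : Outcome β) :
    ifAny (alts (ds.map o)) (fun _ => y) no = if ∃ d ∈ ds, p d then y else no := by
  rw [List.map_congr_left (g := fun d => if p d then pure (f d) else fail) fun d hd => ?_, alts_ite]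
  · induction ds with
    | nil => simp [ifAny]
    | cons d ds ih =>
      by_cases h : p d
      · simp [h, ifAny]
      · rw [List.filter_cons_of_neg (by simpa using h), ih fun d hd => ho d (by simp [hd])]
        simp [h]
  · split_ifs with h
    exacts [(ho d hd).1 h, (ho d hd).2 h]

/-- The answer committed to comes from the first element of `ds` that satisfies `p`, which does not
involve `i`. The witness can therefore be chosen once for all recursion bounds. -/
theorem ifAny_alts_of_exists {ι : Type*} {ds : List γ} {o : ι → γ → Outcome α} {p : γ → Prop}
    {f : γ → α}
    (ho : ∀ i, ∀ d ∈ ds, (p d → o i d = pure (f d)) ∧ (¬ p d → o i d = fail)) (h : ∃ d ∈ ds, p d)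
    (y : ι → α → Outcome β) (no : ι → Outcome β) :
    ∃ d ∈ ds, ∀ i, ifAny (alts (ds.map (o i))) (y i) (no i) = y i (f d) := by
  have hs : ∀ i, alts (ds.map (o i)) = ⟨(ds.filter fun d => p d).map f, .done⟩ := fun i => by
    rw [← alts_ite]
    refine congrArg alts (List.map_congr_left fun d hd => ?_)
    split_ifs with h
    exacts [(ho i d hd).1 h, (ho i d hd).2 h]
  obtain ⟨d, hd, hp⟩ := h
  have hm : d ∈ ds.filter fun d => p d := by simp [hd, hp]
  cases hl : ds.filter fun d => p d with
  | nil => simp [hl] at hm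
  | cons d' l =>
    have : d' ∈ ds.filter fun d => p d := by rw [hl]; simp
    exact ⟨d', (List.mem_filter.1 this).1, fun i => by rw [hs, hl]; simp [ifAny]⟩

theorem ifAny_alts_of_not_exists {ds : List γ} {o : γ → Outcome α}
    (ho : ∀ d ∈ ds, o d = fail) (y : α → Outcome β) (no : Outcome β) :
    ifAny (alts (ds.map o)) y no = no := by
  rw [alts_eq_fail (by simpa using ho)]
  rfl

/-- Filtering the alternatives by a condition that only excludes failures. -/
theorem alts_filter_map (l : List γ) (p q : γ → Prop) [DecidablePred p] [DecidablePred q]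
    (f : γ → Outcome α)
    (hqp : ∀ x ∈ l, q x → p x) (hf : ∀ x ∈ l, p x → ¬ q x → f x = fail) :
    alts ((l.filter fun x => p x).map f) = alts ((l.filter fun x => q x).map f) := by
  induction l with
  | nil => rfl
  | cons x l ih =>
    have ih' := ih (fun y hy => hqp y (by simp [hy])) (fun y hy => hf y (by simp [hy]))
    by_cases hq : q x
    · have hp := hqp x (by simp) hq
      simp [hp, hq, alts_cons, ih']
    · by_cases hp : p x
      · simp [hp, hq, alts_cons, ih', hf x (by simp) hp hq, fail_orElse]
      · simp [hp, hq, ih']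

end Outcome

/-! ### Convergence for growing bounds on the depth of the recursion -/

section Convergence

open Filter

variable {α : Type*} {β : Type*} {γ : Type*} {δ : Type*}

/-- `run` eventually has the outcome `o`. -/
def Converges (run : ℕ → Outcome α) (o : Outcome α) : Prop := ∀ᶠ n in atTop, run n = o

/-- Each use pays for one unfolding of a recursive function, whose value at the bound `0` is a
timeout. -/
theorem Converges.of_succ {run : ℕ → Outcome α} {o : Outcome α}
    (h : Converges (fun n => run (n + 1)) o) : Converges run o := by
  obtain ⟨N, hN⟩ := eventually_atTop.1 h
  refine eventually_atTop.2 ⟨N + 1, fun n hn => ?_⟩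
  obtain ⟨m, rfl⟩ : ∃ m, n = m + 1 := ⟨n - 1, by omega⟩
  exact hN m (by omega)

theorem converges_const (o : Outcome α) : Converges (fun _ => o) o := Eventually.of_forall fun _ => rfl

theorem Converges.orElse {f g : ℕ → Outcome α} {o o' : Outcome α} (hf : Converges f o)
    (hg : Converges g o') : Converges (fun n => (f n).orElse (g n)) (o.orElse o') := by
  filter_upwards [hf, hg] with n h h'
  rw [h, h']

theorem Converges.map {f : ℕ → Outcome α} {o : Outcome α} (g : α → β) (hf : Converges f o) :
    Converges (fun n => (f n).map g) (o.map g) := by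
  filter_upwards [hf] with n h
  rw [h]

/-- Both outcomes are finite, and their answers correspond to each other. -/
def OutcomeRel (r : α → β → Prop) (o : Outcome α) (o' : Outcome β) : Prop :=
  o.status = .done ∧ o'.status = .done ∧ List.Forall₂ r o.answers o'.answers

theorem OutcomeRel.orElse {r : α → β → Prop} {o₁ o₂ : Outcome α} {o₁' o₂' : Outcome β}
    (h₁ : OutcomeRel r o₁ o₁') (h₂ : OutcomeRel r o₂ o₂') :
    OutcomeRel r (o₁.orElse o₂) (o₁'.orElse o₂') := by
  rcases o₁ with ⟨a, s⟩; rcases o₁' with ⟨a', s'⟩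
  obtain ⟨rfl, rfl, h⟩ := h₁
  exact ⟨h₂.1, h₂.2.1, List.rel_append h h₂.2.2⟩

theorem outcomeRel_fail (r : α → β → Prop) : OutcomeRel r fail fail := ⟨rfl, rfl, .nil⟩

theorem outcomeRel_pure {r : α → β → Prop} {a : α} {b : β} (h : r a b) :
    OutcomeRel r (pure a) (pure b) := ⟨rfl, rfl, .cons h .nil⟩

/-- Two executions stop, and their answers correspond to each other. -/
def Simulates (r : α → β → Prop) (run : ℕ → Outcome α) (run' : ℕ → Outcome β) : Prop :=
  ∃ o o', Converges run o ∧ Converges run' o' ∧ OutcomeRel r o o'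

theorem Simulates.of_succ {r : α → β → Prop} {f : ℕ → Outcome α} {f' : ℕ → Outcome β}
    (h : Simulates r (fun n => f (n + 1)) (fun n => f' (n + 1))) : Simulates r f f' := by
  obtain ⟨o, o', h, h', hr⟩ := h
  exact ⟨o, o', h.of_succ, h'.of_succ, hr⟩

theorem Simulates.of_succ_left {r : α → β → Prop} {f : ℕ → Outcome α} {f' : ℕ → Outcome β}
    (h : Simulates r (fun n => f (n + 1)) f') : Simulates r f f' := by
  obtain ⟨o, o', h, h', hr⟩ := h
  exact ⟨o, o', h.of_succ, h', hr⟩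

theorem Simulates.add {r : α → β → Prop} {f : ℕ → Outcome α} {f' : ℕ → Outcome β}
    (h : Simulates r f f') (k : ℕ) : Simulates r (fun n => f (n + k)) (fun n => f' (n + k)) := by
  obtain ⟨o, o', h, h', hr⟩ := h
  exact ⟨o, o', (tendsto_add_atTop_nat k).eventually h, (tendsto_add_atTop_nat k).eventually h',
    hr⟩

theorem Simulates.mono {r s : α → β → Prop} {f : ℕ → Outcome α} {f' : ℕ → Outcome β}
    (h : Simulates r f f') (hrs : ∀ a b, r a b → s a b) : Simulates s f f' := by
  obtain ⟨o, o', h, h', h₁, h₂, hr⟩ := h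
  exact ⟨o, o', h, h', h₁, h₂, hr.imp hrs⟩

theorem simulates_fail (r : α → β → Prop) : Simulates r (fun _ => fail) (fun _ => fail) :=
  ⟨_, _, converges_const _, converges_const _, outcomeRel_fail r⟩

theorem simulates_pure {r : α → β → Prop} {a : α} {b : β} (h : r a b) :
    Simulates r (fun _ => pure a) (fun _ => pure b) :=
  ⟨_, _, converges_const _, converges_const _, outcomeRel_pure h⟩

theorem Simulates.orElse {r : α → β → Prop} {f g : ℕ → Outcome α} {f' g' : ℕ → Outcome β}
    (h : Simulates r f f') (h' : Simulates r g g') :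
    Simulates r (fun n => (f n).orElse (g n)) (fun n => (f' n).orElse (g' n)) := by
  obtain ⟨o, o', h₁, h₂, hr⟩ := h
  obtain ⟨p, p', h₁', h₂', hr'⟩ := h'
  exact ⟨_, _, h₁.orElse h₁', h₂.orElse h₂', hr.orElse hr'⟩

/-- The alternatives are finitely many, so their thresholds for the recursion bound have a common
upper bound. -/
theorem Simulates.alts {r : α → β → Prop} {l : List γ} {l' : List δ}
    {f : ℕ → γ → Outcome α} {f' : ℕ → δ → Outcome β}
    (h : List.Forall₂ (fun x x' => Simulates r (fun n => f n x) (fun n => f' n x')) l l') :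
    Simulates r (fun n => Outcome.alts (l.map (f n))) (fun n => Outcome.alts (l'.map (f' n))) := by
  induction h with
  | nil => exact simulates_fail r
  | cons h _ ih => exact h.orElse ih

/-- Once the first runs have settled, their answers are fixed finite lists, and only finitely many
continuations have to settle as well. Finiteness of the outcomes is what makes eventual equality
compatible with sequencing. -/
theorem Simulates.bind {r : α → β → Prop} {s : γ → δ → Prop}
    {f : ℕ → Outcome α} {f' : ℕ → Outcome β} {g : ℕ → α → Outcome γ} {g' : ℕ → β → Outcome δ}
    (h : Simulates r f f') (hg : ∀ a b, r a b → Simulates s (fun n => g n a) (fun n => g' n b)) :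
    Simulates s (fun n => (f n).bind (g n)) (fun n => (f' n).bind (g' n)) := by
  obtain ⟨⟨l, _⟩, ⟨l', _⟩, h₁, h₂, rfl, rfl, hr⟩ := h
  obtain ⟨o, o', h, h', hr'⟩ := Simulates.alts (hr.imp hg)
  refine ⟨o, o', ?_, ?_, hr'⟩
  · filter_upwards [h₁, h] with n e e'
    rw [e, bind_done, e']
  · filter_upwards [h₂, h'] with n e e'
    rw [e, bind_done, e']

theorem Simulates.map {r : α → β → Prop} {s : γ → δ → Prop} {f : ℕ → Outcome α}
    {f' : ℕ → Outcome β} (h : Simulates r f f') (g : α → γ) (g' : β → δ)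
    (hs : ∀ a b, r a b → s (g a) (g' b)) :
    Simulates s (fun n => (f n).map g) (fun n => (f' n).map g') := by
  obtain ⟨o, o', h, h', h₁, h₂, hr⟩ := h
  refine ⟨_, _, h.map g, h'.map g', h₁, h₂, ?_⟩
  exact List.forall₂_map_left_iff.2 (List.forall₂_map_right_iff.2 (hr.imp hs))

/-- The execution stops, and all its answers satisfy `p`. -/
def Stably (p : α → Prop) (run : ℕ → Outcome α) : Prop :=
  ∃ o, Converges run o ∧ o.status = .done ∧ ∀ a ∈ o.answers, p a

/-- Forgets the second run. It serves for answers that a for-all will reject later, where only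
termination and the shape of the answers count. -/
theorem Simulates.stably {r : α → β → Prop} {f : ℕ → Outcome α} {f' : ℕ → Outcome β}
    (h : Simulates r f f') : Stably (fun a => ∃ b, r a b) f := by
  obtain ⟨o, o', h, h', h₁, h₂, hr⟩ := h
  refine ⟨o, h, h₁, fun a ha => ?_⟩
  obtain ⟨i, hi, rfl⟩ := List.getElem_of_mem ha
  exact ⟨_, (List.forall₂_iff_get.1 hr).2 i hi (by rw [← hr.length_eq]; exact hi)⟩

theorem Stably.mono {p q : α → Prop} {f : ℕ → Outcome α} (h : Stably p f)
    (hpq : ∀ a, p a → q a) : Stably q f := by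
  obtain ⟨o, h, h₁, h₂⟩ := h
  exact ⟨o, h, h₁, fun a ha => hpq a (h₂ a ha)⟩

theorem stably_fail (p : α → Prop) : Stably p fun _ => fail :=
  ⟨_, converges_const _, rfl, by simp [fail, halt]⟩

theorem stably_pure {p : α → Prop} {a : α} (h : p a) : Stably p fun _ => pure a :=
  ⟨_, converges_const _, rfl, by simpa [Outcome.pure] using h⟩

theorem Stably.orElse {p : α → Prop} {f g : ℕ → Outcome α} (hf : Stably p f) (hg : Stably p g) :
    Stably p fun n => (f n).orElse (g n) := by
  obtain ⟨⟨l, _⟩, h, rfl, hp⟩ := hf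
  obtain ⟨o', h', hd, hp'⟩ := hg
  refine ⟨_, h.orElse h', hd, fun a ha => ?_⟩
  rcases List.mem_append.1 ha with ha | ha
  exacts [hp a ha, hp' a ha]

theorem Stably.alts {p : α → Prop} {l : List γ} {f : ℕ → γ → Outcome α}
    (h : ∀ x ∈ l, Stably p fun n => f n x) : Stably p fun n => Outcome.alts (l.map (f n)) := by
  induction l with
  | nil => exact stably_fail p
  | cons x l ih => exact (h x (by simp)).orElse (ih fun y hy => h y (by simp [hy]))

theorem Stably.bind {p : α → Prop} {q : β → Prop} {f : ℕ → Outcome α} {g : ℕ → α → Outcome β}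
    (h : Stably p f) (hg : ∀ a, p a → Stably q fun n => g n a) :
    Stably q fun n => (f n).bind (g n) := by
  obtain ⟨⟨l, _⟩, h₁, rfl, hp⟩ := h
  obtain ⟨o, h, h'⟩ := Stably.alts fun a ha => hg a (hp a ha)
  refine ⟨o, ?_, h'⟩
  filter_upwards [h₁, h] with n e e'
  rw [e, bind_done, e']

/-- The execution stops, its first answer is `a`, and all others satisfy `q`. -/
def StablyFirst (p : α → Prop) (q : α → Prop) (run : ℕ → Outcome α) : Prop :=
  ∃ a l, Converges run ⟨a :: l, .done⟩ ∧ p a ∧ ∀ b ∈ l, q b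

theorem StablyFirst.of_succ {p q : α → Prop} {f : ℕ → Outcome α}
    (h : StablyFirst p q fun n => f (n + 1)) : StablyFirst p q f := by
  obtain ⟨a, l, h, h'⟩ := h
  exact ⟨a, l, h.of_succ, h'⟩

theorem stablyFirst_pure {p : α → Prop} (q : α → Prop) {a : α} (h : p a) :
    StablyFirst p q fun _ => pure a :=
  ⟨a, [], converges_const _, h, by simp⟩

theorem StablyFirst.orElse {p q : α → Prop} {f g : ℕ → Outcome α} (hf : StablyFirst p q f)
    (hg : Stably q g) : StablyFirst p q fun n => (f n).orElse (g n) := by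
  obtain ⟨a, l, h, hp, hq⟩ := hf
  obtain ⟨⟨l', _⟩, h', rfl, hq'⟩ := hg
  refine ⟨a, l ++ l', h.orElse h', hp, fun b hb => ?_⟩
  rcases List.mem_append.1 hb with hb | hb
  exacts [hq b hb, hq' b hb]

theorem StablyFirst.bind {p q : α → Prop} {p' q' : β → Prop} {f : ℕ → Outcome α}
    {g : ℕ → α → Outcome β} (h : StablyFirst p q f)
    (hp : ∀ a, p a → StablyFirst p' q' fun n => g n a) (hq : ∀ a, q a → Stably q' fun n => g n a) :
    StablyFirst p' q' fun n => (f n).bind (g n) := by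
  obtain ⟨a, l, h, ha, hl⟩ := h
  obtain ⟨a', l', h', hr⟩ := (hp a ha).orElse (Stably.alts fun b hb => hq b (hl b hb))
  refine ⟨a', l', ?_, hr⟩
  filter_upwards [h, h'] with n e e'
  rw [e, bind_done, List.map_cons, alts_cons, e']

/-- The first answer is continued as `run'` prescribes, the others lead to failure. -/
theorem StablyFirst.simulates_bind {p q : α → Prop} {r : γ → δ → Prop} {f : ℕ → Outcome α}
    {g : ℕ → α → Outcome γ} {f' : ℕ → Outcome δ} (h : StablyFirst p q f)
    (hp : ∀ a, p a → Simulates r (fun n => g n a) f')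
    (hq : ∀ a, q a → ∀ n, g n a = fail) :
    Simulates r (fun n => (f n).bind (g n)) f' := by
  obtain ⟨a, l, h, ha, hl⟩ := h
  obtain ⟨o, o', h₁, h₂, hr⟩ := hp a ha
  refine ⟨o, o', ?_, h₂, hr⟩
  filter_upwards [h, h₁] with n e e'
  rw [e, bind_done, List.map_cons, alts_cons, e', alts_eq_fail, orElse_fail]
  intro o ho
  obtain ⟨b, hb, rfl⟩ := List.mem_map.1 ho
  exact hq b (hl b hb) n

/-- The left side concerns an eventually constant proposition, and `atTop` on the natural numbers is
a nontrivial filter. -/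
theorem Converges.eventually_iff {run : ℕ → Outcome α} {o : Outcome α} (h : Converges run o)
    (p : Outcome α → Prop) : (∀ᶠ n in atTop, p (run n)) ↔ p o := by
  rw [eventually_congr (h.mono fun n hn => by rw [hn] : ∀ᶠ n in atTop, p (run n) ↔ p o)]
  exact eventually_const

theorem Simulates.sameBehaviour {f : β → α} {run : ℕ → Outcome α} {run' : ℕ → Outcome β}
    (h : Simulates (fun a b => a = f b) run run') : SameBehaviour f run run' := by
  obtain ⟨⟨l, _⟩, ⟨l', _⟩, h, h', rfl, rfl, hr⟩ := h
  have hl : l = l'.map f := by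
    dsimp only at hr
    rw [← List.forall₂_map_right_iff (f := f) (R := (· = ·))] at hr
    exact List.forall₂_eq_eq_eq ▸ hr
  refine ⟨fun i a => ?_, fun s => ?_⟩
  · unfold HasAnswer
    rw [h.eventually_iff fun o => o.answers[i]? = some a]
    simp only [hl, List.getElem?_map, Option.map_eq_some_iff]
    exact exists_congr fun b =>
      and_congr_left' (h'.eventually_iff fun o => o.answers[i]? = some b).symm
  · unfold Stops
    rw [h.eventually_iff fun o => o.status = s, h'.eventually_iff fun o => o.status = s]

end Convergence

/-! ### Terms, ground terms and stores -/

namespace Term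

variable {F : Type u}

theorem mem_vars_app {f : F} {k : ℕ} {args : Fin k → Term F} {x : ℕ} :
    x ∈ (app f args).vars ↔ ∃ i, x ∈ (args i).vars := by
  simp [vars, List.mem_flatten, List.mem_ofFn]

theorem subst_congr {t : Term F} {σ τ : ℕ → Term F} (h : ∀ x ∈ t.vars, σ x = τ x) :
    t.subst σ = t.subst τ := by
  induction t with
  | var x => exact h x (by simp [vars])
  | num z => rfl
  | special k => rfl
  | app f args ih =>
    simp only [subst]
    congr 1
    funext i
    exact ih i fun x hx => h x (mem_vars_app.2 ⟨i, hx⟩)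

theorem subst_var (t : Term F) : t.subst var = t := by
  induction t with
  | app f args ih => simp only [subst]; congr 1; funext i; exact ih i
  | _ => rfl

theorem IsGround.subst {t : Term F} (h : t.IsGround) (σ : ℕ → Term F) : t.subst σ = t := by
  rw [subst_congr (τ := var), subst_var]
  simp [show t.vars = [] from h]

theorem subst_subst (t : Term F) (σ τ : ℕ → Term F) :
    (t.subst σ).subst τ = t.subst fun x => (σ x).subst τ := by
  induction t with
  | app f args ih => simp only [Term.subst]; congr 1; funext i; exact ih i
  | _ => rfl

theorem mem_vars_subst {t : Term F} {σ : ℕ → Term F} {z : ℕ} :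
    z ∈ (t.subst σ).vars ↔ ∃ x ∈ t.vars, z ∈ (σ x).vars := by
  induction t with
  | var x => simp [subst, vars]
  | num => simp [subst, vars]
  | special => simp [subst, vars]
  | app f args ih =>
    simp only [Term.subst, mem_vars_app, ih]
    aesop

theorem isGround_iff {t : Term F} : t.IsGround ↔ ∀ x, x ∉ t.vars :=
  List.eq_nil_iff_forall_not_mem

theorem isGround_subst {t : Term F} {σ : ℕ → Term F} :
    (t.subst σ).IsGround ↔ ∀ x ∈ t.vars, (σ x).IsGround := by
  simp only [isGround_iff, mem_vars_subst]
  aesop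

theorem not_isGround_var (x : ℕ) : ¬ (var x : Term F).IsGround := by simp [IsGround, vars]

theorem single_self (x : ℕ) (t : Term F) : single x t x = t := by simp [single]

theorem single_of_ne {x y : ℕ} (h : y ≠ x) (t : Term F) : single x t y = var y := by
  simp [single, h]

theorem subst_single_of_notMem {t : Term F} {x : ℕ} (h : x ∉ t.vars) (s : Term F) :
    t.subst (single x s) = t := by
  rw [subst_congr (τ := var), subst_var]
  intro y hy
  exact single_of_ne (by rintro rfl; exact h hy) s

end Term

namespace Store

variable {F : Type u}

theorem walk_ground {t : Term F} (h : t.IsGround) (st : Store F) : st.walk t = t := h.subst _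

theorem walk_var (st : Store F) (x : ℕ) : st.walk (.var x) = st.sub x := rfl

/-- A term whose value is a variable is a variable. -/
theorem walk_eq_var {st : Store F} {t : Term F} {y : ℕ} (h : st.walk t = .var y) :
    ∃ x, t = .var x ∧ st.sub x = .var y := by
  cases t with
  | var x => exact ⟨x, rfl, h⟩
  | _ => simp [walk, Term.subst] at h

theorem walk_bind (st : Store F) (x : ℕ) (t s : Term F) :
    (st.bind x t).walk s = (st.walk s).subst (Term.single x t) := by
  simp only [walk, bind, Term.subst_subst]

theorem walk_merge (st : Store F) (x y : ℕ) (s : Term F) :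
    (st.merge x y).walk s = (st.walk s).subst (Term.single x (.var y)) := by
  simp only [merge, walk_bind]
  rfl

theorem bindValue_of_proh_eq_nil {unif : Store F → Term F → Term F → Outcome (Store F)}
    {st : Store F} {x : ℕ} {t : Term F} (hx : x ∉ t.vars) (h : st.proh x = []) :
    st.bindValue unif x t = pure (st.bind x t) := by
  simp [bindValue, hx, h, alts_nil, ifAny, fail, halt]

/-- Ground values are kept. -/
def Keeps (st st' : Store F) : Prop :=
  st.next ≤ st'.next ∧ ∀ x, (st.sub x).IsGround → st'.sub x = st.sub x

theorem Keeps.refl (st : Store F) : st.Keeps st := ⟨le_rfl, fun _ _ => rfl⟩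

theorem Keeps.trans {a b c : Store F} (h : a.Keeps b) (h' : b.Keeps c) : a.Keeps c :=
  ⟨h.1.trans h'.1, fun x hx => by rw [h'.2 x (by rw [h.2 x hx]; exact hx), h.2 x hx]⟩

theorem Keeps.walk {st st' : Store F} (h : st.Keeps st') {t : Term F}
    (ht : (st.walk t).IsGround) : st'.walk t = st.walk t := by
  refine Term.subst_congr fun x hx => h.2 x ?_
  exact Term.isGround_subst.1 ht x hx

/-- Old variables are not affected. -/
def Extends (st st' : Store F) : Prop :=
  st.next ≤ st'.next ∧ ∀ x < st.next, st'.sub x = st.sub x ∧ st'.proh x = st.proh x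

theorem Extends.refl (st : Store F) : st.Extends st := ⟨le_rfl, fun _ _ => ⟨rfl, rfl⟩⟩

theorem Extends.trans {a b c : Store F} (h : a.Extends b) (h' : b.Extends c) : a.Extends c :=
  ⟨h.1.trans h'.1, fun x hx => by
    rw [(h'.2 x (hx.trans_le h.1)).1, (h'.2 x (hx.trans_le h.1)).2]; exact h.2 x hx⟩

/-- The variables from `m` on are fresh. -/
def FreshFrom (st : Store F) (m : ℕ) : Prop :=
  (∀ x ≥ m, st.sub x = .var x ∧ st.proh x = []) ∧ ∀ x < m, ∀ z ∈ (st.sub x).vars, z < m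

theorem FreshFrom.mono {st : Store F} {m m' : ℕ} (h : st.FreshFrom m) (hm : m ≤ m') :
    st.FreshFrom m' := by
  refine ⟨fun x hx => h.1 x (hm.trans hx), fun x hx z hz => ?_⟩
  rcases lt_or_ge x m with h' | h'
  · exact (h.2 x h' z hz).trans_le hm
  · rw [(h.1 x h').1] at hz
    simp only [Term.vars, List.mem_singleton] at hz
    omega

/-- Well-formed stores without loop variables. -/
def Good (st : Store F) : Prop := st.FreshFrom st.next ∧ st.loop = []

/-- Variables from `next` on are their own values, hence not ground, so nothing is claimed about
them. -/
theorem Extends.keeps {st st' : Store F} (h : st.Extends st') (hst : st.FreshFrom st.next) :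
    st.Keeps st' := by
  refine ⟨h.1, fun x hx => ?_⟩
  rcases lt_or_ge x st.next with h' | h'
  · exact (h.2 x h').1
  · rw [(hst.1 x h').1] at hx
    exact absurd hx (Term.not_isGround_var x)

theorem Good.with_next {st : Store F} (h : st.Good) {m : ℕ} (hm : st.next ≤ m) :
    ({ st with next := m } : Store F).Good :=
  ⟨h.1.mono hm, h.2⟩

theorem extends_with_next (st : Store F) {m : ℕ} (hm : st.next ≤ m) :
    st.Extends { st with next := m } := ⟨hm, fun _ _ => ⟨rfl, rfl⟩⟩

theorem Good.not_isLoop {st : Store F} (h : st.Good) (x : ℕ) : ¬ st.IsLoop x := by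
  simp [IsLoop, h.2]

/-! ### Unification with fresh variables, and ground tests -/

theorem unify_ground (n : ℕ) {st : Store F} {s t : Term F} (hs : (st.walk s).IsGround)
    (ht : (st.walk t).IsGround) :
    unify (n + 1) st s t = if st.walk s = st.walk t then pure st else fail := by
  simp [unify, hs, ht]

theorem disunify_ground (n : ℕ) {st : Store F} {s t : Term F} (hs : (st.walk s).IsGround)
    (ht : (st.walk t).IsGround) :
    disunify (n + 1) st s t = if st.walk s = st.walk t then fail else pure st := by
  simp [disunify, hs, ht]

theorem unify_var_right (n : ℕ) {st : Store F} {s t : Term F} {y : ℕ} (hs : (st.walk s).IsGround)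
    (ht : st.walk t = .var y) :
    unify (n + 1) st s t = st.bindValue (unify n) y (st.walk s) := by
  have h : ¬ (st.walk t).IsGround := by rw [ht]; exact Term.not_isGround_var y
  rw [unify, if_neg (by simp [h]), ht]
  cases hw : st.walk s with
  | var x => rw [hw] at hs; exact absurd hs (Term.not_isGround_var x)
  | _ => rfl

theorem unify_var_left (n : ℕ) {st : Store F} {s t : Term F} {x : ℕ} (hs : st.walk s = .var x)
    (ht : (st.walk t).IsGround) :
    unify (n + 1) st s t = st.bindValue (unify n) x (st.walk t) := by
  have h : ¬ (st.walk s).IsGround := by rw [hs]; exact Term.not_isGround_var x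
  rw [unify, if_neg (by simp [h]), hs]
  cases hw : st.walk t with
  | var x => rw [hw] at ht; exact absurd ht (Term.not_isGround_var x)
  | _ => rfl

theorem unify_var_var (n : ℕ) {st : Store F} {s t : Term F} {x y : ℕ} (hs : st.walk s = .var x)
    (ht : st.walk t = .var y) (h : x ≠ y) :
    unify (n + 1) st s t = pure (st.merge x y) := by
  have h' : ¬ (st.walk s).IsGround := by rw [hs]; exact Term.not_isGround_var x
  rw [unify, if_neg (by simp [h']), hs, ht]
  simp [h]

theorem disunify_var_left (n : ℕ) {st : Store F} {s t : Term F} {x : ℕ} (hs : st.walk s = .var x)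
    (ht : (st.walk t).IsGround) :
    disunify (n + 1) st s t = pure (st.prohibit x (st.walk t)) := by
  have h : ¬ (st.walk s).IsGround := by rw [hs]; exact Term.not_isGround_var x
  rw [disunify, if_neg (by simp [h]), hs]
  cases hw : st.walk t with
  | var x => rw [hw] at ht; exact absurd ht (Term.not_isGround_var x)
  | _ => rfl

theorem seq_unify_ground (n : ℕ) (st : Store F) (as bs : List (Term F))
    (ha : ∀ a ∈ as, (st.walk a).IsGround) (hb : ∀ b ∈ bs, (st.walk b).IsGround)
    (hl : as.length = bs.length) :
    seq (fun p st' => unify (n + 1) st' p.1 p.2) (as.zip bs) st =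
      if as.map st.walk = bs.map st.walk then pure st else fail := by
  induction as generalizing bs with
  | nil => cases bs <;> simp_all [seq_nil]
  | cons a as ih =>
    cases bs with
    | nil => simp at hl
    | cons b bs =>
      rw [List.zip_cons_cons, seq_cons, unify_ground n (ha a (by simp)) (hb b (by simp))]
      by_cases h : st.walk a = st.walk b
      · rw [if_pos h, Outcome.pure_bind, ih bs (fun a h => ha a (by simp [h])) (fun b h => hb b (by simp [h]))
          (by simpa using hl)]
        simp [h]
      · rw [if_neg h, fail_bind]
        simp [h]

theorem unifyArgs_ground (n : ℕ) (st : Store F) (as bs : List (Term F))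
    (ha : ∀ a ∈ as, (st.walk a).IsGround) (hb : ∀ b ∈ bs, (st.walk b).IsGround) :
    unifyArgs (n + 1) st as bs = if as.map st.walk = bs.map st.walk then pure st else fail := by
  unfold unifyArgs
  split_ifs with h h' h'
  · rw [seq_unify_ground n st as bs ha hb h, if_pos h']
  · rw [seq_unify_ground n st as bs ha hb h, if_neg h']
  · exact absurd (by simpa using congrArg List.length h') h
  · rfl

theorem exactMatch_ground (n : ℕ) (st : Store F) (as bs : List (Term F))
    (ha : ∀ a ∈ as, (st.walk a).IsGround) (hb : ∀ b ∈ bs, (st.walk b).IsGround) :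
    exactMatch (n + 1) st as bs = if as.map st.walk = bs.map st.walk then pure st else fail := by
  have hv : (as ++ bs).flatMap (fun t => (st.walk t).vars) = [] := by
    simp only [List.flatMap_eq_nil_iff, List.mem_append]
    rintro t (h | h)
    exacts [ha t h, hb t h]
  rw [exactMatch, unifyArgs_ground n st as bs ha hb, hv]
  split_ifs
  · simp [Outcome.filter, Outcome.pure, Unaltered]
  · rfl

/-- Unification of arguments, each of which is ground or an unconstrained variable of its own, with
fresh variables. -/
theorem exists_seq_unify_fresh (as : List (Term F)) (m : ℕ) (st : Store F) (hst : st.FreshFrom m)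
    (has : ∀ a ∈ as, (st.walk a).IsGround ∨
      ∃ y < m, st.walk a = .var y ∧ st.sub y = .var y ∧ st.proh y = [])
    (hd : as.Pairwise fun a b => ∀ y, st.walk a = .var y → st.walk b ≠ .var y) :
    ∃ s : Store F,
      (∀ n, seq (fun p st' => unify (n + 1) st' p.1 p.2)
        (as.zip ((List.range' m as.length).map .var)) st = Outcome.pure s) ∧
      s.FreshFrom (m + as.length) ∧ s.next = st.next ∧ s.loop = st.loop ∧
      (∀ x, (st.sub x).IsGround → s.sub x = st.sub x) ∧
      (∀ z < m, (∀ a ∈ as, st.walk a ≠ .var z) →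
        s.proh z = st.proh z ∧ ∀ x, st.sub x = .var z → s.sub x = .var z) ∧
      (∀ i a, as[i]? = some a → s.walk a = s.sub (m + i) ∧
        ((st.walk a).IsGround ∧ s.sub (m + i) = st.walk a ∨
          (∃ y, st.walk a = .var y) ∧ s.sub (m + i) = .var (m + i) ∧ s.proh (m + i) = [])) ∧
      ((∀ a ∈ as, (st.walk a).IsGround) →
        ∀ x < m, s.sub x = st.sub x ∧ s.proh x = st.proh x) := by
  induction as generalizing m st with
  | nil =>
    exact ⟨st, fun n => rfl, hst, rfl, rfl, fun _ _ => rfl, fun _ _ _ => ⟨rfl, fun _ h => h⟩,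
      by simp, fun _ _ _ => ⟨rfl, rfl⟩⟩
  | cons a as ih =>
    rw [List.pairwise_cons] at hd
    have hm := hst.1 m le_rfl
    have hne : ∀ x < m, ∀ s, (st.sub x).subst (Term.single m s) = st.sub x := fun x hx s =>
      Term.subst_single_of_notMem (fun h => lt_irrefl _ (hst.2 x hx m h)) s
    simp only [List.length_cons, List.range'_succ, List.map_cons, List.zip_cons_cons, seq_cons]
    rcases has a (by simp) with ha | ⟨y, hym, hay, hyy, hyp⟩
    -- Ground argument: the fresh variable `m` is bound to its value, and the variables below `m`
    -- keep theirs.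
    · set st₁ := st.bind m (st.walk a) with hst₁
      have hw : ∀ t, st₁.walk t = (st.walk t).subst (Term.single m (st.walk a)) := walk_bind st m _
      have hsub : ∀ x, st₁.sub x = (st.sub x).subst (Term.single m (st.walk a)) := fun x => rfl
      have hlt : ∀ x < m, st₁.sub x = st.sub x := fun x hx => by rw [hsub, hne x hx]
      have hself : st₁.sub m = st.walk a := by
        rw [hsub, hm.1]; exact Term.single_self _ _
      have hgt : ∀ x > m, st₁.sub x = .var x := fun x hx => by
        rw [hsub, (hst.1 x hx.le).1]; exact Term.single_of_ne hx.ne' _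
      have hwv : ∀ t z, z ≠ m → st.walk t = .var z → st₁.walk t = .var z := fun t z hz h => by
        rw [hw, h]; exact Term.single_of_ne hz _
      have hwv' : ∀ t z, st₁.walk t = .var z → st.walk t = .var z := fun t z h => by
        obtain ⟨x, rfl, hx⟩ := walk_eq_var h
        rw [walk_var]
        rcases lt_trichotomy x m with h' | rfl | h'
        · rw [← hlt x h', hx]
        · rw [hself] at hx
          rw [hx] at ha
          exact absurd ha (Term.not_isGround_var z)
        · rw [hgt x h'] at hx
          rw [(hst.1 x h'.le).1, hx]
      have hwg : ∀ t, (st.walk t).IsGround → st₁.walk t = st.walk t := fun t h => by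
        rw [hw, h.subst]
      have hunif : ∀ n, unify (n + 1) st a (.var m) = Outcome.pure st₁ := fun n => by
        rw [unify_var_right n ha (show st.walk (.var m) = .var m from hm.1),
          bindValue_of_proh_eq_nil (by simp [show (st.walk a).vars = [] from ha]) hm.2]
      obtain ⟨s, hs, hs₁, hs₂, hs₃, hs₄, hs₅, hs₆, hs₇⟩ := ih (m + 1) st₁
        ⟨fun x hx => ⟨hgt x hx, (hst.1 x (by omega)).2⟩, fun x hx z hz => by
          rcases Nat.lt_succ_iff_lt_or_eq.1 hx with h | rfl
          · rw [hlt x h] at hz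
            exact (hst.2 x h z hz).trans (Nat.lt_succ_self m)
          · rw [hself, show (st.walk a).vars = [] from ha] at hz
            simp at hz⟩
        (fun b hb => (has b (by simp [hb])).imp (fun h => by rwa [hwg b h])
          fun ⟨y, h₁, h₂, h₃, h₄⟩ =>
            ⟨y, by omega, hwv b y h₁.ne h₂, by rw [hlt y h₁, h₃], h₄⟩)
        (hd.2.imp fun h y hy hy' => h y (hwv' _ y hy) (hwv' _ y hy'))
      have key : s.sub m = st.walk a := by
        rw [hs₄ m (by rw [hself]; exact ha), hself]
      have hkeep : ∀ x, (st.sub x).IsGround → s.sub x = st.sub x := fun x hx => by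
        have h := hwg (.var x) hx
        rw [walk_var, walk_var] at h
        rw [hs₄ x (by rw [h]; exact hx), h]
      refine ⟨s, fun n => by rw [hunif, Outcome.pure_bind, hs], ?_, hs₂, hs₃, hkeep, ?_, ?_, ?_⟩
      · convert hs₁ using 1; omega
      · intro z hz hza
        obtain ⟨h₁, h₂⟩ := hs₅ z (by omega) fun b hb h => hza b (by simp [hb]) (hwv' b z h)
        exact ⟨h₁, fun x hx => h₂ x (hwv (.var x) z hz.ne hx)⟩
      · rintro (_ | i) b hb
        · obtain rfl : a = b := by simpa using hb
          have : s.walk a = st.walk a :=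
            Term.subst_congr fun x hx => hkeep x (Term.isGround_subst.1 ha x hx)
          exact ⟨by rw [Nat.add_zero, key, this], Or.inl ⟨ha, key⟩⟩
        · have hb' : as[i]? = some b := by simpa using hb
          have hmem : b ∈ as := List.mem_of_getElem? hb'
          obtain ⟨h₁, h₂⟩ := hs₆ i b hb'
          have e : m + (i + 1) = m + 1 + i := by omega
          rw [e]
          refine ⟨h₁, h₂.imp (fun ⟨h, h'⟩ => ?_) fun ⟨⟨y, hy⟩, h'⟩ => ⟨⟨y, hwv' b y hy⟩, h'⟩⟩
          rcases has b (by simp [hmem]) with h'' | ⟨y, hy, h'', _⟩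
          · exact ⟨h'', by rw [h', hwg b h'']⟩
          · rw [hwv b y hy.ne h''] at h
            exact absurd h (Term.not_isGround_var y)
      · intro hg x hx
        obtain ⟨h₁, h₂⟩ := hs₇ (fun b hb => by
          rw [hwg b (hg b (by simp [hb]))]; exact hg b (by simp [hb])) x (by omega)
        exact ⟨by rw [h₁, hlt x hx], h₂⟩
    -- Unbound argument: its variable `y` is redirected to `m`. Both lists of prohibited values are
    -- empty, so no list changes.
    · set st₁ := st.merge y m with hst₁
      have hw : ∀ t, st₁.walk t = (st.walk t).subst (Term.single y (.var m)) := walk_merge st y m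
      have hsub : ∀ x, st₁.sub x = (st.sub x).subst (Term.single y (.var m)) := fun x => rfl
      have hproh : ∀ z, st₁.proh z = st.proh z := fun z => by
        change Function.update st.proh m _ z = _
        rcases eq_or_ne z m with rfl | h
        · simp [hm.2, hyp]
        · simp [h]
      have hge : ∀ x ≥ m, st₁.sub x = .var x := fun x hx => by
        rw [hsub, (hst.1 x hx).1]; exact Term.single_of_ne (by omega) _
      have hwv : ∀ t z, z ≠ y → st.walk t = .var z → st₁.walk t = .var z := fun t z hz h => by
        rw [hw, h]; exact Term.single_of_ne hz _
      have hwv' : ∀ t z, z ≠ m → st₁.walk t = .var z → st.walk t = .var z := fun t z hz h => by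
        rw [hw] at h
        cases hwt : st.walk t with
        | var x =>
          rw [hwt] at h
          rcases eq_or_ne x y with rfl | hx
          · rw [show (Term.var x : Term F).subst (Term.single x (.var m)) = .var m from
              Term.single_self _ _] at h
            exact absurd (by simpa using h.symm) hz
          · rwa [show (Term.var x : Term F).subst (Term.single y (.var m)) = .var x from
              Term.single_of_ne hx _] at h
        | _ => rw [hwt] at h; simp [Term.subst] at h
      have hwg : ∀ t, (st.walk t).IsGround → st₁.walk t = st.walk t := fun t h => by
        rw [hw, h.subst]
      have hwa : st₁.walk a = .var m := by
        rw [hw, hay]; exact Term.single_self _ _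
      have hunif : ∀ n, unify (n + 1) st a (.var m) = Outcome.pure st₁ := fun n =>
        unify_var_var n hay (show st.walk (.var m) = .var m from hm.1) hym.ne
      -- By distinctness the remaining arguments do not have the value `y`; hence after the merge
      -- none of them has the value `m`, and variables among their values are the same as before.
      have hwne : ∀ b ∈ as, ∀ z, st₁.walk b = .var z → z ≠ m ∧ z ≠ y ∧ st.walk b = .var z := by
        intro b hb z h
        rcases has b (by simp [hb]) with h' | ⟨y', h₁, h₂, h₃, h₄⟩
        · rw [hwg b h'] at h
          rw [h] at h'
          exact absurd h' (Term.not_isGround_var z)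
        · have hyy' : y' ≠ y := fun e => hd.1 b hb y hay (by rw [h₂, e])
          rw [hwv b y' hyy' h₂] at h
          obtain rfl : y' = z := by simpa using h
          exact ⟨h₁.ne, hyy', h₂⟩
      obtain ⟨s, hs, hs₁, hs₂, hs₃, hs₄, hs₅, hs₆, hs₇⟩ := ih (m + 1) st₁
        ⟨fun x hx => ⟨hge x (by omega), by rw [hproh]; exact (hst.1 x (by omega)).2⟩,
          fun x hx z hz => by
          rcases Nat.lt_succ_iff_lt_or_eq.1 hx with h | rfl
          · rw [hsub, Term.mem_vars_subst] at hz
            obtain ⟨w, hw, hz⟩ := hz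
            rcases eq_or_ne w y with rfl | h'
            · rw [Term.single_self] at hz
              simp only [Term.vars, List.mem_singleton] at hz
              omega
            · rw [Term.single_of_ne h'] at hz
              simp only [Term.vars, List.mem_singleton] at hz
              have := hst.2 x h w hw
              omega
          · rw [hge x le_rfl] at hz
            simp only [Term.vars, List.mem_singleton] at hz
            omega⟩
        (fun b hb => (has b (by simp [hb])).imp (fun h => by rwa [hwg b h])
          fun ⟨y', h₁, h₂, h₃, h₄⟩ => by
            have hyy' : y' ≠ y := fun e => hd.1 b hb y hay (by rw [h₂, e])
            exact ⟨y', by omega, hwv b y' hyy' h₂, hwv (.var y') y' hyy' h₃, by rw [hproh, h₄]⟩)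
        (hd.2.imp_of_mem fun hb hb' h z hz hz' =>
          h z (hwne _ hb z hz).2.2 (hwne _ hb' z hz').2.2)
      obtain ⟨hpm, hvm⟩ := hs₅ m (by omega) fun b hb h => (hwne b hb m h).1 rfl
      -- Since no remaining argument has the value `m`, the rest of the unification leaves `m`
      -- unbound.
      have key : s.sub m = .var m := hvm m (hge m le_rfl)
      refine ⟨s, fun n => by rw [hunif, Outcome.pure_bind, hs], ?_, hs₂, hs₃, ?_, ?_, ?_, ?_⟩
      · convert hs₁ using 1; omega
      · intro x hx
        have h := hwg (.var x) hx
        rw [walk_var, walk_var] at h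
        rw [hs₄ x (by rw [h]; exact hx), h]
      · intro z hz hza
        have hzy : z ≠ y := fun e => hza a (by simp) (by rw [hay, e])
        obtain ⟨h₁, h₂⟩ := hs₅ z (by omega) fun b hb h => hza b (by simp [hb]) (hwne b hb z h).2.2
        exact ⟨by rw [h₁, hproh], fun x hx => h₂ x (hwv (.var x) z hzy hx)⟩
      · rintro (_ | i) b hb
        · obtain rfl : a = b := by simpa using hb
          obtain ⟨x, rfl, hx⟩ := walk_eq_var hwa
          rw [Nat.add_zero, key, walk_var, hvm x hx]
          exact ⟨rfl, Or.inr ⟨⟨y, hay⟩, rfl, by rw [hpm, hproh, hm.2]⟩⟩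
        · have hb' : as[i]? = some b := by simpa using hb
          have hmem : b ∈ as := List.mem_of_getElem? hb'
          obtain ⟨h₁, h₂⟩ := hs₆ i b hb'
          have e : m + (i + 1) = m + 1 + i := by omega
          rw [e]
          refine ⟨h₁, h₂.imp (fun ⟨h, h'⟩ => ?_)
            fun ⟨⟨y, hy⟩, h'⟩ => ⟨⟨y, (hwne b hmem y hy).2.2⟩, h'⟩⟩
          rcases has b (by simp [hmem]) with h'' | ⟨y', hy, h'', _⟩
          · exact ⟨h'', by rw [h', hwg b h'']⟩
          · have hyy' : y' ≠ y := fun e => hd.1 b hmem y hay (by rw [h'', e])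
            rw [hwv b y' hyy' h''] at h
            exact absurd h (Term.not_isGround_var y')
      · intro hg
        have := hg a (by simp)
        rw [hay] at this
        exact absurd this (Term.not_isGround_var y)

end Store

/-! ### Built-in operations -/

section Tests

variable {R : Type v} {F : Type u}

theorem AExpr.vars_subst_eq_nil {e : AExpr F} {σ : ℕ → Term F} (h : e.vars = []) :
    e.subst σ = e := by
  induction e with
  | val t => simp only [AExpr.subst]; rw [Term.IsGround.subst h]
  | plus a b iha ihb | minus a b iha ihb | times a b iha ihb =>
    simp only [AExpr.vars, List.append_eq_nil_iff] at h
    simp only [AExpr.subst, iha h.1, ihb h.2]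

theorem Builtin.subst_of_vars_eq_nil {b : Builtin F} (h : b.vars = []) (σ : ℕ → Term F) :
    b.subst σ = b := by
  cases b with
  | eq s t =>
    simp only [Builtin.vars, List.append_eq_nil_iff] at h
    simp only [Builtin.subst]
    rw [Term.IsGround.subst h.1, Term.IsGround.subst h.2]
  | is s e =>
    simp only [Builtin.vars, List.append_eq_nil_iff] at h
    simp only [Builtin.subst]
    rw [Term.IsGround.subst h.1, AExpr.vars_subst_eq_nil h.2]
  | lt a b =>
    simp only [Builtin.vars, List.append_eq_nil_iff] at h
    simp only [Builtin.subst, AExpr.vars_subst_eq_nil h.1, AExpr.vars_subst_eq_nil h.2]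
  | le a b =>
    simp only [Builtin.vars, List.append_eq_nil_iff] at h
    simp only [Builtin.subst, AExpr.vars_subst_eq_nil h.1, AExpr.vars_subst_eq_nil h.2]

theorem evalTest_ground (n : ℕ) (naf : Bool) {b : Builtin F} {st : Store F}
    (h : (b.subst st.sub).vars = []) :
    evalTest (n + 1) naf b st =
      if ((b.subst st.sub).Holds ↔ naf = false) then Outcome.pure st else fail := by
  have key : ∀ s t : Term F, s.IsGround → t.IsGround →
      (if naf = true then disunify (n + 1) st s t else unify (n + 1) st s t) =
        if (s = t ↔ naf = false) then Outcome.pure st else fail := by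
    intro s t hs ht
    have es := Store.walk_ground hs st
    have et := Store.walk_ground ht st
    rw [Store.disunify_ground n (by rwa [es]) (by rwa [et]),
      Store.unify_ground n (by rwa [es]) (by rwa [et]), es, et]
    cases naf <;> by_cases e : s = t <;> simp [e]
  unfold evalTest
  generalize b.subst st.sub = b' at h
  cases b' with
  | eq s t =>
    simp only [Builtin.vars, List.append_eq_nil_iff] at h
    exact key s t h.1 h.2
  | is s e =>
    simp only [Builtin.vars, List.append_eq_nil_iff] at h
    simp only [h.2, ne_eq, not_true_eq_false, if_false]
    cases he : e.eval with
    | some z =>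
      refine (key s (.num z) h.1 rfl).trans ?_
      simp [Builtin.Holds, he]
    | none => cases naf <;> simp [Builtin.Holds, he]
  | lt a b => simp [h]
  | le a b => simp [h]

theorem evalTest_eq_of_unbound (n : ℕ) {st : Store F} {x : ℕ} {t : Term F}
    (hx : st.sub x = .var x) (hp : st.proh x = []) (ht : t.IsGround) :
    evalTest (n + 1) false (.eq (.var x) t) st = Outcome.pure (st.bind x t) := by
  have hw := Store.walk_ground ht st
  have e : (Builtin.eq (.var x) t).subst st.sub = .eq (.var x) t := by
    simp only [Builtin.subst, Term.subst, hx, ht.subst]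
  unfold evalTest
  rw [e]
  simp only [Bool.false_eq_true, if_false]
  rw [Store.unify_var_left n (show st.walk (.var x) = .var x from hx) (by rwa [hw]), hw,
    Store.bindValue_of_proh_eq_nil (by simp [show t.vars = [] from ht]) hp]

theorem evalTest_ne_of_unbound (n : ℕ) {st : Store F} {x : ℕ} {t : Term F}
    (hx : st.sub x = .var x) (ht : t.IsGround) :
    evalTest (n + 1) true (.eq (.var x) t) st = Outcome.pure (st.prohibit x t) := by
  have hw := Store.walk_ground ht st
  have e : (Builtin.eq (.var x) t).subst st.sub = .eq (.var x) t := by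
    simp only [Builtin.subst, Term.subst, hx, ht.subst]
  unfold evalTest
  rw [e]
  simp only [if_true]
  rw [Store.disunify_var_left n (show st.walk (.var x) = .var x from hx) (by rwa [hw]), hw]

theorem exec_test (P : Program R F) (n : ℕ) (stk : List (Lit R F)) (s : Bool) (b : Builtin F)
    (st : State R F) :
    exec P (n + 1) stk (.test s b) st = (evalTest n s b st.toStore).map st.setStore := by
  rw [exec]

theorem exec_lit (P : Program R F) (n : ℕ) (stk : List (Lit R F)) (l : Lit R F) (st : State R F) :
    exec P (n + 1) stk (.lit l) st = call n stk l st fun st₀ =>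
      alts ((rulesFor P l).map fun r =>
        (unifyArgs n { st₀.toStore with next := st₀.next + r.bound } l.args
            (r.shift st₀.next).params).bind fun s =>
          (seq (exec P n (l :: stk)) (r.shift st₀.next).body (st₀.setStore s)).bind
            (close n stk.length l)) := by
  rw [exec]

/-- The bound `n + 2` leaves one unit for `exec` and one for the unification or disunification
inside the test. -/
theorem exec_test_ground (P : Program R F) (n : ℕ) (stk : List (Lit R F)) (s : Bool)
    (b : Builtin F) (st : State R F) (h : (b.subst st.sub).vars = []) :
    exec P (n + 2) stk (.test s b) st =
      if ((b.subst st.sub).Holds ↔ s = false) then Outcome.pure st else fail := by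
  rw [exec_test, evalTest_ground n s h]
  split_ifs <;> rfl

/-- A conjunction of ground tests. -/
theorem seq_tests_ground (P : Program R F) (n : ℕ) (stk : List (Lit R F))
    (gs : List (Bool × Builtin F)) (st : State R F)
    (h : ∀ g ∈ gs, (g.2.subst st.sub).vars = []) :
    seq (exec P (n + 2) stk) (gs.map fun g => .test g.1 g.2) st =
      if ∀ g ∈ gs, ((g.2.subst st.sub).Holds ↔ g.1 = false) then Outcome.pure st else fail := by
  induction gs with
  | nil => simp [seq_nil]
  | cons g gs ih =>
    rw [List.map_cons, seq_cons, exec_test_ground P n stk _ _ st (h g (by simp))]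
    by_cases hg : (g.2.subst st.sub).Holds ↔ g.1 = false
    · rw [if_pos hg, Outcome.pure_bind, ih fun g hg => h g (by simp [hg])]
      simp [hg]
    · rw [if_neg hg, fail_bind, if_neg fun H => hg (H g (by simp))]

end Tests

/-! ### Clauses without variables -/

section GroundClauses

variable {R : Type v} {F : Type u}

theorem lt_varBound {l : List ℕ} {x : ℕ} (h : x ∈ l) : x < varBound l := by
  induction l with
  | nil => simp at h
  | cons y l ih =>
    change x < max (y + 1) (varBound l)
    rcases List.mem_cons.1 h with rfl | h
    · exact lt_max_of_lt_left (Nat.lt_succ_self _)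
    · exact lt_max_of_lt_right (ih h)

/-- Variables `m, m + 1, …` are tested for equality with the given terms. -/
def argTests (m : ℕ) (ts : List (Term F)) : List (Bool × Builtin F) :=
  ts.mapIdx fun i t => (false, .eq (.var (m + i)) t)

theorem argTests_cons (m : ℕ) (t : Term F) (ts : List (Term F)) :
    argTests m (t :: ts) = (false, .eq (.var m) t) :: argTests (m + 1) ts := by
  simp only [argTests, List.mapIdx_cons, Nat.add_zero, List.cons.injEq, true_and]
  congr 1
  funext i t
  rw [Nat.add_assoc, Nat.add_comm 1 i]

theorem abstractArgs_ground (m : ℕ) (seen : List ℕ) (ts : List (Term F))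
    (h : ∀ t ∈ ts, t.IsGround) :
    abstractArgs (R := R) m seen ts =
      (List.range' m ts.length, (argTests m ts).map fun g => .test g.1 g.2) := by
  induction ts generalizing m with
  | nil => rfl
  | cons t ts ih =>
    have ih' := ih (m + 1) fun t ht => h t (by simp [ht])
    rw [argTests_cons]
    cases t with
    | var x => exact absurd (h _ (by simp)) (Term.not_isGround_var x)
    | _ => simp [abstractArgs, ih', List.range'_succ]

namespace Clause

variable {c : Clause R F}

theorem IsGround.headArgs (hc : c.IsGround) : ∀ t ∈ c.headArgs, t.IsGround := by
  simp only [Clause.IsGround, Clause.vars, List.append_eq_nil_iff, List.flatMap_eq_nil_iff] at hc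
  exact hc.1

theorem IsGround.body (hc : c.IsGround) : ∀ g ∈ c.body, g.vars = [] := by
  simp only [Clause.IsGround, Clause.vars, List.append_eq_nil_iff, List.flatMap_eq_nil_iff] at hc
  exact hc.2

theorem IsGround.headVars (hc : c.IsGround) : c.headVars = List.range c.headArgs.length := by
  rw [Clause.headVars, abstractArgs_ground _ _ _ hc.headArgs, show c.vars = [] from hc,
    List.range_eq_range']
  rfl

theorem IsGround.headGoals (hc : c.IsGround) :
    c.headGoals = (argTests 0 c.headArgs).map fun g => .test g.1 g.2 := by
  rw [Clause.headGoals, abstractArgs_ground _ _ _ hc.headArgs, show c.vars = [] from hc]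
  rfl

/-- The only variables of the abstracted clause are those introduced for the arguments of its head.
Consequently the dual rule of a predicate contains no for-all. -/
theorem IsGround.bodyVars (hc : c.IsGround) : c.bodyVars = [] := by
  rw [Clause.bodyVars, List.filter_eq_nil_iff]
  intro x hx
  simp only [List.mem_dedup, List.mem_flatMap, List.mem_append, hc.headGoals, argTests,
    List.mem_map, List.mem_mapIdx] at hx
  obtain ⟨g, ⟨g', ⟨i, hi, rfl⟩, rfl⟩ | hg, hx⟩ := hx
  · have ht := hc.headArgs _ (List.getElem_mem hi)
    simp only [BodyGoal.vars, Builtin.vars, Term.vars, show (c.headArgs[i]).vars = [] from ht] at hx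
    simp only [Nat.zero_add, List.append_nil, List.mem_singleton] at hx
    simp [hc.headVars, hx, hi]
  · rw [hc.body g hg] at hx
    simp at hx

theorem IsGround.toCheck (hc : c.IsGround) : c.toCheck.IsGround := by
  unfold Clause.toCheck
  split
  · exact hc
  · rename_i a ha
    split_ifs
    · exact hc
    · have h := hc.headArgs
      have h' := hc.body
      simp only [Clause.headArgs, ha, Option.map_some, Option.getD_some] at h
      simp only [Clause.IsGround, Clause.vars, List.append_eq_nil_iff, List.flatMap_eq_nil_iff,
        List.mem_append, Clause.headArgs, ha, Option.map_some, Option.getD_some]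
      refine ⟨h, ?_⟩
      rintro g (hg | hg)
      · exact h' g hg
      · obtain rfl : g = .lit true a := by simpa using hg
        exact List.flatMap_eq_nil_iff.2 h

theorem toCheck_head (c : Clause R F) : c.toCheck.head = c.head := by
  unfold Clause.toCheck
  split
  · rfl
  · split_ifs <;> rfl

theorem toCheck_headArgs (c : Clause R F) : c.toCheck.headArgs = c.headArgs := by
  rw [Clause.headArgs, toCheck_head, Clause.headArgs]

end Clause

theorem BodyGoal.shift_toGoal {g : BodyGoal R F} (h : g.vars = []) (m : ℕ) :
    g.toGoal.shift m = g.toGoal := by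
  cases g with
  | lit s a =>
    simp only [BodyGoal.vars, Atom.vars, List.flatMap_eq_nil_iff] at h
    simp only [BodyGoal.toGoal, Goal.shift, Lit.subst]
    congr 2
    conv_rhs => rw [← List.map_id a.args]
    exact List.map_congr_left fun t ht => Term.IsGround.subst (h t ht) _
  | test s b => simp only [BodyGoal.toGoal, Goal.shift, Builtin.subst_of_vars_eq_nil h]

theorem BodyGoal.vars_neg (g : BodyGoal R F) : g.neg.vars = g.vars := by cases g <;> rfl

theorem argTests_shift (m k : ℕ) {ts : List (Term F)} (h : ∀ t ∈ ts, t.IsGround) :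
    (((argTests k ts).map fun g => (BodyGoal.test g.1 g.2 : BodyGoal R F)).map
      BodyGoal.toGoal).map (Goal.shift m) =
    (argTests (k + m) ts).map fun g => (.test g.1 g.2 : Goal R F) := by
  induction ts generalizing k with
  | nil => rfl
  | cons t ts ih =>
    have ih' := ih (k + 1) fun t ht => h t (by simp [ht])
    rw [argTests_cons, argTests_cons]
    simp only [List.map_cons, ih']
    simp only [BodyGoal.toGoal, Goal.shift, Builtin.subst, Term.subst,
      (h t (by simp)).subst, Nat.add_right_comm]

end GroundClauses

/-! ### Calls of ground literals -/

section Calls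

variable {R : Type v} {F : Type u}

/-- The arguments of the literal are bound to ground terms. -/
def Store.GroundLit (st : Store F) (l : Lit R F) : Prop := ∀ a ∈ l.args, (st.walk a).IsGround

theorem Store.Keeps.groundLit {st st' : Store F} (h : st.Keeps st') {l : Lit R F}
    (hl : st.GroundLit l) : st'.GroundLit l := fun a ha => by rw [h.walk (hl a ha)]; exact hl a ha

theorem Store.Keeps.map_walk {st st' : Store F} (h : st.Keeps st') {l : Lit R F}
    (hl : st.GroundLit l) : l.args.map st'.walk = l.args.map st.walk :=
  List.map_congr_left fun a ha => h.walk (hl a ha)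

theorem mem_of_mem_negCounts {β : Type*} {sgn : β → Bool} {s : Bool} {c : ℕ} {l : List β}
    {e : ℕ × ℕ × β} (h : e ∈ negCounts sgn s c l) : e.2.2 ∈ l := by
  induction l generalizing s c with
  | nil => simp [negCounts] at h
  | cons d l ih =>
    simp only [negCounts, List.mem_cons] at h
    rcases h with rfl | h
    · simp
    · exact List.mem_cons_of_mem _ (ih h)

/-- The count grows exactly when the sign changes, so its parity records whether the signs at the
two ends agree. For two occurrences of the same literal it is even; the loop tests therefore decide
every recurring call, which is the source of termination. -/
theorem even_of_mem_negCounts {β : Type*} {sgn : β → Bool} {s : Bool} {c : ℕ} {l : List β}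
    {e : ℕ × ℕ × β} (h : e ∈ negCounts sgn s c l) : Even e.2.1 ↔ (Even c ↔ sgn e.2.2 = s) := by
  induction l generalizing s c with
  | nil => simp [negCounts] at h
  | cons d l ih =>
    simp only [negCounts, List.mem_cons] at h
    rcases h with rfl | h
    · by_cases hd : sgn d = s <;> simp [hd, Nat.even_add_one]
    · rw [ih h]
      by_cases hd : sgn d = s
      · simp [hd]
      · rw [if_neg hd, Nat.even_add_one]
        cases h₁ : sgn e.2.2 <;> cases h₂ : sgn d <;> cases s <;> simp_all

theorem exists_mem_negCounts {β : Type*} (sgn : β → Bool) (s : Bool) (c : ℕ) {l : List β} {d : β}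
    (h : d ∈ l) : ∃ e ∈ negCounts sgn s c l, e.2.2 = d := by
  induction l generalizing s c with
  | nil => simp at h
  | cons d' l ih =>
    simp only [negCounts, List.mem_cons]
    rcases List.mem_cons.1 h with rfl | h
    · exact ⟨_, Or.inl rfl, rfl⟩
    · obtain ⟨e, he, rfl⟩ := ih _ _ h
      exact ⟨e, Or.inr he, rfl⟩

theorem forall₂_negCounts {β γ : Type*} {r : β → γ → Prop} {sgn : β → Bool} {sgn' : γ → Bool}
    (hr : ∀ a b, r a b → sgn a = sgn' b) (s : Bool) (c : ℕ) {l : List β} {l' : List γ}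
    (h : List.Forall₂ r l l') :
    List.Forall₂ (fun e e' => e.2.1 = e'.2.1 ∧ r e.2.2 e'.2.2) (negCounts sgn s c l)
      (negCounts sgn' s c l') := by
  induction h generalizing s c with
  | nil => exact .nil
  | cons h _ ih =>
    simp only [negCounts, hr _ _ h]
    exact .cons ⟨rfl, h⟩ (ih _ _)

section CallGround

variable {n : ℕ} {stk : List (Lit R F)} {l : Lit R F} {st : State R F}
  {expand : State R F → Outcome (State R F)}

theorem call_of_conflict (hl : st.GroundLit l)
    (hd : ∀ d ∈ st.chs ++ stk, l.Conflict d → st.GroundLit d)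
    (h : ∃ d ∈ st.chs ++ stk, l.Conflict d ∧ l.args.map st.walk = d.args.map st.walk) :
    call (n + 1) stk l st expand = fail := by
  rw [call, ifAny_alts_const _ _ (fun d => l.args.map st.walk = d.args.map st.walk)
    (fun _ => st.toStore) fun d h' => ?_]
  · obtain ⟨d, h₁, h₂, h₃⟩ := h
    exact if_pos ⟨d, by simpa [conflicts, h₂] using h₁, h₃⟩
  · simp only [conflicts, List.mem_filter, decide_eq_true_eq] at h'
    rw [Store.exactMatch_ground n _ _ _ hl (hd d h'.1 h'.2)]
    exact ⟨fun h => if_pos h, fun h => if_neg h⟩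

/-- For ground arguments, failing the exact match means failing to unify. The filter `restrict`
finds nothing to avoid and returns the store unchanged. -/
theorem call_of_not_conflict (hl : st.GroundLit l)
    (hd : ∀ d ∈ st.chs ++ stk, l.Conflict d → st.GroundLit d)
    (h : ¬ ∃ d ∈ st.chs ++ stk, l.Conflict d ∧ l.args.map st.walk = d.args.map st.walk) :
    call (n + 1) stk l st expand =
      ifAny (alts ((st.chs.filter fun d => l.Same d).map
        fun d => exactMatch (n + 1) st.toStore l.args d.args))
      (fun _ => Outcome.pure st) (checkStack (n + 1) stk l st (expand st)) := by
  have h₀ : ∀ d ∈ conflicts l (st.chs ++ stk),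
      st.GroundLit d ∧ l.args.map st.walk ≠ d.args.map st.walk := by
    intro d h'
    simp only [conflicts, List.mem_filter, decide_eq_true_eq] at h'
    exact ⟨hd d h'.1 h'.2, fun e => h ⟨d, h'.1, h'.2, e⟩⟩
  rw [call, ifAny_alts_of_not_exists fun d h' => ?_]
  · congr 1
    rw [restrict, ifAny_alts_of_not_exists fun d h' => ?_, Outcome.pure_bind]
    · rfl
    · rw [Store.unifyArgs_ground n _ _ _ hl (h₀ d h').1, if_neg (h₀ d h').2]
  · rw [Store.exactMatch_ground n _ _ _ hl (h₀ d h').1, if_neg (h₀ d h').2]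

theorem call_of_known (hl : st.GroundLit l)
    (hd : ∀ d ∈ st.chs ++ stk, l.Conflict d ∨ l.Same d → st.GroundLit d)
    (h : ¬ ∃ d ∈ st.chs ++ stk, l.Conflict d ∧ l.args.map st.walk = d.args.map st.walk)
    (h' : ∃ d ∈ st.chs, l.Same d ∧ l.args.map st.walk = d.args.map st.walk) :
    call (n + 1) stk l st expand = Outcome.pure st := by
  rw [call_of_not_conflict hl (fun d h₁ h₂ => hd d h₁ (Or.inl h₂)) h,
    ifAny_alts_const _ _ (fun d => l.args.map st.walk = d.args.map st.walk)
    (fun _ => st.toStore) fun d h' => ?_]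
  · obtain ⟨d, h₁, h₂, h₃⟩ := h'
    exact if_pos ⟨d, by simp [h₁, h₂], h₃⟩
  · simp only [List.mem_filter, decide_eq_true_eq] at h'
    rw [Store.exactMatch_ground n _ _ _ hl (hd d (by simp [h'.1]) (Or.inr h'.2))]
    exact ⟨fun h => if_pos h, fun h => if_neg h⟩

theorem call_of_not_known (hl : st.GroundLit l)
    (hd : ∀ d ∈ st.chs ++ stk, l.Conflict d ∨ l.Same d → st.GroundLit d)
    (h : ¬ ∃ d ∈ st.chs ++ stk, l.Conflict d ∧ l.args.map st.walk = d.args.map st.walk)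
    (h' : ¬ ∃ d ∈ st.chs, l.Same d ∧ l.args.map st.walk = d.args.map st.walk) :
    call (n + 1) stk l st expand = checkStack (n + 1) stk l st (expand st) := by
  rw [call_of_not_conflict hl (fun d h₁ h₂ => hd d h₁ (Or.inl h₂)) h,
    ifAny_alts_of_not_exists fun d h₁ => ?_]
  simp only [List.mem_filter, decide_eq_true_eq] at h₁
  rw [Store.exactMatch_ground n _ _ _ hl (hd d (by simp [h₁.1]) (Or.inr h₁.2)),
    if_neg fun e => h' ⟨d, h₁.1, h₁.2, e⟩]

theorem checkStack_of_positive {o : Outcome (State R F)} (hl : st.GroundLit l)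
    (hd : ∀ d ∈ stk, l.Same d → st.GroundLit d)
    (h : ∃ e ∈ negCounts Lit.sign l.sign 0 stk, l.Same e.2.2 ∧
      l.args.map st.walk = e.2.2.args.map st.walk ∧ e.2.1 = 0) :
    checkStack (n + 1) stk l st o = fail := by
  rw [checkStack, ifAny_alts_const _ _
    (fun e : ℕ × ℕ × Lit R F => l.args.map st.walk = e.2.2.args.map st.walk)
    (fun _ => st.toStore) fun e h' => ?_]
  · obtain ⟨e, h₁, h₂, h₃, h₄⟩ := h
    exact if_pos ⟨e, by simp [h₁, h₂, h₄], h₃⟩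
  · simp only [List.mem_filter, decide_eq_true_eq] at h'
    rw [Store.exactMatch_ground n _ _ _ hl (hd _ (mem_of_mem_negCounts h'.1.1) h'.1.2)]
    exact ⟨fun h => if_pos h, fun h => if_neg h⟩

/-- The depth `d` of the ancestor is chosen before the bound `n` and the expansion `o`, so that the
run is eventually constant. -/
theorem checkStack_of_even (hl : st.GroundLit l)
    (hd : ∀ d ∈ stk, l.Same d → st.GroundLit d)
    (h : ¬ ∃ e ∈ negCounts Lit.sign l.sign 0 stk, l.Same e.2.2 ∧
      l.args.map st.walk = e.2.2.args.map st.walk ∧ e.2.1 = 0)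
    (h' : ∃ e ∈ negCounts Lit.sign l.sign 0 stk, l.Same e.2.2 ∧
      l.args.map st.walk = e.2.2.args.map st.walk ∧ e.2.1 ≠ 0 ∧ Even e.2.1) :
    ∃ d, ∀ n o, checkStack (n + 1) stk l st o = Outcome.pure (st.record d l) := by
  have hc : ∀ q : ℕ × ℕ × Lit R F → Prop,
      ∀ e ∈ ((negCounts Lit.sign l.sign 0 stk).filter fun e => l.Same e.2.2).filter fun e => q e,
      e ∈ negCounts Lit.sign l.sign 0 stk ∧ l.Same e.2.2 ∧ q e ∧ st.GroundLit e.2.2 := by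
    intro q e he
    simp only [List.mem_filter, decide_eq_true_eq] at he
    exact ⟨he.1.1, he.1.2, he.2, hd _ (mem_of_mem_negCounts he.1.1) he.1.2⟩
  have h₀ : ∀ n, ∀ e ∈ ((negCounts Lit.sign l.sign 0 stk).filter fun e => l.Same e.2.2).filter
      fun e => e.2.1 = 0, exactMatch (n + 1) st.toStore l.args e.2.2.args = fail := by
    intro n e he
    obtain ⟨h₁, h₂, h₃, h₄⟩ := hc (fun e => e.2.1 = 0) e (by simpa using he)
    rw [Store.exactMatch_ground n _ _ _ hl h₄, if_neg fun e' => h ⟨e, h₁, h₂, e', h₃⟩]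
  -- The pair consists of the recursion bound and the outcome of the expansion; using it as the
  -- index yields one ancestor for all of them.
  have h₁ : ∀ n : ℕ × Outcome (State R F), ∀ e ∈ ((negCounts Lit.sign l.sign 0 stk).filter fun e => l.Same e.2.2).filter
      fun e => e.2.1 ≠ 0 ∧ Even e.2.1,
      (l.args.map st.walk = e.2.2.args.map st.walk →
        (exactMatch (n.1 + 1) st.toStore l.args e.2.2.args).map (fun _ => e.1) =
          Outcome.pure e.1) ∧
      (¬ l.args.map st.walk = e.2.2.args.map st.walk →
        (exactMatch (n.1 + 1) st.toStore l.args e.2.2.args).map (fun _ => e.1) = fail) := by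
    intro n e he
    rw [Store.exactMatch_ground n.1 _ _ _ hl
      (hc (fun e => e.2.1 ≠ 0 ∧ Even e.2.1) e (by simpa using he)).2.2.2]
    exact ⟨fun h => by rw [if_pos h, pure_map], fun h => by rw [if_neg h, fail_map]⟩
  obtain ⟨e, -, he⟩ := ifAny_alts_of_exists h₁ (by
      obtain ⟨e, h₁, h₂, h₃, h₄, h₅⟩ := h'
      exact ⟨e, by simp [h₁, h₂, h₄, h₅], h₃⟩)
    (fun _ d => Outcome.pure (st.record d l))
    (fun n => Outcome.orElse (alts ((((negCounts Lit.sign l.sign 0 stk).filter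
      fun e => l.Same e.2.2).filter fun e => e.2.1 ≠ 0 ∧ Even e.2.1).map fun e =>
        (unifyArgs (n.1 + 1) st.toStore l.args e.2.2.args).map fun s =>
          (st.setStore s).record e.1 l)) n.2)
  refine ⟨e.1, fun n o => ?_⟩
  rw [checkStack, ifAny_alts_of_not_exists (h₀ n)]
  exact he (n, o)

/-- Neither kind of cycle is found, and for ground arguments the attempt to unify with the ancestors
of even loops adds no further alternatives. -/
theorem checkStack_of_not_mem {o : Outcome (State R F)} (hl : st.GroundLit l)
    (hd : ∀ d ∈ stk, l.Same d → st.GroundLit d)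
    (h : ¬ ∃ d ∈ stk, l.Same d ∧ l.args.map st.walk = d.args.map st.walk) :
    checkStack (n + 1) stk l st o = o := by
  have key : ∀ e ∈ (negCounts Lit.sign l.sign 0 stk).filter fun e => l.Same e.2.2,
      st.GroundLit e.2.2 ∧ l.args.map st.walk ≠ e.2.2.args.map st.walk := by
    intro e he
    simp only [List.mem_filter, decide_eq_true_eq] at he
    have hm := mem_of_mem_negCounts he.1
    exact ⟨hd _ hm he.2, fun h' => h ⟨_, hm, he.2, h'⟩⟩
  rw [checkStack, ifAny_alts_of_not_exists fun e he => ?_,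
    ifAny_alts_of_not_exists fun e he => ?_, alts_eq_fail, fail_orElse]
  · intro o ho
    obtain ⟨e, he, rfl⟩ := List.mem_map.1 ho
    have := key e (List.mem_filter.1 he).1
    rw [Store.unifyArgs_ground n _ _ _ hl this.1, if_neg this.2, fail_map]
  · have := key e (List.mem_filter.1 he).1
    rw [Store.exactMatch_ground n _ _ _ hl this.1, if_neg this.2, fail_map]
  · have := key e (List.mem_filter.1 he).1
    rw [Store.exactMatch_ground n _ _ _ hl this.1, if_neg this.2]

end CallGround

end Calls

/-! ### Correspondence of the states of the two methods -/

section Correspondence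

variable {R : Type v} {F : Type u}

theorem exists_iff_of_forall₂ {α β : Type*} {r : α → β → Prop} {p : α → Prop} {q : β → Prop}
    {l : List α} {l' : List β} (h : List.Forall₂ r l l') (hpq : ∀ a b, r a b → (p a ↔ q b)) :
    (∃ a ∈ l, p a) ↔ ∃ b ∈ l', q b := by
  induction h with
  | nil => simp
  | cons h _ ih => simp [hpq _ _ h, ih]

/-- The propositional literal for a literal at run time; it is undefined for the heads of sub-checks,
and for calls of a dual with arguments different from those in the head of the clause. -/
def absLit (P : Program R F) (st : Store F) (l : Lit R F) :
    Option (Propositional.Lit (Atom R F)) :=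
  match l.sym with
  | .user h r => some (l.naf, .atom ⟨h, r, l.args.map st.walk⟩)
  | .dual k => if ∃ c, P[k]? = some c ∧ l.args.map st.walk = c.headArgs then some (false, .dual k)
    else none
  | .chk _ => none

/-- Literals that are ground, except perhaps for the heads of sub-checks. -/
structure LitOK (st : Store F) (l : Lit R F) : Prop where
  ground : (∀ k, l.sym ≠ .chk k) → st.GroundLit l
  naf : (∀ h r, l.sym ≠ .user h r) → l.naf = false

theorem LitOK.keeps {st st' : Store F} {l : Lit R F} (h : LitOK st l) (hk : st.Keeps st') :
    LitOK st' l :=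
  ⟨fun hs => hk.groundLit (h.ground hs), h.naf⟩

theorem LitOK.absLit_keeps {st st' : Store F} {l : Lit R F} (h : LitOK st l) (hk : st.Keeps st')
    (P : Program R F) : absLit P st' l = absLit P st l := by
  unfold absLit
  cases hs : l.sym with
  | chk k => rfl
  | _ => simp only [hk.map_walk (h.ground (by simp [hs]))]

theorem sym_ne_chk_of_absLit {P : Program R F} {st : Store F} {l : Lit R F}
    {lp : Propositional.Lit (Atom R F)} (h : absLit P st l = some lp) (k : ℕ) :
    l.sym ≠ .chk k ∧ lp.2 ≠ .chk k := by
  unfold absLit at h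
  cases hs : l.sym with
  | user h' r => simp [hs] at h; simp [← h]
  | dual j => simp [hs] at h; simp [← h.2]
  | chk j => simp [hs] at h

/-- For literals of the program the image contains sign, symbol and argument values, hence
everything that a conflict depends on. Duals are never negated and sub-checks have no image, so
neither conflicts with anything relevant; this also covers a dual `d` whose image is undefined. -/
theorem conflict_iff_absLit {P : Program R F} {st : Store F} {l d : Lit R F}
    {lp : Propositional.Lit (Atom R F)} (hl : LitOK st l) (hd : LitOK st d)
    (h : absLit P st l = some lp) :
    (l.Conflict d ∧ l.args.map st.walk = d.args.map st.walk) ↔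
      ∃ dp, absLit P st d = some dp ∧ Propositional.Conflict Atom.Complementary lp dp := by
  have hlen : l.args.map st.walk = d.args.map st.walk → l.args.length = d.args.length := fun e => by
    simpa using congrArg List.length e
  unfold absLit at h ⊢
  cases hs : l.sym with
  | chk k => simp [hs] at h
  | user g r =>
    simp only [hs, Option.some.injEq] at h
    subst h
    cases hs' : d.sym with
    | chk k => simp [Lit.Conflict, hs, hs']
    | dual k =>
      simp only [Lit.Conflict, hs, hs', Propositional.Conflict]
      constructor
      · rintro ⟨⟨-, ⟨-, h⟩ | ⟨-, -, _, _, -, h⟩⟩, -⟩ <;> cases h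
      · rintro ⟨dp, h, h'⟩
        split_ifs at h
        simp only [Option.some.injEq] at h
        subst h
        simp at h'
    | user g' r' =>
      simp only [Lit.Conflict, hs, hs', Propositional.Conflict, Option.some.injEq,
        exists_eq_left', Propositional.Sym.atom.injEq, Atom.mk.injEq, Sym.user.injEq,
        Atom.Complementary]
      constructor
      · rintro ⟨⟨-, ⟨h₁, h₂, h₃⟩ | ⟨h₁, h₂, x, y, ⟨h₃, h₄⟩, h₅, h₆⟩⟩, e⟩
        · exact Or.inl ⟨h₁, h₂, h₃, e⟩
        · exact Or.inr ⟨h₁, h₂, _, _, ⟨by simp [h₃, h₅], by simp [h₄, h₆], e⟩, rfl, rfl⟩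
      · rintro (⟨h₁, h₂, h₃, e⟩ | ⟨h₁, h₂, _, _, ⟨h₃, h₄, e⟩, rfl, rfl⟩)
        · exact ⟨⟨hlen e, Or.inl ⟨h₁, h₂, h₃⟩⟩, e⟩
        · exact ⟨⟨hlen e, Or.inr ⟨h₁, h₂, g, r, ⟨rfl, rfl⟩, by
            have h₃ : g = !g' := h₃
            simp [h₃], h₄.symm⟩⟩, e⟩
  | dual k =>
    simp only [hs] at h
    split_ifs at h
    simp only [Option.some.injEq] at h
    subst h
    have hn := hl.naf (by simp [hs])
    cases hs' : d.sym with
    | chk j => simp [Lit.Conflict, hs, hs']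
    | user g' r' => simp [Lit.Conflict, hs, hs', Propositional.Conflict]
    | dual j =>
      have hn' := hd.naf (by simp [hs'])
      simp only [Lit.Conflict, hs, hn, hn']
      constructor
      · rintro ⟨⟨-, ⟨h, -⟩ | ⟨-, -, _, _, h, -⟩⟩, -⟩
        · exact absurd rfl h
        · cases h
      · rintro ⟨dp, h, h'⟩
        split_ifs at h
        simp only [Option.some.injEq] at h
        subst h
        simp [Propositional.Conflict] at h'

/-- The image of a dual forgets the arguments, but it is only defined when they are those in the
head of the clause. Two duals with the same image thus have the same arguments. -/
theorem same_iff_absLit {P : Program R F} {st : Store F} {l d : Lit R F}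
    {lp : Propositional.Lit (Atom R F)} (hl : LitOK st l) (hd : LitOK st d)
    (h : absLit P st l = some lp) :
    (l.Same d ∧ l.args.map st.walk = d.args.map st.walk) ↔ absLit P st d = some lp := by
  have hlen : l.args.map st.walk = d.args.map st.walk → l.args.length = d.args.length := fun e => by
    simpa using congrArg List.length e
  unfold absLit at h ⊢
  cases hs : l.sym with
  | chk k => simp [hs] at h
  | user g r =>
    simp only [hs, Option.some.injEq] at h
    subst h
    cases hs' : d.sym with
    | chk k => simp [Lit.Same, hs, hs']
    | dual k => simp [Lit.Same, hs, hs']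
    | user g' r' =>
      simp only [Lit.Same, hs, hs', Option.some.injEq, Prod.mk.injEq,
        Propositional.Sym.atom.injEq, Atom.mk.injEq, Sym.user.injEq]
      constructor
      · rintro ⟨⟨h₁, ⟨h₂, h₃⟩, h₄⟩, e⟩
        exact ⟨h₁.symm, h₂.symm, h₃.symm, e.symm⟩
      · rintro ⟨h₁, h₂, h₃, e⟩
        exact ⟨⟨h₁.symm, ⟨h₂.symm, h₃.symm⟩, hlen e.symm⟩, e.symm⟩
  | dual k =>
    simp only [hs] at h
    split_ifs at h with hc
    obtain ⟨c, hc, hc'⟩ := hc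
    simp only [Option.some.injEq] at h
    subst h
    have hn := hl.naf (by simp [hs])
    cases hs' : d.sym with
    | chk j => simp [Lit.Same, hs, hs']
    | user g' r' => simp [Lit.Same, hs, hs']
    | dual j =>
      have hn' := hd.naf (by simp [hs'])
      simp only [Lit.Same, hs, hs', hn, hn', Sym.dual.injEq]
      constructor
      · rintro ⟨⟨-, rfl, -⟩, e⟩
        rw [if_pos ⟨c, hc, by rw [← e, hc']⟩]
      · intro h
        split_ifs at h with h'
        obtain ⟨c', h₁, h₂⟩ := h'
        obtain rfl : j = k := by simpa using h
        obtain rfl : c = c' := by simpa [hc] using h₁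
        have e : l.args.map st.walk = d.args.map st.walk := by rw [hc', h₂]
        exact ⟨⟨trivial, rfl, hlen e⟩, e⟩

/-- Entries of the two call stacks correspond to each other. -/
def Corresponds (P : Program R F) (st : Store F) (l : Lit R F)
    (lp : Propositional.Lit (Atom R F)) : Prop :=
  LitOK st l ∧ (absLit P st l = some lp ∨ ∃ k, l.sym = .chk k ∧ lp = (false, .chk k))

theorem Corresponds.keeps {P : Program R F} {st st' : Store F} {l : Lit R F}
    {lp : Propositional.Lit (Atom R F)} (h : Corresponds P st l lp) (hk : st.Keeps st') :
    Corresponds P st' l lp :=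
  ⟨h.1.keeps hk, h.2.imp (fun h' => by rw [h.1.absLit_keeps hk, h']) id⟩

/-- Corresponding stacks therefore have the same numbers of negations, by `forall₂_negCounts`. -/
theorem Corresponds.sign_eq {P : Program R F} {st : Store F} {l : Lit R F}
    {lp : Propositional.Lit (Atom R F)} (h : Corresponds P st l lp) :
    l.sign = Propositional.sign lp := by
  rcases h with ⟨-, h | ⟨k, h, rfl⟩⟩
  · unfold absLit at h
    unfold Lit.sign
    cases hs : l.sym with
    | user g r => simp only [hs, Option.some.injEq] at h; subst h; rfl
    | dual k =>
      simp only [hs] at h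
      split_ifs at h
      simp only [Option.some.injEq] at h
      subst h
      rfl
    | chk k => simp [hs] at h
  · simp [Lit.sign, h, Propositional.sign]

theorem Corresponds.same_iff {P : Program R F} {st : Store F} {l d : Lit R F}
    {lp dp : Propositional.Lit (Atom R F)} (hl : LitOK st l) (h : absLit P st l = some lp)
    (hd : Corresponds P st d dp) :
    (l.Same d ∧ l.args.map st.walk = d.args.map st.walk) ↔ dp = lp := by
  rw [same_iff_absLit hl hd.1 h]
  rcases hd with ⟨-, hd | ⟨k, hd, rfl⟩⟩
  · simp [hd]
  · have := (sym_ne_chk_of_absLit h k).2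
    simp only [absLit, hd, reduceCtorEq, false_iff]
    rintro rfl
    exact this rfl

theorem Corresponds.conflict_iff {P : Program R F} {st : Store F} {l d : Lit R F}
    {lp dp : Propositional.Lit (Atom R F)} (hl : LitOK st l) (h : absLit P st l = some lp)
    (hd : Corresponds P st d dp) :
    (l.Conflict d ∧ l.args.map st.walk = d.args.map st.walk) ↔
      Propositional.Conflict Atom.Complementary lp dp := by
  rw [conflict_iff_absLit hl hd.1 h]
  rcases hd with ⟨-, hd | ⟨k, hd, rfl⟩⟩
  · simp [hd]
  · have := (sym_ne_chk_of_absLit h k).2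
    simp only [absLit, hd, reduceCtorEq, false_and, exists_false, false_iff]
    rintro (⟨-, h'⟩ | ⟨-, -, a, b, -, -, h'⟩)
    · exact this h'
    · cases h'

/-- The states of the two methods correspond to each other; `D` contains the indices of the sub-checks
that may have been called. -/
structure StateRel (P : Program R F) (D : Set ℕ) (st : State R F)
    (chs : List (Propositional.Lit (Atom R F))) : Prop where
  good : st.toStore.Good
  pending : ∀ p ∈ st.pending, st.toStore.GroundLit p.2
  ok : ∀ d ∈ st.chs, LitOK st.toStore d
  abs : st.chs.filterMap (absLit P st.toStore) = chs.filter fun l => ∀ k, l.2 ≠ .chk k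
  dom : ∀ k, ((∃ d ∈ st.chs, d.sym = .chk k) ∨ ∃ d ∈ chs, d.2 = .chk k) → k ∈ D

theorem StateRel.mono {P : Program R F} {D D' : Set ℕ} {st : State R F}
    {chs : List (Propositional.Lit (Atom R F))} (h : StateRel P D st chs) (hD : D ⊆ D') :
    StateRel P D' st chs :=
  { h with dom := fun k hk => hD (h.dom k hk) }

theorem StateRel.keeps {P : Program R F} {D : Set ℕ} {st : State R F} {s : Store F}
    {chs : List (Propositional.Lit (Atom R F))} (h : StateRel P D st chs)
    (hs : st.toStore.Keeps s) (hg : s.Good) : StateRel P D (st.setStore s) chs where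
  good := hg
  pending p hp := hs.groundLit (h.pending p hp)
  ok d hd := (h.ok d hd).keeps hs
  abs := by
    rw [← h.abs]
    exact List.filterMap_congr fun d hd => (h.ok d hd).absLit_keeps hs P
  dom := h.dom

theorem StateRel.mem_iff {P : Program R F} {D : Set ℕ} {st : State R F}
    {chs : List (Propositional.Lit (Atom R F))} (h : StateRel P D st chs)
    {dp : Propositional.Lit (Atom R F)} (hdp : ∀ k, dp.2 ≠ .chk k) :
    dp ∈ chs ↔ ∃ d ∈ st.chs, absLit P st.toStore d = some dp := by
  rw [← List.mem_filterMap, h.abs]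
  simp [hdp]

/-- The state after the success of the call `l` at depth `d` by expansion. -/
def State.closed (st : State R F) (d : ℕ) (l : Lit R F) : State R F :=
  { st with
    chs := l :: st.chs
    pending := st.pending.filter fun p => p.1 ≠ d }

theorem seq_of_forall_pure {α γ : Type*} {f : γ → α → Outcome α} {a : α} (gs : List γ)
    (h : ∀ g, f g a = Outcome.pure a) : seq f gs a = Outcome.pure a := by
  induction gs with
  | nil => rfl
  | cons g gs ih => rw [seq_cons, h, Outcome.pure_bind, ih]

/-- Loop variables would have to occur in a pending call, and pending calls are ground. So nothing
is constrained, the list of loop variables stays empty, and only the CHS and the pending list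
change. -/
theorem close_eq {st : State R F} (hg : st.toStore.Good)
    (hp : ∀ p ∈ st.pending, st.toStore.GroundLit p.2) (n d : ℕ) (l : Lit R F) :
    close n d l st = Outcome.pure (st.closed d l) := by
  have hv : loopVars d l (st.setStore st.toStore) = [] := by
    rw [loopVars, List.filter_eq_nil_iff]
    intro x _
    simp only [decide_eq_true_eq, not_exists, not_and]
    intro p hp' _ hx
    obtain ⟨t, ht, hx⟩ := List.mem_flatMap.1 hx
    exact Term.isGround_iff.1 (hp p hp' t ht) x hx
  rw [close, seq_of_forall_pure, pure_map, hv]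
  · rfl
  · intro e
    rw [if_neg]
    rintro ⟨t, -, x, -, h⟩
    exact hg.not_isLoop x h

/-- The value `none` of `lp` covers entries without a propositional image: heads of sub-checks, and
duals called with arguments other than those in the head. -/
theorem StateRel.closed {P : Program R F} {D : Set ℕ} {st : State R F}
    {chs : List (Propositional.Lit (Atom R F))} (h : StateRel P D st chs) {l : Lit R F}
    (hl : LitOK st.toStore l) (hD : ∀ k, l.sym = .chk k → k ∈ D) (d : ℕ)
    {lp : Option (Propositional.Lit (Atom R F))} (ha : absLit P st.toStore l = lp) :
    StateRel P D (st.closed d l) (lp.toList ++ chs) where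
  good := h.good
  pending p hp := h.pending p (List.mem_of_mem_filter hp)
  ok := by
    intro d' hd
    rcases List.mem_cons.1 hd with rfl | hd
    exacts [hl, h.ok d' hd]
  abs := by
    change (l :: st.chs).filterMap (absLit P st.toStore) = _
    cases lp with
    | none => rw [List.filterMap_cons_none ha, h.abs]; rfl
    | some lp =>
      rw [List.filterMap_cons_some ha, h.abs]
      simp [(fun k => (sym_ne_chk_of_absLit ha k).2 : ∀ k, lp.2 ≠ .chk k)]
  dom := by
    rintro k (⟨d', hd, hk⟩ | ⟨d', hd, hk⟩)
    · rcases List.mem_cons.1 hd with rfl | hd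
      exacts [hD k hk, h.dom k (Or.inl ⟨d', hd, hk⟩)]
    · rcases List.mem_append.1 hd with hd | hd
      · cases lp with
        | none => simp at hd
        | some lp =>
          simp only [Option.toList_some, List.mem_singleton] at hd
          subst hd
          exact absurd hk (sym_ne_chk_of_absLit ha k).2
      · exact h.dom k (Or.inr ⟨d', hd, hk⟩)

/-- A transition to a state that corresponds to `chs'`. -/
structure Step (P : Program R F) (D : Set ℕ) (st st' : State R F)
    (chs' : List (Propositional.Lit (Atom R F))) : Prop where
  rel : StateRel P D st' chs'
  ext : st.toStore.Extends st'.toStore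
  chk : ∀ d ∈ st'.chs, (∃ k, d.sym = .chk k) → d ∈ st.chs

theorem StateRel.step {P : Program R F} {D : Set ℕ} {st : State R F}
    {chs : List (Propositional.Lit (Atom R F))} (h : StateRel P D st chs) : Step P D st st chs :=
  ⟨h, .refl _, fun _ hd _ => hd⟩

theorem StateRel.step_setStore {P : Program R F} {D : Set ℕ} {st : State R F} {s : Store F}
    {chs : List (Propositional.Lit (Atom R F))} (h : StateRel P D st chs)
    (hs : st.toStore.Extends s) (hg : s.Good) : Step P D st (st.setStore s) chs :=
  ⟨h.keeps (hs.keeps h.good.1) hg, hs, fun _ hd _ => hd⟩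

theorem Step.trans {P : Program R F} {D : Set ℕ} {st st' st'' : State R F}
    {chs' chs'' : List (Propositional.Lit (Atom R F))} (h : Step P D st st' chs')
    (h' : Step P D st' st'' chs'') : Step P D st st'' chs'' :=
  ⟨h'.rel, h.ext.trans h'.ext, fun d hd hk => h.chk d (h'.chk d hd hk) hk⟩

theorem Step.closed {P : Program R F} {D : Set ℕ} {st st' : State R F}
    {chs' : List (Propositional.Lit (Atom R F))} (h : Step P D st st' chs') {l : Lit R F}
    (hl : LitOK st'.toStore l) (hc : ∀ k, l.sym ≠ .chk k) (d : ℕ)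
    {lp : Option (Propositional.Lit (Atom R F))} (ha : absLit P st'.toStore l = lp) :
    Step P D st (st'.closed d l) (lp.toList ++ chs') where
  rel := h.rel.closed hl (fun k hk => absurd hk (hc k)) d ha
  ext := h.ext
  chk d' hd hk := by
    rcases List.mem_cons.1 hd with rfl | hd
    · obtain ⟨k, hk⟩ := hk
      exact absurd hk (hc k)
    · exact h.chk d' hd hk

end Correspondence

/-! ### Execution of rules -/

section Rules

variable {R : Type v} {F : Type u}

/-- Execution of one rule for the call `l`. -/
def runRule (P : Program R F) (n : ℕ) (stk : List (Lit R F)) (l : Lit R F) (st : State R F)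
    (r : Rule R F) : Outcome (State R F) :=
  (unifyArgs n { st.toStore with next := st.next + r.bound } l.args
      (r.shift st.next).params).bind fun s =>
    (seq (exec P n (l :: stk)) (r.shift st.next).body (st.setStore s)).bind
      (close n stk.length l)

theorem exec_lit_eq (P : Program R F) (n : ℕ) (stk : List (Lit R F)) (l : Lit R F)
    (st : State R F) :
    exec P (n + 1) stk (.lit l) st = call n stk l st fun st₀ =>
      alts ((rulesFor P l).map (runRule P n stk l st₀)) :=
  exec_lit P n stk l st

theorem map_walk_shift_range (K m : ℕ) :
    (((List.range K).map .var : List (Term F)).map (Term.subst fun x => .var (x + m))) =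
      (List.range' m K).map .var := by
  refine List.ext_getElem (by simp) fun i h₁ h₂ => ?_
  simp [Term.subst, Nat.add_comm]

theorem le_bound {r : Rule R F} {K : ℕ} (hr : r.params = (List.range K).map .var) :
    K ≤ r.bound := by
  rcases K with _ | K
  · exact Nat.zero_le _
  · refine lt_varBound (List.mem_append_left _ (List.mem_flatMap.2 ⟨.var K, ?_, ?_⟩))
    · rw [hr]; simp
    · simp [Term.vars]

/-- The call of a rule with variables as parameters for ground arguments. -/
theorem exists_runRule_ground (P : Program R F) (stk : List (Lit R F)) {l : Lit R F}
    {st : State R F} (hst : st.toStore.Good) (hl : st.toStore.GroundLit l) {r : Rule R F}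
    (hr : r.params = (List.range l.args.length).map .var) :
    ∃ s : Store F, s.Good ∧ st.toStore.Extends s ∧
      st.next + l.args.length ≤ s.next ∧
      (∀ i a, l.args[i]? = some a → s.sub (st.next + i) = st.walk a) ∧
      ∀ n, runRule P (n + 1) stk l st r =
        (seq (exec P (n + 1) (l :: stk)) (r.shift st.next).body (st.setStore s)).bind
          (close (n + 1) stk.length l) := by
  have hb := le_bound hr
  obtain ⟨s, hs, hs₁, hs₂, hs₃, hs₄, hs₅, hs₆, hs₇⟩ :=
    Store.exists_seq_unify_fresh l.args st.next { st.toStore with next := st.next + r.bound }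
      hst.1 (fun a ha => Or.inl (hl a ha)) (List.pairwise_of_forall_mem_list fun a ha b _ y h => by
        have h' : (st.walk a).IsGround := hl a ha
        rw [show st.walk a = .var y from h] at h'
        exact absurd h' (Term.not_isGround_var y))
  refine ⟨s, ⟨hs₁.mono (by rw [hs₂]; exact Nat.add_le_add_left hb _), by rw [hs₃]; exact hst.2⟩,
    ⟨by rw [hs₂]; exact Nat.le_add_right _ _, hs₇ hl⟩,
    by rw [hs₂]; exact Nat.add_le_add_left hb _, fun i a ha => ?_, fun n => ?_⟩
  · rcases (hs₆ i a ha).2 with h | ⟨⟨y, h⟩, -⟩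
    · exact h.2
    · have := hl a (List.mem_of_getElem? ha)
      rw [show st.walk a = .var y from h] at this
      exact absurd this (Term.not_isGround_var y)
  · rw [runRule, unifyArgs, if_pos (by simp [Rule.shift, hr])]
    have : (r.shift st.next).params = (List.range' st.next l.args.length).map .var := by
      rw [Rule.shift, hr, map_walk_shift_range]
    rw [this, hs, Outcome.pure_bind]

/-- Conjunctions of tests as goals. -/
def testGoals (T : List (Bool × Builtin F)) : List (Goal R F) := T.map fun g => .test g.1 g.2

theorem negations_argTests (ts : List (Term F)) :
    negations ((argTests 0 ts).map fun g => (BodyGoal.test g.1 g.2 : BodyGoal R F)) =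
      ts.mapIdx fun i t => ((argTests 0 ts).take i ++ [(true, Builtin.eq (.var i) t)]).map
        fun g => BodyGoal.test g.1 g.2 := by
  refine List.ext_getElem (by simp [negations, argTests]) fun i h₁ h₂ => ?_
  simp [negations, argTests, BodyGoal.neg, ← List.map_take]

/-- The body of a rule for the dual of a clause without variables, with renamed variables: one of the
arguments differs from that in the head. -/
def differBody (m : ℕ) (ts : List (Term F)) (i : ℕ) (t : Term F) : List (Bool × Builtin F) :=
  (argTests m ts).take i ++ [(true, .eq (.var (m + i)) t)]

/-- A rule for the dual of a clause without variables: an argument differs from that in the head. -/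
def differRule (ts : List (Term F)) (i : ℕ) (t : Term F) : Rule R F :=
  ⟨(List.range ts.length).map .var, testGoals (differBody 0 ts i t)⟩

/-- A rule for the dual of a clause without variables: the arguments are those in the head, and the
negation of a goal in the body holds. -/
def negRule (ts : List (Term F)) (g : BodyGoal R F) : Rule R F :=
  ⟨(List.range ts.length).map .var, testGoals (argTests 0 ts) ++ [g.neg.toGoal]⟩

/-- Here the separate treatment of clauses without variables matters: a negated body goal is
preceded by the tests of the arguments only, not by the body goals before it. After the tests one
alternative per body goal remains, as in the propositional dual. -/
theorem Clause.IsGround.dualRules {c : Clause R F} (hc : c.IsGround) :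
    c.dualRules = (c.headArgs.mapIdx fun i t => differRule c.headArgs i t) ++
      c.body.map (negRule c.headArgs) := by
  rw [Clause.dualRules, Clause.dualBodies, if_pos hc, hc.headGoals, hc.headVars, hc.bodyVars,
    negations_argTests, List.map_append, List.append_nil]
  congr 1
  · refine List.ext_getElem (by simp) fun i h₁ h₂ => ?_
    simp [differRule, testGoals, differBody, BodyGoal.toGoal, Function.comp_def]
  · simp [negRule, testGoals, BodyGoal.toGoal, Function.comp_def]

theorem shift_testGoals_argTests (m : ℕ) {ts : List (Term F)} (h : ∀ t ∈ ts, t.IsGround) :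
    (testGoals (R := R) (argTests 0 ts)).map (Goal.shift m) = testGoals (argTests m ts) := by
  have := argTests_shift (R := R) m 0 h
  rw [Nat.zero_add] at this
  simp only [testGoals]
  rw [← this]
  simp [BodyGoal.toGoal, Function.comp_def]

theorem shift_differRule (m : ℕ) {ts : List (Term F)} (h : ∀ t ∈ ts, t.IsGround) {i : ℕ}
    {t : Term F} (ht : ts[i]? = some t) :
    ((differRule ts i t : Rule R F).shift m).body = testGoals (differBody m ts i t) := by
  have := shift_testGoals_argTests (R := R) m h
  simp only [differRule, Rule.shift, differBody, testGoals, List.map_append, List.map_take,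
    List.map_cons, List.map_nil] at this ⊢
  rw [this]
  simp only [Goal.shift, Builtin.subst, Term.subst, (h t (List.mem_of_getElem? ht)).subst,
    Nat.zero_add, Nat.add_comm m]

theorem shift_negRule (m : ℕ) {ts : List (Term F)} (h : ∀ t ∈ ts, t.IsGround) {g : BodyGoal R F}
    (hg : g.vars = []) :
    ((negRule ts g).shift m).body = testGoals (argTests m ts) ++ [g.neg.toGoal] := by
  simp only [negRule, Rule.shift, List.map_append, shift_testGoals_argTests m h, List.map_cons,
    List.map_nil, BodyGoal.shift_toGoal (g := g.neg) (by rw [BodyGoal.vars_neg, hg])]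

theorem mem_argTests {m : ℕ} {ts : List (Term F)} {g : Bool × Builtin F} :
    g ∈ argTests m ts ↔ ∃ i t, ts[i]? = some t ∧ g = (false, .eq (.var (m + i)) t) := by
  simp only [argTests, List.mem_mapIdx, List.getElem?_eq_some_iff]
  constructor
  · rintro ⟨i, hi, rfl⟩
    exact ⟨i, _, ⟨hi, rfl⟩, rfl⟩
  · rintro ⟨i, _, ⟨hi, rfl⟩, rfl⟩
    exact ⟨i, hi, rfl⟩

theorem mem_take_argTests {m j : ℕ} {ts : List (Term F)} {g : Bool × Builtin F} :
    g ∈ (argTests m ts).take j ↔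
      ∃ i t, i < j ∧ ts[i]? = some t ∧ g = (false, .eq (.var (m + i)) t) := by
  simp only [List.mem_take_iff_getElem, argTests, List.getElem?_eq_some_iff]
  constructor
  · rintro ⟨i, hi, rfl⟩
    simp only [List.length_mapIdx, lt_min_iff] at hi
    exact ⟨i, _, hi.1, ⟨hi.2, rfl⟩, by simp⟩
  · rintro ⟨i, _, hj, ⟨hi, rfl⟩, rfl⟩
    exact ⟨i, by simp [hi, hj], by simp⟩

/-- Tests of equality for variables bound to ground terms. -/
theorem seq_argTests_ground (P : Program R F) (n : ℕ) (stk : List (Lit R F)) {m : ℕ}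
    {ts : List (Term F)} (hts : ∀ t ∈ ts, t.IsGround) {st : State R F} {as : List (Term F)}
    (hl : as.length = ts.length) (hg : ∀ a ∈ as, (st.walk a).IsGround)
    (ha : ∀ i a, as[i]? = some a → st.sub (m + i) = st.walk a) :
    seq (exec P (n + 2) stk) (testGoals (argTests m ts)) st =
      if as.map st.walk = ts then Outcome.pure st else fail := by
  have key : ∀ i t, ts[i]? = some t → ∃ a, as[i]? = some a ∧ st.sub (m + i) = st.walk a ∧
      (st.walk a).IsGround ∧ t.IsGround := by
    intro i t ht
    have hi : i < as.length := by rw [hl]; exact (List.getElem?_eq_some_iff.1 ht).1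
    exact ⟨as[i], by simp, ha i _ (by simp), hg _ (by simp), hts t (List.mem_of_getElem? ht)⟩
  have e : (∀ g ∈ argTests m ts, ((g.2.subst st.sub).Holds ↔ g.1 = false)) ↔
      as.map st.walk = ts := by
    constructor
    · intro h
      refine List.ext_getElem (by simpa using hl) fun i h₁ h₂ => ?_
      obtain ⟨a, h₃, h₄, h₅, h₆⟩ := key i ts[i] (by simp)
      have := h (false, .eq (.var (m + i)) ts[i]) (mem_argTests.2 ⟨i, _, by simp, rfl⟩)
      simp only [Builtin.subst, Term.subst, Builtin.Holds, h₄, h₆.subst, iff_true] at this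
      rw [← this, List.getElem_map]
      congr 1
      simpa using (List.getElem?_eq_some_iff.1 h₃).2
    · rintro rfl g hg'
      obtain ⟨i, t, ht, rfl⟩ := mem_argTests.1 hg'
      obtain ⟨a, h₃, h₄, h₅, h₆⟩ := key i t ht
      have : st.walk a = t := by simpa [h₃] using ht
      simp [Builtin.subst, Term.subst, Builtin.Holds, h₄, h₆.subst, this]
  rw [testGoals, seq_tests_ground P n stk]
  · by_cases h : as.map st.walk = ts
    · rw [if_pos h, if_pos (e.2 h)]
    · rw [if_neg h, if_neg fun h' => h (e.1 h')]
  · intro g hg'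
    obtain ⟨i, t, ht, rfl⟩ := mem_argTests.1 hg'
    obtain ⟨a, h₃, h₄, h₅, h₆⟩ := key i t ht
    simp only [Builtin.subst, Term.subst, Builtin.vars, h₄, h₆.subst, List.append_eq_nil_iff]
    exact ⟨h₅, h₆⟩

/-- The test whether `i` is the first argument that differs. -/
theorem seq_differBody_ground (P : Program R F) (n : ℕ) (stk : List (Lit R F)) {m : ℕ}
    {ts : List (Term F)} (hts : ∀ t ∈ ts, t.IsGround) {st : State R F} {as : List (Term F)}
    (hl : as.length = ts.length) (hg : ∀ a ∈ as, (st.walk a).IsGround)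
    (ha : ∀ i a, as[i]? = some a → st.sub (m + i) = st.walk a) {i : ℕ} {t : Term F}
    (ht : ts[i]? = some t) :
    seq (exec P (n + 2) stk) (testGoals (differBody m ts i t)) st =
      if (∀ j < i, (as.map st.walk)[j]? = ts[j]?) ∧ (as.map st.walk)[i]? ≠ ts[i]?
        then Outcome.pure st else fail := by
  have key : ∀ i t, ts[i]? = some t → ∃ a, as[i]? = some a ∧ st.sub (m + i) = st.walk a ∧
      (st.walk a).IsGround ∧ t.IsGround := by
    intro i t ht
    have hi : i < as.length := by rw [hl]; exact (List.getElem?_eq_some_iff.1 ht).1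
    exact ⟨as[i], by simp, ha i _ (by simp), hg _ (by simp), hts t (List.mem_of_getElem? ht)⟩
  have hi := (List.getElem?_eq_some_iff.1 ht).1
  have e : (∀ g ∈ differBody m ts i t, ((g.2.subst st.sub).Holds ↔ g.1 = false)) ↔
      (∀ j < i, (as.map st.walk)[j]? = ts[j]?) ∧ (as.map st.walk)[i]? ≠ ts[i]? := by
    simp only [differBody, List.mem_append, List.mem_singleton, or_imp, forall_and, forall_eq]
    refine and_congr ⟨fun h j hj => ?_, fun h g hg => ?_⟩ ?_
    · obtain ⟨a, h₃, h₄, h₅, h₆⟩ := key j ts[j] (by simp)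
      have := h _ (mem_take_argTests.2 ⟨j, ts[j], hj, by simp, rfl⟩)
      simp only [Builtin.subst, Term.subst, Builtin.Holds, h₄, h₆.subst, iff_true] at this
      simp [h₃, this]
    · obtain ⟨j, t, hj, ht, rfl⟩ := mem_take_argTests.1 hg
      obtain ⟨a, h₃, h₄, h₅, h₆⟩ := key j t ht
      have := h j hj
      simp only [List.getElem?_map, h₃, ht, Option.map_some, Option.some.injEq] at this
      simp [Builtin.subst, Term.subst, Builtin.Holds, h₄, h₆.subst, this]
    · obtain ⟨a, h₃, h₄, h₅, h₆⟩ := key i t ht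
      simp [Builtin.subst, Term.subst, Builtin.Holds, h₄, h₆.subst, h₃, ht]
  rw [testGoals, seq_tests_ground P n stk]
  · by_cases h : (∀ j < i, (as.map st.walk)[j]? = ts[j]?) ∧ (as.map st.walk)[i]? ≠ ts[i]?
    · rw [if_pos h, if_pos (e.2 h)]
    · rw [if_neg h, if_neg fun h' => h (e.1 h')]
  · intro g hg'
    have : ∃ s j t, ts[j]? = some t ∧ g = (s, .eq (.var (m + j)) t) := by
      rcases List.mem_append.1 hg' with h | h
      · obtain ⟨j, t, -, ht, rfl⟩ := mem_take_argTests.1 h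
        exact ⟨_, j, t, ht, rfl⟩
      · exact ⟨true, i, t, ht, by simpa using h⟩
    obtain ⟨s, j, t, ht, rfl⟩ := this
    obtain ⟨a, h₃, h₄, h₅, h₆⟩ := key j t ht
    simp only [Builtin.subst, Term.subst, Builtin.vars, h₄, h₆.subst, List.append_eq_nil_iff]
    exact ⟨h₅, h₆⟩

end Rules

/-! ### Simulation of ground calls -/

section Simulation

variable {R : Type v} {F : Type u}

/-- A set of literals that contains those called by the rules of the program. -/
structure CallClosed (P : Program R F) (U : Finset (Propositional.Lit (Atom R F))) : Prop where
  body : ∀ c ∈ P, ∀ s a, BodyGoal.lit s a ∈ c.body → ∀ s', (s', .atom a) ∈ U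
  head : ∀ c ∈ P, ∀ a, c.head = some a → ∀ s', (s', .atom a) ∈ U
  dual : ∀ k < P.length, (false, .dual k) ∈ U

/-- Execution of the propositional program that corresponds to a ground program. -/
abbrev propExec (P : Program R F) := Propositional.exec Atom.Complementary (P.map Clause.toProp)

/-- Calls with the given propositional call stack are executed in the same way by both methods. -/
def SimulatesCalls (P : Program R F) (U : Finset (Propositional.Lit (Atom R F)))
    (stkp : List (Propositional.Lit (Atom R F))) : Prop :=
  ∀ (D : Set ℕ) (stk : List (Lit R F)) (st : State R F)
    (chs : List (Propositional.Lit (Atom R F))) (l : Lit R F) (lp : Propositional.Lit (Atom R F)),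
    List.Forall₂ (Corresponds P st.toStore) stk stkp → StateRel P D st chs →
    LitOK st.toStore l → absLit P st.toStore l = some lp → lp ∈ U →
    Simulates (fun st' chs' => Step P D st st' chs') (fun n => exec P n stk (.lit l) st)
      (fun n => propExec P n stkp (.lit lp.1 lp.2) chs)

variable {P : Program R F} {U : Finset (Propositional.Lit (Atom R F))}
  {stk : List (Lit R F)} {stkp : List (Propositional.Lit (Atom R F))} {D : Set ℕ}
  {st : State R F} {chs : List (Propositional.Lit (Atom R F))}

theorem corresponds_keeps {s s' : Store F} (h : List.Forall₂ (Corresponds P s) stk stkp)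
    (hk : s.Keeps s') : List.Forall₂ (Corresponds P s') stk stkp :=
  h.imp fun _ _ h => h.keeps hk

theorem Step.corresponds {st' : State R F} {chs' : List (Propositional.Lit (Atom R F))}
    (h : Step P D st st' chs') (hst : st.toStore.Good)
    (hs : List.Forall₂ (Corresponds P st.toStore) stk stkp) :
    List.Forall₂ (Corresponds P st'.toStore) stk stkp :=
  corresponds_keeps hs (h.ext.keeps hst.1)

theorem BodyGoal.litOK {s : Bool} {a : Atom R F} (hg : (BodyGoal.lit s a).vars = [])
    (st : Store F) : LitOK st ⟨s, .user a.hyphen a.rel, a.args⟩ ∧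
      absLit P st ⟨s, .user a.hyphen a.rel, a.args⟩ = some (s, .atom a) := by
  have h : ∀ t ∈ a.args, t.IsGround := List.flatMap_eq_nil_iff.1 hg
  refine ⟨⟨fun _ t ht => ?_, fun hs => absurd rfl (hs _ _)⟩, ?_⟩
  · rw [Store.walk_ground (h t ht)]
    exact h t ht
  · have : a.args.map st.walk = a.args := by
      conv_rhs => rw [← List.map_id a.args]
      exact List.map_congr_left fun t ht => Store.walk_ground (h t ht) st
    simp [absLit, this]

theorem SimulatesCalls.bodyGoal (h : SimulatesCalls P U stkp)
    (hs : List.Forall₂ (Corresponds P st.toStore) stk stkp) (hr : StateRel P D st chs)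
    {g : BodyGoal R F} (hg : g.vars = []) (hU : ∀ s a, g = .lit s a → (s, .atom a) ∈ U) :
    Simulates (fun st' chs' => Step P D st st' chs') (fun n => exec P n stk g.toGoal st)
      (fun n => propExec P n stkp g.toProp.toInternal chs) := by
  cases g with
  | lit s a =>
    obtain ⟨h₁, h₂⟩ := BodyGoal.litOK (P := P) hg st.toStore
    exact h D stk st chs _ _ hs hr h₁ h₂ (hU s a rfl)
  | test s b =>
    refine Simulates.of_succ (Simulates.of_succ ?_)
    have hb : b.subst st.sub = b := Builtin.subst_of_vars_eq_nil hg _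
    simp only [BodyGoal.toGoal, BodyGoal.toProp, Propositional.Goal.toInternal, propExec,
      Propositional.exec]
    have e : ∀ n, exec P (n + 1 + 1) stk (.test s b) st =
        if (b.Holds ↔ s = false) then Outcome.pure st else fail := fun n => by
      rw [exec_test_ground P n stk s b st (by rw [hb]; exact hg), hb]
    simp only [e]
    by_cases hh : b.Holds ↔ s = false
    · simp only [if_pos hh]
      exact simulates_pure hr.step
    · simp only [if_neg hh]
      exact simulates_fail _

theorem SimulatesCalls.body (h : SimulatesCalls P U stkp) (gs : List (BodyGoal R F))
    (hs : List.Forall₂ (Corresponds P st.toStore) stk stkp) (hr : StateRel P D st chs)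
    (hg : ∀ g ∈ gs, g.vars = []) (hU : ∀ s a, BodyGoal.lit s a ∈ gs → (s, .atom a) ∈ U) :
    Simulates (fun st' chs' => Step P D st st' chs')
      (fun n => seq (exec P n stk) (gs.map BodyGoal.toGoal) st)
      (fun n => seq (propExec P n stkp) (gs.map fun g => g.toProp.toInternal) chs) := by
  induction gs generalizing st chs with
  | nil => exact simulates_pure hr.step
  | cons g gs ih =>
    simp only [List.map_cons, seq_cons]
    refine (h.bodyGoal hs hr (hg g (by simp)) fun s a e => hU s a (by simp [e])).bind
      fun st' chs' h' => ?_
    exact (ih (h'.corresponds hr.good hs) h'.rel (fun g hg' => hg g (by simp [hg']))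
      fun s a e => hU s a (by simp [e])).mono fun _ _ => h'.trans

theorem BodyGoal.toProp_neg (g : BodyGoal R F) : g.neg.toProp = g.toProp.neg := by
  cases g with
  | lit s a => rfl
  | test s b =>
    simp only [BodyGoal.neg, BodyGoal.toProp, Propositional.Goal.neg,
      Propositional.Goal.truth.injEq, eq_iff_iff]
    cases s <;> simp

/-- The answers of a call that succeeds by expansion. -/
def ClosedStep (P : Program R F) (D : Set ℕ) (st : State R F) (d : ℕ) (l : Lit R F)
    (lp : Propositional.Lit (Atom R F)) (st' : State R F)
    (chs' : List (Propositional.Lit (Atom R F))) : Prop :=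
  ∃ st₁ chs₁, Step P D st st₁ chs₁ ∧ st' = st₁.closed d l ∧ chs' = lp :: chs₁

/-- Continuation of the execution of a body by the addition of the call to the coinductive hypothesis
set. -/
theorem simulates_close {f : ℕ → Outcome (State R F)}
    {f' : ℕ → Outcome (List (Propositional.Lit (Atom R F)))}
    (h : Simulates (fun st' chs' => Step P D st st' chs') f f') (k : ℕ → ℕ) (d : ℕ) (l : Lit R F)
    (lp : Propositional.Lit (Atom R F)) :
    Simulates (ClosedStep P D st d l lp) (fun n => (f n).bind (close (k n) d l))
      (fun n => (f' n).map fun chs' => lp :: chs') := by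
  simp only [map_eq_bind]
  refine h.bind fun st' chs' h' => ?_
  simp only [close_eq h'.rel.good h'.rel.pending]
  exact simulates_pure ⟨st', chs', h', rfl, rfl⟩

/-- The rule tests equality before `i` and difference at `i`. For given arguments at most one
position passes, so these rules together have at most one answer. -/
theorem exists_runRule_differRule (P : Program R F) (stk : List (Lit R F)) {l : Lit R F}
    (hst : st.toStore.Good) (hp : ∀ p ∈ st.pending, st.toStore.GroundLit p.2)
    (hl : st.toStore.GroundLit l) {ts : List (Term F)}
    (hts : ∀ t ∈ ts, t.IsGround) (hlen : l.args.length = ts.length) {i : ℕ} {t : Term F}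
    (ht : ts[i]? = some t) :
    ∃ s : Store F, s.Good ∧ st.toStore.Extends s ∧
      ∀ n, runRule P (n + 2) stk l st (differRule ts i t) =
        if (∀ j < i, (l.args.map st.walk)[j]? = ts[j]?) ∧ (l.args.map st.walk)[i]? ≠ ts[i]?
          then Outcome.pure ((st.setStore s).closed stk.length l) else fail := by
  obtain ⟨s, hs₁, hs₂, hs₃, hs₄, hs₅⟩ := exists_runRule_ground P stk hst hl
    (r := differRule ts i t) (by rw [hlen]; rfl)
  have hk := hs₂.keeps hst.1
  have hw : ∀ a ∈ l.args, s.walk a = st.walk a := fun a ha => hk.walk (hl a ha)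
  refine ⟨s, hs₁, hs₂, fun n => ?_⟩
  rw [hs₅ (n + 1), shift_differRule _ hts ht,
    seq_differBody_ground P n _ hts hlen (st := st.setStore s) (hk.groundLit hl)
      (fun i a ha => by
        rw [show (st.setStore s).walk a = s.walk a from rfl, hw a (List.mem_of_getElem? ha)]
        exact hs₄ i a ha) ht,
    show l.args.map (st.setStore s).walk = l.args.map st.walk from List.map_congr_left hw]
  split_ifs with h
  · rw [Outcome.pure_bind, close_eq (st := st.setStore s) hs₁ fun p hp' => hk.groundLit (hp p hp')]
  · rw [fail_bind]

theorem alts_differRules_of_eq (P : Program R F) (n : ℕ) (stk : List (Lit R F)) {l : Lit R F}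
    (hst : st.toStore.Good) (hp : ∀ p ∈ st.pending, st.toStore.GroundLit p.2)
    (hl : st.toStore.GroundLit l) {ts : List (Term F)}
    (hts : ∀ t ∈ ts, t.IsGround) (he : l.args.map st.walk = ts) :
    alts ((ts.mapIdx fun i t => (differRule ts i t : Rule R F)).map (runRule P (n + 2) stk l st)) =
      fail := by
  refine alts_eq_fail fun o ho => ?_
  obtain ⟨r, hr, rfl⟩ := List.mem_map.1 ho
  obtain ⟨i, hi, rfl⟩ := List.mem_mapIdx.1 hr
  have hlen : l.args.length = ts.length := by simpa using congrArg List.length he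
  obtain ⟨s, -, -, hs⟩ := exists_runRule_differRule P stk hst hp hl hts hlen
    (i := i) (t := ts[i]) (by simp)
  rw [hs n, if_neg]
  rintro ⟨-, h⟩
  exact h (by rw [he])

theorem exists_runRule_negRule (P : Program R F) (stk : List (Lit R F)) {l : Lit R F}
    (hst : st.toStore.Good) (hl : st.toStore.GroundLit l) {ts : List (Term F)}
    (hts : ∀ t ∈ ts, t.IsGround) (hlen : l.args.length = ts.length) {g : BodyGoal R F}
    (hg : g.vars = []) :
    ∃ s : Store F, s.Good ∧ st.toStore.Extends s ∧
      ∀ n, runRule P (n + 2) stk l st (negRule ts g) =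
        if l.args.map st.walk = ts then
          (seq (exec P (n + 2) (l :: stk)) ([g.neg].map BodyGoal.toGoal) (st.setStore s)).bind
            (close (n + 2) stk.length l)
        else fail := by
  obtain ⟨s, hs₁, hs₂, hs₃, hs₄, hs₅⟩ := exists_runRule_ground P stk hst hl
    (r := negRule ts g) (by rw [hlen]; rfl)
  have hk := hs₂.keeps hst.1
  have hw : ∀ a ∈ l.args, s.walk a = st.walk a := fun a ha => hk.walk (hl a ha)
  refine ⟨s, hs₁, hs₂, fun n => ?_⟩
  rw [hs₅ (n + 1), shift_negRule _ hts hg, seq_append,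
    seq_argTests_ground P n _ hts hlen (st := st.setStore s) (hk.groundLit hl)
      (fun i a ha => by
        rw [show (st.setStore s).walk a = s.walk a from rfl, hw a (List.mem_of_getElem? ha)]
        exact hs₄ i a ha),
    show l.args.map (st.setStore s).walk = l.args.map st.walk from List.map_congr_left hw]
  split_ifs with h
  · rw [Outcome.pure_bind]
    rfl
  · rw [fail_bind, fail_bind]

/-- For the arguments of the head, every rule that asks for a difference fails. In the other rules
the tests of the arguments succeed without effect, and the negated body goals remain in textual
order. -/
theorem SimulatesCalls.dualRules {l : Lit R F} {lp : Propositional.Lit (Atom R F)}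
    (h : SimulatesCalls P U (lp :: stkp))
    (hs : List.Forall₂ (Corresponds P st.toStore) stk stkp) (hr : StateRel P D st chs)
    (hl : st.toStore.GroundLit l) (hlp : Corresponds P st.toStore l lp) {c : Clause R F}
    (hc : c.IsGround) (he : l.args.map st.walk = c.headArgs)
    (hU : ∀ s a, BodyGoal.lit s a ∈ c.body → (!s, .atom a) ∈ U) :
    Simulates (ClosedStep P D st stk.length l lp)
      (fun n => alts (c.dualRules.map (runRule P (n + 2) stk l st)))
      (fun n => alts ((c.body.map fun g => [g.toProp.neg.toInternal]).map fun body =>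
        (seq (propExec P (n + 2) (lp :: stkp)) body chs).map fun chs' => lp :: chs')) := by
  have hlen : l.args.length = c.headArgs.length := by simpa using congrArg List.length he
  simp only [hc.dualRules, List.map_append, alts_append,
    alts_differRules_of_eq P _ stk hr.good hr.pending hl hc.headArgs he, fail_orElse, List.map_map]
  refine Simulates.alts (List.forall₂_same.2 fun g hg => ?_)
  have hgv := hc.body g hg
  obtain ⟨s, hs₁, hs₂, key⟩ := exists_runRule_negRule P stk hr.good hl hc.headArgs hlen hgv
  have hk := hs₂.keeps hr.good.1
  simp only [if_pos he] at key
  have hstep := hr.step_setStore hs₂ hs₁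
  simp only [Function.comp_apply, key]
  have := h.body (stk := l :: stk) (st := st.setStore s) [g.neg]
    (.cons (hlp.keeps hk) (corresponds_keeps hs hk)) hstep.rel
    (by simpa [BodyGoal.vars_neg] using hgv)
    (fun s a e => by
      have e : BodyGoal.lit s a = g.neg := by simpa using e
      cases g with
      | lit s' a' =>
        simp only [BodyGoal.neg, BodyGoal.lit.injEq] at e
        obtain ⟨rfl, rfl⟩ := e
        exact hU s' a hg
      | test s' b => cases e)
  simp only [List.map_cons, List.map_nil, BodyGoal.toProp_neg] at this ⊢
  exact simulates_close ((this.mono fun _ _ => hstep.trans).add 2) (fun n => n + 2) _ l lp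

theorem rel_litOK (hs : List.Forall₂ (Corresponds P st.toStore) stk stkp)
    (hr : StateRel P D st chs) : ∀ d ∈ st.chs ++ stk, LitOK st.toStore d := by
  intro d hd
  rcases List.mem_append.1 hd with hd | hd
  · exact hr.ok d hd
  · obtain ⟨i, hi, rfl⟩ := List.getElem_of_mem hd
    exact ((List.forall₂_iff_get.1 hs).2 i hi (by rw [← hs.length_eq]; exact hi)).1

/-- The call of the dual of a clause for arguments different from those in its head. -/
theorem simulates_dual_of_ne (hs : List.Forall₂ (Corresponds P st.toStore) stk stkp)
    (hr : StateRel P D st chs) {l : Lit R F} {k : ℕ} (hk : l.sym = .dual k) (hn : l.naf = false)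
    (hl : st.toStore.GroundLit l) {c : Clause R F} (hPc : P[k]? = some c) (hc : c.IsGround)
    (hlen : l.args.length = c.headArgs.length) (hne : l.args.map st.walk ≠ c.headArgs) :
    Simulates (fun st' chs' => Step P D st st' chs') (fun n => exec P n stk (.lit l) st)
      (fun _ => Outcome.pure chs) := by
  have hok := rel_litOK hs hr
  have hgr : ∀ d ∈ st.chs ++ stk, l.Conflict d ∨ l.Same d → st.toStore.GroundLit d := by
    intro d hd h
    refine (hok d hd).ground fun j hj => ?_
    rcases h with ⟨-, ⟨-, h⟩ | ⟨-, -, _, _, h, -⟩⟩ | ⟨-, h, -⟩ <;> simp [hk, hj] at h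
  -- A conflict would require a negated dual, or a literal of the program in place of `l`.
  have hconf : ¬ ∃ d ∈ st.chs ++ stk, l.Conflict d ∧ l.args.map st.walk = d.args.map st.walk := by
    rintro ⟨d, hd, ⟨-, ⟨h, h'⟩ | ⟨-, -, _, _, h, -⟩⟩, -⟩
    · rw [hk] at h'
      rw [hn, (hok d hd).naf (by simp [← h'])] at h
      exact h rfl
    · simp [hk] at h
  have hlok : LitOK st.toStore l := ⟨fun _ => hl, fun _ => hn⟩
  have habs : absLit P st.toStore l = none := by
    simp [absLit, hk, hPc, hne]
  -- One unit of depth is spent on the call and two on the ground tests in its rules. The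
  -- propositional side makes no call.
  refine Simulates.of_succ_left (Simulates.of_succ_left (Simulates.of_succ_left ?_))
  by_cases hkn : ∃ d ∈ st.chs, l.Same d ∧ l.args.map st.walk = d.args.map st.walk
  · simp only [exec_lit_eq, call_of_known hl hgr hconf hkn]
    exact simulates_pure hr.step
  -- Every dual on the stack has a propositional counterpart, hence the arguments in the head of its
  -- clause, which those of `l` are not.
  · have hmem : ¬ ∃ d ∈ stk, l.Same d ∧ l.args.map st.walk = d.args.map st.walk := by
      rw [exists_iff_of_forall₂ hs (q := fun _ => False) fun d dp hd => ?_]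
      · simp
      · simp only [iff_false]
        rintro ⟨⟨-, h, -⟩, e⟩
        rcases hd.2 with h' | ⟨j, hj, -⟩
        · simp only [absLit, ← h, hk] at h'
          split_ifs at h' with h''
          obtain ⟨c', h₁, h₂⟩ := h''
          obtain rfl : c = c' := by simpa [hPc] using h₁
          exact hne (e.trans h₂)
        · simp [hk, hj] at h
    have hrules : rulesFor P l = c.dualRules := by simp [rulesFor, hk, hn, hPc]
    simp only [exec_lit_eq, call_of_not_known hl hgr hconf hkn, checkStack_of_not_mem hl
      (fun d hd h => hgr d (by simp [hd]) (Or.inr h)) hmem, hrules, hc.dualRules]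
    -- Only the rule for the first position `m` at which the arguments differ from the head
    -- succeeds. All rules before and after it fail, so there is exactly one answer.
    have hex : ∃ i : ℕ, (l.args.map st.walk)[i]? ≠ c.headArgs[i]? := by
      by_contra! h
      exact hne (List.ext_getElem? h)
    have hm := Nat.find_spec hex
    have hlt : ∀ j < Nat.find hex, (l.args.map st.walk)[j]? = c.headArgs[j]? := fun j hj => by
      by_contra h
      exact Nat.find_min hex hj h
    set m := Nat.find hex with hmdef
    have hml : m < c.headArgs.length := by
      by_contra! h
      exact hm (by rw [List.getElem?_eq_none h, List.getElem?_eq_none (by simpa [hlen] using h)])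
    obtain ⟨s, hs₁, hs₂, hs₃⟩ := exists_runRule_differRule P stk hr.good hr.pending hl hc.headArgs
      hlen (i := m) (t := c.headArgs[m]) (by simp)
    have hstep := hr.step_setStore hs₂ hs₁
    have hsplit : (c.headArgs.mapIdx fun i t => (differRule c.headArgs i t : Rule R F)) =
        (c.headArgs.mapIdx fun i t => differRule c.headArgs i t).take m ++
          differRule c.headArgs m c.headArgs[m] ::
          (c.headArgs.mapIdx fun i t => differRule c.headArgs i t).drop (m + 1) := by
      conv_lhs => rw [← List.take_append_drop m
        (c.headArgs.mapIdx fun i t => (differRule c.headArgs i t : Rule R F)),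
        List.drop_eq_getElem_cons (by simpa using hml)]
      simp
    have hfail : ∀ n i, i ≠ m → ∀ hi : i < c.headArgs.length,
        runRule P (n + 2) stk l st (differRule c.headArgs i c.headArgs[i]) = fail := by
      intro n i him hi
      obtain ⟨s', -, -, hs'⟩ := exists_runRule_differRule P stk hr.good hr.pending hl hc.headArgs
        hlen (i := i) (t := c.headArgs[i]) (by simp)
      rw [hs', if_neg]
      rintro ⟨h₁, h₂⟩
      rcases lt_or_gt_of_ne him with h | h
      · exact h₂ (hlt i h)
      · exact hm (h₁ m h)
    have hneg : ∀ n, alts ((c.body.map (negRule c.headArgs)).map (runRule P (n + 2) stk l st)) =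
        fail := by
      intro n
      refine alts_eq_fail fun o ho => ?_
      simp only [List.mem_map] at ho
      obtain ⟨r, ⟨g, hg, rfl⟩, rfl⟩ := ho
      obtain ⟨s', -, -, hs'⟩ := exists_runRule_negRule P stk hr.good hl hc.headArgs hlen
        (hc.body g hg)
      rw [hs', if_neg hne]
    have htake : ∀ n, alts (((c.headArgs.mapIdx fun i t => differRule c.headArgs i t).take m).map
        (runRule P (n + 2) stk l st)) = fail := by
      intro n
      refine alts_eq_fail fun o ho => ?_
      obtain ⟨r, hr, rfl⟩ := List.mem_map.1 ho
      obtain ⟨i, hi, rfl⟩ := List.mem_take_iff_getElem.1 hr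
      simp only [List.length_mapIdx, lt_min_iff] at hi
      simpa using hfail n i hi.1.ne hi.2
    have hdrop : ∀ n, alts (((c.headArgs.mapIdx fun i t => differRule c.headArgs i t).drop
        (m + 1)).map (runRule P (n + 2) stk l st)) = fail := by
      intro n
      refine alts_eq_fail fun o ho => ?_
      obtain ⟨r, hr, rfl⟩ := List.mem_map.1 ho
      obtain ⟨i, hi, rfl⟩ := List.mem_drop_iff_getElem.1 hr
      simp only [List.length_mapIdx] at hi
      simpa using hfail n (m + 1 + i) (by omega) (by omega)
    have heq : ∀ n, alts (((c.headArgs.mapIdx fun i t => differRule c.headArgs i t) ++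
        c.body.map (negRule c.headArgs)).map (runRule P (n + 2) stk l st)) =
        Outcome.pure ((st.setStore s).closed stk.length l) := by
      intro n
      rw [List.map_append, alts_append, hneg, orElse_fail, hsplit, List.map_append, alts_append,
        htake, fail_orElse, List.map_cons, alts_cons, hdrop, orElse_fail, hs₃ n,
        if_pos ⟨hlt, hm⟩]
    simp only [heq]
    have hkeep := hs₂.keeps hr.good.1
    refine simulates_pure ?_
    have := hstep.closed (hlok.keeps hkeep) (by simp [hk]) stk.length (lp := none)
      (by rw [← habs]; exact hlok.absLit_keeps hkeep P)
    simpa using this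

end Simulation

/-! ### Expansion of ground calls, and the induction on the call stack. -/

section Simulation

variable {R : Type v} {F : Type u}
variable {P : Program R F} {U : Finset (Propositional.Lit (Atom R F))}
  {stk : List (Lit R F)} {stkp : List (Propositional.Lit (Atom R F))} {D : Set ℕ}
  {st : State R F} {chs : List (Propositional.Lit (Atom R F))}

theorem filterMap_ite {α β : Type*} (p : α → Prop) [DecidablePred p] (f : α → β) (l : List α) :
    (l.filterMap fun a => if p a then some (f a) else none) =
      (l.filter fun a => p a).map f := by
  induction l with
  | nil => rfl
  | cons a l ih => by_cases h : p a <;> simp [h, ih]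

/-- The call of the dual of the `k`-th clause with `K` variables from `m` on as arguments. -/
def dualLit (R : Type v) (F : Type u) (m K k : ℕ) : Lit R F :=
  ⟨false, .dual k, (List.range' m K).map .var⟩

/-- Without body variables `quantified` introduces no for-all, and the body becomes a list of plain
calls of duals, all with the same arguments. -/
theorem shift_dualRule (hP : P.IsGround) (h : Bool) (r : R) (K m : ℕ) :
    ((dualRule P h r K).shift m).body =
      ((List.range P.length).filter fun k => ∃ c, P[k]? = some c ∧ c.Defines h r K).map
        fun k => .lit (dualLit R F m K k) := by
  rw [← filterMap_ite, dualRule, Rule.shift, List.map_filterMap]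
  refine List.filterMap_congr fun k _ => ?_
  cases hk : P[k]? with
  | none => simp
  | some c =>
    have hc : c.IsGround := hP c (List.mem_of_getElem? hk)
    by_cases hd : c.Defines h r K
    · have := map_walk_shift_range (F := F) K m
      simp [hd, quantified, hc.bodyVars, Goal.shift, Lit.subst, dualLit, ← this]
    · simp [hd]

/-- The first list runs over all clauses for the predicate, the second only over those with head
`a`. Calls that occur only in the first list have exactly one answer and leave the propositional CHS
as it is, so the two conjunctions stay in step. -/
theorem SimulatesCalls.duals (h : SimulatesCalls P U stkp) (hP : P.IsGround)
    (hU : CallClosed P U) (a : Atom R F) (m : ℕ) (L : List ℕ) (hL : ∀ k ∈ L, k < P.length)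
    (hs : List.Forall₂ (Corresponds P st.toStore) stk stkp) (hr : StateRel P D st chs)
    (hg : ∀ k, st.toStore.GroundLit (dualLit R F m a.args.length k))
    (hw : ((List.range' m a.args.length).map .var).map st.walk = a.args) :
    Simulates (fun st' chs' => Step P D st st' chs')
      (fun n => seq (exec P n stk) ((L.filter fun k =>
        ∃ c, P[k]? = some c ∧ c.Defines a.hyphen a.rel a.args.length).map
          fun k => .lit (dualLit R F m a.args.length k)) st)
      (fun n => seq (propExec P n stkp) ((L.filter fun k => ∃ c, P[k]? = some c ∧
        c.head = some a).map fun k => .lit false (.dual k)) chs) := by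
  induction L generalizing st chs with
  | nil => exact simulates_pure hr.step
  | cons k L ih =>
    have ih' : ∀ {st' : State R F} {chs'}, Step P D st st' chs' →
        Simulates (fun st'' chs'' => Step P D st st'' chs'')
          (fun n => seq (exec P n stk) ((L.filter fun k =>
            ∃ c, P[k]? = some c ∧ c.Defines a.hyphen a.rel a.args.length).map
              fun k => .lit (dualLit R F m a.args.length k)) st')
          (fun n => seq (propExec P n stkp) ((L.filter fun k => ∃ c, P[k]? = some c ∧
            c.head = some a).map fun k => .lit false (.dual k)) chs') := by
      intro st' chs' h'
      have hk := h'.ext.keeps hr.good.1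
      refine (ih (fun k hk => hL k (by simp [hk])) (h'.corresponds hr.good hs) h'.rel
        (fun k => hk.groundLit (hg k)) ?_).mono fun _ _ => h'.trans
      exact (hk.map_walk (hg 0)).trans hw
    obtain ⟨c, hPc⟩ : ∃ c, P[k]? = some c := ⟨_, List.getElem?_eq_getElem (hL k (by simp))⟩
    have hc : c.IsGround := hP c (List.mem_of_getElem? hPc)
    have hlok : LitOK st.toStore (dualLit R F m a.args.length k) := ⟨fun _ => hg k, fun _ => rfl⟩
    by_cases hd : c.Defines a.hyphen a.rel a.args.length
    · by_cases hh : c.head = some a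
      · rw [List.filter_cons_of_pos (by simp [hPc, hd]), List.filter_cons_of_pos (by simp [hPc, hh])]
        simp only [List.map_cons, seq_cons]
        have hha : c.headArgs = a.args := by simp [Clause.headArgs, hh]
        refine (h D stk st chs _ (false, .dual k) hs hr hlok ?_
          (hU.dual k (hL k (by simp)))).bind fun st' chs' h' => ih' h'
        have : (dualLit R F m a.args.length k).args.map st.walk = c.headArgs := by
          rw [hha]; exact hw
        exact if_pos ⟨c, hPc, this⟩
      -- Same predicate but another head: the call occurs on one side only, and the other side is
      -- regarded as `pure chs` followed by the remaining calls.
      · rw [List.filter_cons_of_pos (by simp [hPc, hd]), List.filter_cons_of_neg (by simp [hPc, hh])]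
        simp only [List.map_cons, seq_cons]
        obtain ⟨a', h₁, h₂, h₃, h₄⟩ := hd
        have hha : c.headArgs = a'.args := by simp [Clause.headArgs, h₁]
        have := (simulates_dual_of_ne hs hr (k := k) rfl rfl (hg k) hPc hc
          (by simp [dualLit, hha, h₄]) (by
            rw [show (dualLit R F m a.args.length k).args.map st.walk = a.args from hw, hha]
            intro e
            apply hh
            rw [h₁]
            cases a; cases a'
            simp_all)).bind (g' := fun n chs' => seq (propExec P n stkp)
              ((L.filter fun k => ∃ c, P[k]? = some c ∧
                c.head = some a).map fun k => .lit false (.dual k)) chs')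
              fun st' chs' h' => ih' h'
        simpa only [Outcome.pure_bind] using this
    · have hh : c.head ≠ some a := fun hh => hd ⟨a, hh, rfl, rfl, rfl⟩
      rw [List.filter_cons_of_neg (by simp [hPc, hd]), List.filter_cons_of_neg (by simp [hPc, hh])]
      exact ih' hr.step

/-- Head and call are both ground, so unification is all or nothing. Upon success only the counter
for fresh variables has moved. -/
theorem runRule_clause (P : Program R F) (n : ℕ) (stk : List (Lit R F)) {l : Lit R F}
    (hl : st.toStore.GroundLit l) {c : Clause R F} (hc : c.IsGround) :
    runRule P (n + 1) stk l st ⟨c.headArgs, c.body.map BodyGoal.toGoal⟩ =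
      if l.args.map st.walk = c.headArgs then
        (seq (exec P (n + 1) (l :: stk)) (c.body.map BodyGoal.toGoal)
          (st.setStore { st.toStore with next := st.next +
            (⟨c.headArgs, c.body.map BodyGoal.toGoal⟩ : Rule R F).bound })).bind
          (close (n + 1) stk.length l)
      else fail := by
  have hp : ∀ (f : Term F → Term F), (∀ t, t.IsGround → f t = t) →
      c.headArgs.map f = c.headArgs := by
    intro f hf
    conv_rhs => rw [← List.map_id c.headArgs]
    exact List.map_congr_left fun t ht => hf t (hc.headArgs t ht)
  rw [runRule]
  simp only [Rule.shift]
  rw [hp _ fun t ht => ht.subst _, Store.unifyArgs_ground]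
  · have : (c.body.map BodyGoal.toGoal).map (Goal.shift st.next) =
        c.body.map BodyGoal.toGoal := by
      rw [List.map_map]
      exact List.map_congr_left fun g hg => BodyGoal.shift_toGoal (hc.body g hg) _
    rw [this, hp _ fun t ht => Store.walk_ground ht _]
    change (Outcome.bind (if l.args.map st.walk = c.headArgs then _ else _) _) = _
    split_ifs
    · rw [Outcome.pure_bind]
    · rw [fail_bind]
  · exact hl
  · intro t ht
    rw [Store.walk_ground (hc.headArgs t ht)]
    exact hc.headArgs t ht

theorem closedStep_imp {l : Lit R F} {lp : Propositional.Lit (Atom R F)}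
    (hr : StateRel P D st chs)
    (hl : LitOK st.toStore l) (ha : absLit P st.toStore l = some lp) {d : ℕ} {st' : State R F}
    {chs' : List (Propositional.Lit (Atom R F))} (h : ClosedStep P D st d l lp st' chs') :
    Step P D st st' chs' := by
  obtain ⟨st₁, chs₁, h, rfl, rfl⟩ := h
  have hk := h.ext.keeps hr.good.1
  exact h.closed (hl.keeps hk) (fun k => (sym_ne_chk_of_absLit ha k).1) d
    (lp := some lp) (by rw [hl.absLit_keeps hk, ha])

theorem getElem?_map_toProp (P : Program R F) (k : ℕ) (p : Propositional.Clause (Atom R F) → Prop) :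
    (∃ c, (P.map Clause.toProp)[k]? = some c ∧ p c) ↔ ∃ c, P[k]? = some c ∧ p c.toProp := by
  simp only [List.getElem?_map, Option.map_eq_some_iff]
  aesop

/-- The expansions of a call by the rules for it. -/
theorem SimulatesCalls.expand {l : Lit R F} {lp : Propositional.Lit (Atom R F)}
    (h : SimulatesCalls P U (lp :: stkp)) (hP : P.IsGround) (hU : CallClosed P U)
    (hs : List.Forall₂ (Corresponds P st.toStore) stk stkp) (hr : StateRel P D st chs)
    (hl : LitOK st.toStore l) (ha : absLit P st.toStore l = some lp) :
    Simulates (fun st' chs' => Step P D st st' chs')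
      (fun n => alts ((rulesFor P l).map (runRule P (n + 2) stk l st)))
      (fun n => alts ((Propositional.bodies (P.map Clause.toProp) lp).map fun body =>
        (seq (propExec P (n + 2) (lp :: stkp)) body chs).map fun chs' => lp :: chs')) := by
  have hlg : st.toStore.GroundLit l := hl.ground fun k => (sym_ne_chk_of_absLit ha k).1
  have hcor : Corresponds P st.toStore l lp := ⟨hl, Or.inl ha⟩
  suffices Simulates (ClosedStep P D st stk.length l lp)
      (fun n => alts ((rulesFor P l).map (runRule P (n + 2) stk l st)))
      (fun n => alts ((Propositional.bodies (P.map Clause.toProp) lp).map fun body =>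
        (seq (propExec P (n + 2) (lp :: stkp)) body chs).map fun chs' => lp :: chs')) from
    this.mono fun _ _ h' => closedStep_imp hr hl ha h'
  have ha' := ha
  obtain ⟨naf, sym, args⟩ := l
  unfold absLit at ha'
  cases sym with
  | chk k => simp at ha'
  | dual k =>
    simp only at ha'
    split_ifs at ha' with hc
    obtain ⟨c, hPc, he⟩ := hc
    obtain rfl : naf = false := hl.naf (by simp)
    simp only [Option.some.injEq] at ha'
    subst ha'
    have hc : c.IsGround := hP c (List.mem_of_getElem? hPc)
    have := h.dualRules hs hr hlg hcor hc he
      fun s a hg => hU.body c (List.mem_of_getElem? hPc) s a hg _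
    simpa [rulesFor, hPc, Propositional.bodies, Clause.toProp, Function.comp_def] using this
  | user g r =>
    simp only [Option.some.injEq] at ha'
    subst ha'
    cases naf with
    | false =>
      -- `rulesFor` selects clauses by their predicate, `bodies` by equality of the head. The
      -- surplus clauses fail when their head is unified with the call.
      have e₁ : ∀ n, alts ((rulesFor P ⟨false, .user g r, args⟩).map
          (runRule P (n + 2) stk ⟨false, .user g r, args⟩ st)) =
          alts ((P.filter fun c => c.head = some ⟨g, r, args.map st.walk⟩).map fun c =>
            runRule P (n + 2) stk ⟨false, .user g r, args⟩ st
              ⟨c.headArgs, c.body.map BodyGoal.toGoal⟩) := by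
        intro n
        simp only [rulesFor, List.map_map, Function.comp_def]
        refine alts_filter_map _ _ _ _ ?_ ?_
        · intro c _ hh
          exact ⟨_, hh, rfl, rfl, by simp⟩
        · rintro c hcP ⟨a, h₁, h₂, h₃, h₄⟩ hh
          rw [runRule_clause P _ stk hlg (hP c hcP), if_neg]
          intro e
          have hha : c.headArgs = a.args := by simp [Clause.headArgs, h₁]
          apply hh
          rw [h₁]
          simp only [hha] at e
          cases a
          simp_all
      have e₂ : Propositional.bodies (P.map Clause.toProp)
          (false, .atom ⟨g, r, args.map st.walk⟩) =
          (P.filter fun c => c.head = some ⟨g, r, args.map st.walk⟩).map fun c =>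
            c.body.map fun g => g.toProp.toInternal := by
        simp only [Propositional.bodies, List.filter_map, List.map_map, Clause.toProp,
          Function.comp_def]
        congr!
      simp only [e₁, e₂, List.map_map, Function.comp_def]
      refine Simulates.alts (List.forall₂_same.2 fun c hcm => ?_)
      simp only [List.mem_filter, decide_eq_true_eq] at hcm
      have hc := hP c hcm.1
      have he : args.map st.walk = c.headArgs := by simp [Clause.headArgs, hcm.2]
      simp only [runRule_clause P _ stk hlg hc, if_pos he]
      have hext := Store.extends_with_next st.toStore (m := st.next +
        (⟨c.headArgs, c.body.map BodyGoal.toGoal⟩ : Rule R F).bound) (Nat.le_add_right _ _)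
      have hk := hext.keeps hr.good.1
      have hstep := hr.step_setStore hext (hr.good.with_next (Nat.le_add_right _ _))
      exact simulates_close (((h.body c.body (.cons (hcor.keeps hk) (corresponds_keeps hs hk))
        hstep.rel hc.body fun s a hg => hU.body c hcm.1 s a hg s).mono
          fun _ _ => hstep.trans).add 2) (fun n => n + 2) _ _ _
    | true =>
      obtain ⟨s, hs₁, hs₂, hs₃, hs₄, hs₅⟩ := exists_runRule_ground P stk hr.good hlg
        (r := dualRule P g r args.length) rfl
      have e₁ : ∀ n, alts ((rulesFor P ⟨true, .user g r, args⟩).map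
          (runRule P (n + 2) stk ⟨true, .user g r, args⟩ st)) =
          runRule P (n + 2) stk ⟨true, .user g r, args⟩ st (dualRule P g r args.length) :=
        fun n => orElse_fail _
      have e₂ : ∀ n, alts ((Propositional.bodies (P.map Clause.toProp)
          (true, .atom ⟨g, r, args.map st.walk⟩)).map fun body =>
            (seq (propExec P (n + 2) ((true, .atom ⟨g, r, args.map st.walk⟩) :: stkp))
              body chs).map fun chs' => (true, .atom ⟨g, r, args.map st.walk⟩) :: chs') =
          (seq (propExec P (n + 2) ((true, .atom ⟨g, r, args.map st.walk⟩) :: stkp))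
            (((List.range P.length).filter fun k => ∃ c, P[k]? = some c ∧
              c.head = some ⟨g, r, args.map st.walk⟩).map fun k => .lit false (.dual k)) chs).map
            fun chs' => (true, .atom ⟨g, r, args.map st.walk⟩) :: chs' := by
        intro n
        simp only [Propositional.bodies, List.map_cons, List.map_nil, alts_cons, alts_nil,
          orElse_fail, List.length_map, getElem?_map_toProp P _ fun c =>
            c.head = some ⟨g, r, args.map st.walk⟩, Clause.toProp]
      simp only [e₁, e₂, hs₅, shift_dualRule hP]
      have hk := hs₂.keeps hr.good.1
      have hstep := hr.step_setStore hs₂ hs₁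
      have hwalk : ∀ i a, args[i]? = some a → s.sub (st.next + i) = st.walk a := hs₄
      have hw : ((List.range' st.next args.length).map .var).map (st.setStore s).walk =
          args.map st.walk := by
        refine List.ext_getElem (by simp) fun i h₁ h₂ => ?_
        simp only [List.getElem_map, List.getElem_range', one_mul]
        exact hwalk i _ (by simp)
      have hlen : (args.map st.walk).length = args.length := by simp
      have := h.duals (stk := ⟨true, .user g r, args⟩ :: stk) (st := st.setStore s) hP hU
        ⟨g, r, args.map st.walk⟩ st.next (List.range P.length) (by simp)
        (.cons (hcor.keeps hk) (corresponds_keeps hs hk)) hstep.rel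
        (fun k a ha => by
          simp only [dualLit, hlen] at ha
          have hm := List.mem_map_of_mem (f := (st.setStore s).walk) ha
          rw [hw] at hm
          obtain ⟨b, hb, e⟩ := List.mem_map.1 hm
          change ((st.setStore s).walk a).IsGround
          rw [← e]
          exact hlg b hb)
        (by simpa only [hlen] using hw)
      simp only [hlen] at this
      exact simulates_close ((this.mono fun _ _ => hstep.trans).add 2) (fun n => n + 2) _ _ _

/-- Both methods execute ground calls in the same way. -/
theorem simulatesCalls (hP : P.IsGround) (hU : CallClosed P U)
    (stkp : List (Propositional.Lit (Atom R F))) : SimulatesCalls P U stkp := by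
  -- The measure is the number of callable literals that are not yet on the stack.
  induction hN : (U.filter fun l => l ∉ stkp).card using Nat.strong_induction_on
    generalizing stkp with
  | _ N ih =>
  intro D stk st chs l lp hs hr hl ha hlU
  have hchk := sym_ne_chk_of_absLit ha
  have hlg : st.toStore.GroundLit l := hl.ground fun k => (hchk k).1
  have hcor : Corresponds P st.toStore l lp := ⟨hl, Or.inl ha⟩
  have hok := rel_litOK hs hr
  have hgr : ∀ d ∈ st.chs ++ stk, l.Conflict d ∨ l.Same d → st.toStore.GroundLit d := by
    intro d hd h
    refine (hok d hd).ground fun j hj => ?_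
    have := (hchk j).1
    rcases h with ⟨-, ⟨-, h⟩ | ⟨-, -, _, _, -, h⟩⟩ | ⟨-, h, -⟩ <;> simp_all
  have hgr' : ∀ d ∈ stk, l.Same d → st.toStore.GroundLit d := fun d hd h =>
    hgr d (by simp [hd]) (Or.inr h)
  have hneg := forall₂_negCounts (fun a b h => Corresponds.sign_eq h) l.sign 0 hs
  have hconf : (∃ d ∈ st.chs ++ stk, l.Conflict d ∧ l.args.map st.walk = d.args.map st.walk) ↔
      ∃ dp ∈ chs ++ stkp, Propositional.Conflict Atom.Complementary lp dp := by
    have h₁ := exists_iff_of_forall₂ hs fun d dp hd => hd.conflict_iff hl ha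
    have h₂ : (∃ d ∈ st.chs, l.Conflict d ∧ l.args.map st.walk = d.args.map st.walk) ↔
        ∃ dp ∈ chs, Propositional.Conflict Atom.Complementary lp dp := by
      constructor
      · rintro ⟨d, hd, h⟩
        obtain ⟨dp, h, h'⟩ := (conflict_iff_absLit hl (hr.ok d hd) ha).1 h
        exact ⟨dp, (hr.mem_iff fun k => (sym_ne_chk_of_absLit h k).2).2 ⟨d, hd, h⟩, h'⟩
      · rintro ⟨dp, hdp, h⟩
        have hk : ∀ k, dp.2 ≠ .chk k := by
          intro k hk
          rcases h with ⟨-, h⟩ | ⟨-, -, _, _, -, -, h⟩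
          · exact (hchk k).2 (h.trans hk)
          · rw [hk] at h; cases h
        obtain ⟨d, hd, h'⟩ := (hr.mem_iff hk).1 hdp
        exact ⟨d, hd, (conflict_iff_absLit hl (hr.ok d hd) ha).2 ⟨dp, h', h⟩⟩
    simp only [List.mem_append, or_and_right, exists_or, h₁, h₂]
  -- The CHS of the predicate method also contains entries without an image; these are not instances
  -- of `l`, since `l` has one.
  have hknown : (∃ d ∈ st.chs, l.Same d ∧ l.args.map st.walk = d.args.map st.walk) ↔
      lp ∈ chs := by
    rw [hr.mem_iff fun k => (hchk k).2]
    exact exists_congr fun d => and_congr_right fun hd => same_iff_absLit hl (hr.ok d hd) ha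
  have hmem : (∃ d ∈ stk, l.Same d ∧ l.args.map st.walk = d.args.map st.walk) ↔
      lp ∈ stkp := by
    rw [exists_iff_of_forall₂ hs fun d dp hd => hd.same_iff hl ha]
    simp
  have hpos : (∃ e ∈ negCounts Lit.sign l.sign 0 stk, l.Same e.2.2 ∧
      l.args.map st.walk = e.2.2.args.map st.walk ∧ e.2.1 = 0) ↔
      ∃ e ∈ negCounts Propositional.sign (Propositional.sign lp) 0 stkp,
        e.2.2 = lp ∧ e.2.1 = 0 := by
    rw [← hcor.sign_eq]
    refine exists_iff_of_forall₂ hneg fun e e' he => ?_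
    rw [← and_assoc, he.2.same_iff hl ha, he.1]
  have heven : (∃ e ∈ negCounts Lit.sign l.sign 0 stk, l.Same e.2.2 ∧
      l.args.map st.walk = e.2.2.args.map st.walk ∧ e.2.1 ≠ 0 ∧ Even e.2.1) ↔
      ∃ e ∈ negCounts Propositional.sign (Propositional.sign lp) 0 stkp,
        e.2.2 = lp ∧ e.2.1 ≠ 0 ∧ Even e.2.1 := by
    rw [← hcor.sign_eq]
    refine exists_iff_of_forall₂ hneg fun e e' he => ?_
    rw [← and_assoc, he.2.same_iff hl ha, he.1]
  -- One unit unfolds the call; two more allow for the tests in the rules.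
  refine Simulates.of_succ (Simulates.of_succ (Simulates.of_succ ?_))
  simp only [propExec, Propositional.exec, exec_lit_eq, Prod.mk.eta]
  by_cases h₁ : ∃ d ∈ st.chs ++ stk, l.Conflict d ∧ l.args.map st.walk = d.args.map st.walk
  · simp only [call_of_conflict hlg (fun d hd h => hgr d hd (Or.inl h)) h₁, if_pos (hconf.1 h₁)]
    exact simulates_fail _
  simp only [if_neg (mt hconf.2 h₁)]
  by_cases h₂ : ∃ d ∈ st.chs, l.Same d ∧ l.args.map st.walk = d.args.map st.walk
  · simp only [call_of_known hlg hgr h₁ h₂, if_pos (hknown.1 h₂)]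
    exact simulates_pure hr.step
  simp only [if_neg (mt hknown.2 h₂), call_of_not_known hlg hgr h₁ h₂]
  by_cases h₃ : ∃ e ∈ negCounts Lit.sign l.sign 0 stk, l.Same e.2.2 ∧
      l.args.map st.walk = e.2.2.args.map st.walk ∧ e.2.1 = 0
  · simp only [checkStack_of_positive hlg hgr' h₃, if_pos (hpos.1 h₃)]
    exact simulates_fail _
  simp only [if_neg (mt hpos.2 h₃)]
  by_cases h₄ : ∃ e ∈ negCounts Lit.sign l.sign 0 stk, l.Same e.2.2 ∧
      l.args.map st.walk = e.2.2.args.map st.walk ∧ e.2.1 ≠ 0 ∧ Even e.2.1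
  · simp only [if_pos (heven.1 h₄)]
    obtain ⟨d, hd⟩ := checkStack_of_even hlg hgr' h₃ h₄
    simp only [hd]
    -- Only the pending list changes, and the call recorded there is ground.
    refine simulates_pure ⟨⟨hr.good, ?_, hr.ok, hr.abs, hr.dom⟩, .refl _, fun _ hd _ => hd⟩
    intro p hp
    rcases List.mem_cons.1 hp with rfl | hp
    exacts [hlg, hr.pending p hp]
  simp only [if_neg (mt heven.2 h₄)]
  -- A recurrence would have an even number of negations, and both zero and nonzero even numbers
  -- have been excluded. So the new call strictly decreases the measure.
  have h₅ : lp ∉ stkp := by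
    intro h
    obtain ⟨e, he, rfl⟩ := exists_mem_negCounts Propositional.sign (Propositional.sign lp) 0 h
    have hev := (even_of_mem_negCounts he).2 (by simp)
    by_cases h0 : e.2.1 = 0
    · exact h₃ (hpos.2 ⟨e, he, rfl, h0⟩)
    · exact h₄ (heven.2 ⟨e, he, rfl, h0, hev⟩)
  simp only [checkStack_of_not_mem hlg hgr' (mt hmem.1 h₅)]
  refine SimulatesCalls.expand (ih _ ?_ _ rfl) hP hU hs hr hl ha
  rw [← hN]
  refine Finset.card_lt_card (Finset.ssubset_iff_subset_ne.2 ⟨fun x hx => ?_, fun e => ?_⟩)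
  · simp only [Finset.mem_filter, List.mem_cons, not_or] at hx ⊢
    exact ⟨hx.1, hx.2.2⟩
  · have : lp ∈ U.filter fun l => l ∉ stkp := by simp [hlU, h₅]
    rw [← e] at this
    simp at this

end Simulation

/-! ### Variables with at most one prohibited value -/

section Forbidden

variable {R : Type v} {F : Type u}

namespace Store

/-- The value of the term is an unconstrained variable. -/
def Free (st : Store F) (a : Term F) : Prop :=
  ∃ y < st.next, st.walk a = .var y ∧ st.sub y = .var y ∧ st.proh y = []

/-- The value of the term is a variable below `m`, whose only prohibited value is `t`. -/
def ForbidsBelow (m : ℕ) (st : Store F) (a t : Term F) : Prop :=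
  ∃ y < m, st.walk a = .var y ∧ st.sub y = .var y ∧ st.proh y = [t]

/-- The value of the term is a variable, whose only prohibited value is `t`. -/
def Forbids (st : Store F) (a t : Term F) : Prop := ForbidsBelow st.next st a t

/-- Ground values and the variables with one prohibited value are kept. -/
def Refines (st st' : Store F) : Prop :=
  st.Keeps st' ∧ ∀ a t, st.Forbids a t → st'.Forbids a t

theorem Refines.trans {a b c : Store F} (h : a.Refines b) (h' : b.Refines c) : a.Refines c :=
  ⟨h.1.trans h'.1, fun _ _ hf => h'.2 _ _ (h.2 _ _ hf)⟩

theorem Good.lt_of_sub {st : Store F} (h : st.Good) {x y : ℕ} (hx : st.sub x = .var y)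
    (hy : y < st.next) : x < st.next := by
  by_contra! h'
  rw [(h.1.1 x h').1] at hx
  obtain rfl : x = y := by simpa using hx
  omega

theorem Extends.refines {st st' : Store F} (h : st.Extends st') (hg : st.Good) :
    st.Refines st' := by
  refine ⟨h.keeps hg.1, ?_⟩
  rintro a t ⟨y, hy, hw, hs, hp⟩
  obtain ⟨x, rfl, hx⟩ := walk_eq_var hw
  have hx' := hg.lt_of_sub hx hy
  exact ⟨y, hy.trans_le h.1, by rw [walk_var, (h.2 x hx').1, hx], by rw [(h.2 y hy).1, hs],
    by rw [(h.2 y hy).2, hp]⟩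

end Store

/-- The arguments `e` of an earlier call cannot match `as`: all arguments up to some position are equal
to those in `ts`, where `e` has a variable with this prohibited value. -/
def Blocked (st : Store F) (as ts e : List (Term F)) : Prop :=
  ∃ (i : ℕ) (t : Term F), ts[i]? = some t ∧ (∀ j ≤ i, (as.map st.walk)[j]? = ts[j]?) ∧
    (∀ j < i, (e.map st.walk)[j]? = ts[j]?) ∧ ∃ b, e[i]? = some b ∧ st.Forbids b t

theorem getElem?_map_walk_of_keeps {st st' : Store F} (h : st.Keeps st') {as ts : List (Term F)}
    (hts : ∀ t ∈ ts, t.IsGround) {j : ℕ} (hj : j < ts.length)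
    (ha : (as.map st.walk)[j]? = ts[j]?) : (as.map st'.walk)[j]? = ts[j]? := by
  rw [List.getElem?_eq_getElem hj, List.getElem?_map, Option.map_eq_some_iff] at ha
  obtain ⟨a, h₁, h₂⟩ := ha
  rw [List.getElem?_eq_getElem hj, List.getElem?_map, h₁, Option.map_some, h.walk, h₂]
  rw [h₂]
  exact hts _ (List.getElem_mem hj)

theorem Blocked.refines {st st' : Store F} {as ts e : List (Term F)} (h : Blocked st as ts e)
    (hts : ∀ t ∈ ts, t.IsGround) (hr : st.Refines st') : Blocked st' as ts e := by
  obtain ⟨i, t, hi, h₁, h₂, b, hb, hf⟩ := h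
  have hlt := (List.getElem?_eq_some_iff.1 hi).1
  exact ⟨i, t, hi,
    fun j hj => getElem?_map_walk_of_keeps hr.1 hts (hj.trans_lt hlt) (h₁ j hj),
    fun j hj => getElem?_map_walk_of_keeps hr.1 hts (hj.trans hlt) (h₂ j hj), b, hb, hr.2 _ _ hf⟩

/-- The arguments before position `i` are equal. At `i` the ground term `t` meets a variable for
which `t` is prohibited, and `bindValue` fails. -/
theorem seq_unify_blocked (n : ℕ) {st : Store F} {as ts e : List (Term F)}
    (hts : ∀ t ∈ ts, t.IsGround) (h : Blocked st as ts e) :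
    seq (fun p st' => unify (n + 2) st' p.1 p.2) (as.zip e) st = fail := by
  obtain ⟨i, t, hi, h₁, h₂, b, hb, y, -, hw, hs, hp⟩ := h
  induction i generalizing as ts e with
  | zero =>
    cases ts with
    | nil => simp at hi
    | cons t' ts =>
    cases as with
    | nil => simpa using h₁ 0 le_rfl
    | cons a as =>
    cases e with
    | nil => simp at hb
    | cons b' e =>
      obtain rfl : t' = t := by simpa using hi
      obtain rfl : b' = b := by simpa using hb
      have ha : st.walk a = t' := by simpa using h₁ 0 le_rfl
      have ht := hts t' (by simp)
      have hwt := Store.walk_ground ht st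
      rw [List.zip_cons_cons, seq_cons,
        Store.unify_var_right (n + 1) (by rw [ha]; exact ht) hw, Store.bindValue,
        if_neg (by rw [ha]; simp [show t'.vars = [] from ht]), hp, List.map_singleton, alts_cons,
        alts_nil, orElse_fail, ha, Store.unify_ground n (by rwa [hwt]) (by rwa [hwt]), if_pos rfl]
      exact fail_bind _
  | succ i ih =>
    cases ts with
    | nil => simp at hi
    | cons t' ts =>
    cases as with
    | nil => simpa using h₁ 0 (Nat.zero_le _)
    | cons a as =>
    cases e with
    | nil => simp at hb
    | cons b' e =>
      have ha : st.walk a = t' := by simpa using h₁ 0 (Nat.zero_le _)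
      have hb' : st.walk b' = t' := by simpa using h₂ 0 (Nat.succ_pos _)
      have ht := hts t' (by simp)
      rw [List.zip_cons_cons, seq_cons, Store.unify_ground (n + 1) (by rwa [ha]) (by rwa [hb']),
        if_pos (by rw [ha, hb']), Outcome.pure_bind]
      exact ih (fun t h => hts t (List.mem_cons_of_mem _ h)) (by simpa using hi)
        (fun j hj => by simpa using h₁ (j + 1) (by omega))
        (fun j hj => by simpa using h₂ (j + 1) (by omega)) (by simpa using hb)

theorem exactMatch_blocked (n : ℕ) {st : Store F} {as ts e : List (Term F)}
    (hts : ∀ t ∈ ts, t.IsGround) (h : Blocked st as ts e) :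
    exactMatch (n + 2) st as e = fail := by
  rw [exactMatch, unifyArgs]
  split_ifs
  · rw [seq_unify_blocked n hts h]
    rfl
  · rfl

/-- The call of a sub-check that is not in the coinductive hypothesis set is expanded. -/
theorem call_chk (n : ℕ) {k : ℕ} {as ts : List (Term F)} (hts : ∀ t ∈ ts, t.IsGround)
    {st : State R F} (hok : ∀ d ∈ st.chs, LitOK st.toStore d)
    (hb : ∀ e ∈ st.chs, e.sym = .chk k → Blocked st.toStore as ts e.args)
    (expand : State R F → Outcome (State R F)) :
    call (n + 2) [] ⟨false, .chk k, as⟩ st expand = expand st := by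
  -- Sub-checks are never called under negation, so no entry can conflict with one.
  have hc : conflicts ⟨false, .chk k, as⟩ (st.chs ++ []) = [] := by
    rw [conflicts, List.filter_eq_nil_iff]
    intro d hd
    simp only [List.append_nil] at hd
    simp only [Lit.Conflict, decide_eq_true_eq, not_and, not_or]
    refine fun _ => ⟨fun hn hs => hn (((hok d hd).naf ?_).symm), ?_⟩
    · simp [← hs]
    · rintro - - ⟨_, _, h, -⟩
      cases h
  rw [call, hc, List.map_nil, alts_nil, ifAny_alts_of_not_exists fun d hd => ?_]
  · change Outcome.bind (Outcome.pure st.toStore) _ = _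
    rw [Outcome.pure_bind]
    simp [checkStack, negCounts, alts_nil, fail, halt, ifAny, orElse]
    rfl
  · simp only [List.mem_filter, decide_eq_true_eq] at hd
    exact exactMatch_blocked n hts (hb d hd.1 hd.2.2.1.symm)

/-! ### Expansion of a sub-check for arguments that are not ground -/

/-- Each argument has the prescribed value, or is an unconstrained variable of its own. -/
structure ArgsOK (st : Store F) (as ts : List (Term F)) : Prop where
  ok : ∀ (i : ℕ) (a t : Term F), as[i]? = some a → ts[i]? = some t → st.walk a = t ∨ st.Free a
  distinct : as.Pairwise fun a b => ∀ y, st.walk a = .var y → st.walk b ≠ .var y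

/-- The variables from `m` on stand for the arguments, which have the prescribed values or are
unconstrained. -/
def Entered (st : Store F) (as ts : List (Term F)) (m : ℕ) : Prop :=
  ∀ (i : ℕ) (a t : Term F), as[i]? = some a → ts[i]? = some t → st.walk a = st.sub (m + i) ∧
    (st.sub (m + i) = t ∨ st.sub (m + i) = .var (m + i) ∧ st.proh (m + i) = [])

/-- The case distinction is that of `ArgsOK`: arguments with their prescribed value pass it on to
the new variable, the free ones are merged with it. Variables with a prohibited value remain below
`st.next`, which separates them from the parameters that the tests will bind. -/
theorem exists_unifyArgs_fresh {st : Store F} (hst : st.Good) {as ts : List (Term F)}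
    (hts : ∀ t ∈ ts, t.IsGround) (hlen : as.length = ts.length) (h : ArgsOK st as ts) {B : ℕ}
    (hB : as.length ≤ B) :
    ∃ s : Store F,
      (∀ n, unifyArgs (n + 1) { st with next := st.next + B } as
        ((List.range' st.next as.length).map .var) = Outcome.pure s) ∧
      s.Good ∧ st.Keeps s ∧ (∀ a t, st.Forbids a t → Store.ForbidsBelow st.next s a t) ∧
      st.next + as.length ≤ s.next ∧ Entered s as ts st.next ∧
      ∀ (i : ℕ) (a : Term F), as[i]? = some a → st.Free a → s.sub (st.next + i) = .var (st.next + i) := by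
  have key : ∀ a ∈ as, (st.walk a).IsGround ∨ st.Free a := by
    intro a ha
    obtain ⟨i, hi, rfl⟩ := List.getElem_of_mem ha
    refine (h.ok i _ ts[i] (by simp) (by simp)).imp_left fun e => ?_
    rw [e]
    exact hts _ (by simp)
  obtain ⟨s, hs, hs₁, hs₂, hs₃, hs₄, hs₅, hs₆, -⟩ :=
    Store.exists_seq_unify_fresh as st.next { st with next := st.next + B } hst.1 key h.distinct
  have hle : st.next + as.length ≤ s.next := by rw [hs₂]; exact Nat.add_le_add_left hB _
  refine ⟨s, fun n => ?_, ⟨hs₁.mono hle, by rw [hs₃]; exact hst.2⟩,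
    ⟨by omega, hs₄⟩, ?_, hle, ?_, ?_⟩
  · rw [unifyArgs, if_pos (by simp), hs]
  · rintro b t ⟨y, hy, hw, hyy, hp⟩
    -- A variable with a prohibited value is neither ground nor free, hence not the value of an
    -- argument.
    have hne : ∀ a ∈ as, st.walk a ≠ .var y := by
      intro a ha e
      rcases key a ha with h' | ⟨z, -, h₁, -, h₂⟩
      · rw [e] at h'
        exact Term.not_isGround_var y h'
      · rw [e] at h₁
        obtain rfl : y = z := by simpa using h₁
        rw [hp] at h₂
        simp at h₂
    obtain ⟨h₁, h₂⟩ := hs₅ y hy hne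
    obtain ⟨x, rfl, hx⟩ := Store.walk_eq_var hw
    exact ⟨y, hy, h₂ x hx, h₂ y hyy, by rw [h₁]; exact hp⟩
  · intro i a t ha ht
    obtain ⟨h₁, h₂⟩ := hs₆ i a ha
    refine ⟨h₁, h₂.imp (fun h₂ => ?_) fun h₂ => h₂.2⟩
    rcases h.ok i a t ha ht with e | ⟨y, -, e, -⟩
    · rw [h₂.2]; exact e
    · have := h₂.1
      rw [show ({ st with next := st.next + B } : Store F).walk a = .var y from e] at this
      exact absurd this (Term.not_isGround_var y)
  · rintro i a ha ⟨y, -, hw, -⟩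
    rcases (hs₆ i a ha).2 with h₂ | h₂
    · have := h₂.1
      rw [show ({ st with next := st.next + B } : Store F).walk a = .var y from hw] at this
      exact absurd this (Term.not_isGround_var y)
    · exact h₂.2.1

/-- Tests of equality for variables that have the prescribed values or are unconstrained. -/
theorem exists_seq_argTests (P : Program R F) (stk : List (Lit R F)) {st : State R F}
    (hst : st.toStore.Good) {as ts : List (Term F)} (hts : ∀ t ∈ ts, t.IsGround)
    (hlen : as.length = ts.length) {m : ℕ} (h : Entered st.toStore as ts m)
    (hm : m + ts.length ≤ st.next) (i : ℕ) (hi : i ≤ ts.length) :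
    ∃ s : Store F,
      (∀ n, seq (exec P (n + 2) stk) (testGoals ((argTests m ts).take i)) st =
        Outcome.pure (st.setStore s)) ∧
      s.Good ∧ s.next = st.next ∧ st.toStore.Keeps s ∧ Entered s as ts m ∧
      (∀ a t, Store.ForbidsBelow m st.toStore a t → Store.ForbidsBelow m s a t) ∧
      (∀ j < i, ∀ t : Term F, ts[j]? = some t → s.sub (m + j) = t) ∧
      ∀ j ≥ i, j < ts.length → s.sub (m + j) = st.sub (m + j) := by
  induction i with
  | zero =>
    exact ⟨st.toStore, fun n => rfl, hst, rfl, .refl _, h, fun _ _ h => h, by simp,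
      fun _ _ _ => rfl⟩
  | succ i ih =>
    obtain ⟨s, hs, hg, hn, hk, he, hf, hb, hu⟩ := ih (by omega)
    have hlt : i < ts.length := hi
    have hat : (argTests m ts)[i]? = some (false, Builtin.eq (.var (m + i)) ts[i]) := by
      simp [argTests, hlt]
    have htake : (argTests m ts).take (i + 1) =
        (argTests m ts).take i ++ [(false, .eq (.var (m + i)) ts[i])] := by
      rw [List.take_add_one, hat]; rfl
    have ht : (ts[i]).IsGround := hts _ (by simp)
    obtain ⟨hw, hcase⟩ := he i as[i] ts[i] (by simp) (by simp)
    have hseq : ∀ n, seq (exec P (n + 2) stk) (testGoals ((argTests m ts).take (i + 1))) st =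
        (evalTest (n + 1) false (.eq (.var (m + i)) ts[i]) s).map st.setStore := by
      intro n
      rw [htake, testGoals, List.map_append, seq_append]
      erw [hs n]
      rw [Outcome.pure_bind, List.map_singleton, seq_cons, map_eq_bind]
      have : seq (exec P (n + 2) stk) [] = Outcome.pure := by funext a; rfl
      rw [this, exec_test, map_eq_bind, bind_assoc]
      congr 1
    -- If the parameter already has the prescribed value, the test holds and the store stays the
    -- same. Otherwise the test binds the parameter, and with it the argument that was merged with
    -- it.
    rcases hcase with hbd | ⟨hfree, hproh⟩
    · refine ⟨s, fun n => ?_, hg, hn, hk, he, hf, ?_, fun j hj => hu j (by omega)⟩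
      · have e : (Builtin.eq (.var (m + i)) ts[i]).subst s.sub = .eq ts[i] ts[i] := by
          simp only [Builtin.subst, Term.subst, hbd, ht.subst]
        rw [hseq, evalTest_ground n false (by
          rw [e]; simp [Builtin.vars, show (ts[i]).vars = [] from ht]), e,
          if_pos (by simp [Builtin.Holds])]
        rfl
      · intro j hj t hjt
        rcases Nat.lt_succ_iff_lt_or_eq.1 hj with h' | rfl
        · exact hb j h' t hjt
        · rw [hbd]
          simpa [hlt] using hjt
    · have hsub : ∀ x, (s.bind (m + i) ts[i]).sub x =
          (s.sub x).subst (Term.single (m + i) ts[i]) := fun x => rfl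
      have hself : ∀ x, s.sub x = .var (m + i) → (s.bind (m + i) ts[i]).sub x = ts[i] := by
        intro x hx
        rw [hsub, hx]
        exact Term.single_self _ _
      have hother : ∀ x z, z ≠ m + i → s.sub x = .var z →
          (s.bind (m + i) ts[i]).sub x = .var z := by
        intro x z hz hx
        rw [hsub, hx]
        exact Term.single_of_ne hz _
      have hgr : ∀ x, (s.sub x).IsGround → (s.bind (m + i) ts[i]).sub x = s.sub x := by
        intro x hx
        rw [hsub, hx.subst]
      have hkeep : s.Keeps (s.bind (m + i) ts[i]) := ⟨le_rfl, hgr⟩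
      refine ⟨s.bind (m + i) ts[i], fun n => ?_, ⟨⟨fun x hx => ?_, fun x hx z hz => ?_⟩, hg.2⟩, hn,
        hk.trans hkeep, ?_, ?_, ?_, ?_⟩
      · rw [hseq, evalTest_eq_of_unbound n hfree hproh ht]
        rfl
      · have hx : x ≥ s.next := hx
        exact ⟨hother x x (by omega) (hg.1.1 x hx).1, (hg.1.1 x hx).2⟩
      · have hx : x < s.next := hx
        rw [hsub, Term.mem_vars_subst] at hz
        obtain ⟨w, hw, hz⟩ := hz
        rcases eq_or_ne w (m + i) with rfl | h'
        · rw [Term.single_self, show (ts[i]).vars = [] from ht] at hz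
          simp at hz
        · rw [Term.single_of_ne h'] at hz
          obtain rfl : z = w := by simpa [Term.vars] using hz
          exact hg.1.2 x hx z hw
      · intro j a t ha hjt
        obtain ⟨h₁, h₂⟩ := he j a t ha hjt
        rcases eq_or_ne j i with rfl | hj
        · obtain rfl : ts[j] = t := by simpa [hlt] using hjt
          refine ⟨?_, Or.inl (hself _ hfree)⟩
          rw [hself _ hfree]
          rw [hfree] at h₁
          obtain ⟨x, rfl, hx⟩ := Store.walk_eq_var h₁
          exact hself x hx
        · rcases h₂ with h₂ | ⟨h₂, h₃⟩
          · have hgt : t.IsGround := hts t (List.mem_of_getElem? hjt)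
            rw [hkeep.walk (by rw [h₁, h₂]; exact hgt), hgr _ (by rw [h₂]; exact hgt)]
            exact ⟨h₁, Or.inl h₂⟩
          · have e := hother _ _ (by omega) h₂
            refine ⟨?_, Or.inr ⟨e, h₃⟩⟩
            rw [e]
            rw [h₂] at h₁
            obtain ⟨x, rfl, hx⟩ := Store.walk_eq_var h₁
            exact hother x _ (by omega) hx
      · intro a t hft
        obtain ⟨y, hy, hw, hyy, hp⟩ := hf a t hft
        have : y ≠ m + i := by
          rintro rfl
          rw [hproh] at hp
          simp at hp
        obtain ⟨x, rfl, hx⟩ := Store.walk_eq_var hw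
        exact ⟨y, hy, hother x y this hx, hother y y this hyy, hp⟩
      · intro j hj t hjt
        rcases Nat.lt_succ_iff_lt_or_eq.1 hj with h' | rfl
        · rw [hgr _ (by rw [hb j h' t hjt]; exact hts t (List.mem_of_getElem? hjt))]
          exact hb j h' t hjt
        · rw [hself _ hfree]
          simpa [hlt] using hjt
      · intro j hj hjl
        rw [← hu j (by omega) hjl]
        obtain ⟨h₁, h₂⟩ := he j as[j] ts[j] (by simp) (by simp)
        rcases h₂ with h₂ | ⟨h₂, h₃⟩
        · exact hgr _ (by rw [h₂]; exact hts _ (by simp))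
        · rw [h₂]
          exact hother _ _ (by omega) h₂

end Forbidden

/-! ### Expansion of sub-checks -/

theorem Outcome.seq_singleton {α γ : Type*} (f : γ → α → Outcome α) (g : γ) (a : α) :
    seq f [g] a = f g a := by
  have : (f g a).bind (seq f []) = (f g a).map id := (map_eq_bind _ _).symm
  rw [seq_cons, this]
  simp [Outcome.map]

section SubChecks

variable {R : Type v} {F : Type u}

theorem Clause.toProp_checkBody (c : Clause R F) :
    c.toProp.checkBody = c.toCheck.body.map BodyGoal.toProp := by
  have hmem : ∀ a, Propositional.Goal.lit true a ∈ c.body.map BodyGoal.toProp ↔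
      BodyGoal.lit true a ∈ c.body := by
    intro a
    rw [List.mem_map]
    constructor
    · rintro ⟨g, hg, e⟩
      cases g with
      | lit s b =>
        simp only [BodyGoal.toProp, Propositional.Goal.lit.injEq] at e
        obtain ⟨rfl, rfl⟩ := e
        exact hg
      | test s b => cases e
    · exact fun h => ⟨_, h, rfl⟩
  cases hh : c.head with
  | none => simp [Propositional.Clause.checkBody, Clause.toCheck, Clause.toProp, hh]
  | some a =>
    simp only [Propositional.Clause.checkBody, Clause.toCheck, Clause.toProp, hh, hmem]
    split_ifs <;> simp [BodyGoal.toProp]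

/-- The expansion of a sub-check by the propositional method. -/
theorem propExec_chk (P : Program R F) (n : ℕ) {k : ℕ} {c : Clause R F} (hc : P[k]? = some c)
    {chs : List (Propositional.Lit (Atom R F))} (hchs : ∀ d ∈ chs, d.2 ≠ .chk k) :
    propExec P (n + 1) [] (.lit false (.chk k)) chs =
      alts ((c.toCheck.body.map fun g => [g.toProp.neg.toInternal]).map fun body =>
        (seq (propExec P n [(false, .chk k)]) body chs).map fun chs' => (false, .chk k) :: chs') := by
  have h₁ : ¬ ∃ d ∈ chs ++ [], Propositional.Conflict Atom.Complementary (false, .chk k) d := by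
    rintro ⟨d, hd, ⟨-, h⟩ | ⟨-, -, _, _, -, h, -⟩⟩
    · exact hchs d (by simpa using hd) h.symm
    · cases h
  have h₂ : (false, Propositional.Sym.chk k) ∉ chs := fun h => hchs _ h rfl
  have h₃ : Propositional.bodies (P.map Clause.toProp) (false, .chk k) =
      c.toCheck.body.map fun g => [g.toProp.neg.toInternal] := by
    simp [Propositional.bodies, hc, Clause.toProp_checkBody]
  rw [propExec, Propositional.exec, if_neg h₁, if_neg h₂, h₃]
  simp [negCounts]

variable {P : Program R F} {U : Finset (Propositional.Lit (Atom R F))} {D : Set ℕ}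
  {st : State R F} {chs : List (Propositional.Lit (Atom R F))} {ts : List (Term F)}

/-- The arguments before the `m`-th one have the prescribed values, the prescribed value is prohibited
for the `m`-th one, and the others have the prescribed values or are unconstrained. -/
structure ForbidsAt (st : Store F) (as ts : List (Term F)) (m : ℕ) : Prop where
  before : ∀ i < m, (as.map st.walk)[i]? = ts[i]?
  forbids : ∃ a t, as[m]? = some a ∧ ts[m]? = some t ∧ st.Forbids a t
  after : ∀ (i : ℕ) (a t : Term F), m < i → as[i]? = some a → ts[i]? = some t →
    st.walk a = t ∨ st.Free a

theorem runRule_params (P : Program R F) (n : ℕ) (stk : List (Lit R F)) (l : Lit R F)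
    (st : State R F) {r : Rule R F} (hr : r.params = (List.range l.args.length).map .var) :
    runRule P n stk l st r =
      (unifyArgs n { st.toStore with next := st.next + r.bound } l.args
        ((List.range' st.next l.args.length).map .var)).bind fun s =>
          (seq (exec P n (l :: stk)) (r.shift st.next).body (st.setStore s)).bind
            (close n stk.length l) := by
  have : (r.shift st.next).params = (List.range' st.next l.args.length).map .var := by
    rw [Rule.shift, hr, map_walk_shift_range]
  rw [runRule, this]

/-- The rule for a different `i`-th argument, where the arguments are not all ground. -/
theorem exists_runRule_differRule_unbound (hr : StateRel P D st chs) (stk : List (Lit R F))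
    {l : Lit R F} (hl : ArgsOK st.toStore l.args ts) (hts : ∀ t ∈ ts, t.IsGround)
    (hlen : l.args.length = ts.length) {i : ℕ} {a t : Term F} (ha : l.args[i]? = some a)
    (ht : ts[i]? = some t) :
    (st.walk a = t → ∀ n, runRule P (n + 2) stk l st (differRule ts i t) = fail) ∧
    (st.Free a → ∃ s : Store F,
      (∀ n, runRule P (n + 2) stk l st (differRule ts i t) =
        Outcome.pure ((st.setStore s).closed stk.length l)) ∧
      s.Good ∧ st.toStore.Refines s ∧ ForbidsAt s l.args ts i ∧
      ∀ (j : ℕ) (b : Term F), i < j → l.args[j]? = some b → st.Free b → s.Free b) := by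
  have hp : (differRule ts i t : Rule R F).params = (List.range l.args.length).map .var := by
    rw [hlen]; rfl
  obtain ⟨s, hs, hsg, hsk, hsf, hsn, hse, hsv⟩ :=
    exists_unifyArgs_fresh hr.good hts hlen hl (le_bound hp)
  have hi := (List.getElem?_eq_some_iff.1 ht).1
  obtain ⟨s', hs', hg', hn', hk', he', hf', hb', hu'⟩ :=
    exists_seq_argTests P (l :: stk) (st := st.setStore s) hsg hts hlen hse (hlen ▸ hsn) i hi.le
  have hgt := hts t (List.mem_of_getElem? ht)
  have hs'n : s'.next = s.next := hn'
  have hkeep : st.toStore.Keeps s' := hsk.trans hk'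
  obtain ⟨hwi, hci⟩ := he' i a t ha ht
  have hrun : ∀ n, runRule P (n + 2) stk l st (differRule ts i t) =
      ((evalTest (n + 1) true (.eq (.var (st.next + i)) t) s').map st.setStore).bind
        (close (n + 2) stk.length l) := by
    intro n
    rw [runRule_params P (n + 2) stk l st hp, hs (n + 1), Outcome.pure_bind,
      shift_differRule _ hts ht, differBody, testGoals, List.map_append, seq_append]
    erw [hs' n]
    rw [Outcome.pure_bind, List.map_singleton, seq_cons]
    have : seq (exec P (n + 2) (l :: stk)) [] = Outcome.pure := by funext a; rfl
    rw [this, exec_test, map_eq_bind, map_eq_bind, bind_assoc]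
    simp only [Outcome.pure_bind]
    rfl
  constructor
  · intro hw n
    have e : s'.sub (st.next + i) = t := by
      rw [← hwi, hkeep.walk (by rw [hw]; exact hgt), hw]
    have e' : (Builtin.eq (.var (st.next + i)) t).subst s'.sub = .eq t t := by
      simp only [Builtin.subst, Term.subst, e, hgt.subst]
    rw [hrun, evalTest_ground n true (by rw [e']; simp [Builtin.vars, show t.vars = [] from hgt]),
      e', if_neg (by simp [Builtin.Holds])]
    rfl
  · intro hfree
    -- The equality tests before position `i` leave this parameter unbound, so that the
    -- disunification can only add `t` to its empty list of prohibited values.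
    have hsub : s'.sub (st.next + i) = .var (st.next + i) := by
      rw [hu' i le_rfl hi]
      exact hsv i a ha hfree
    have hproh : s'.proh (st.next + i) = [] := by
      rcases hci with h | h
      · rw [hsub] at h
        rw [← h] at hgt
        exact absurd hgt (Term.not_isGround_var _)
      · exact h.2
    have hlt : st.next + i < s'.next := by rw [hs'n]; omega
    have hpr : (s'.prohibit (st.next + i) t).proh (st.next + i) = [t] := by
      simp [Store.prohibit, hproh]
    have hpr' : ∀ x ≠ st.next + i, (s'.prohibit (st.next + i) t).proh x = s'.proh x := by
      intro x hx
      simp [Store.prohibit, hx]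
    have hkp : s'.Keeps (s'.prohibit (st.next + i) t) := ⟨le_rfl, fun _ _ => rfl⟩
    have hgood : (s'.prohibit (st.next + i) t).Good := by
      refine ⟨⟨fun x hx => ?_, hg'.1.2⟩, hg'.2⟩
      have hx : s'.next ≤ x := hx
      rw [hpr' x (by omega)]
      exact hg'.1.1 x hx
    have hlt' : ∀ (j : ℕ) (b : Term F), l.args[j]? = some b → st.next + j < s'.next := by
      intro j b hb
      have := (List.getElem?_eq_some_iff.1 hb).1
      rw [hs'n]
      omega
    refine ⟨s'.prohibit (st.next + i) t, fun n => ?_, hgood, ⟨hkeep.trans hkp, fun b u hb => ?_⟩,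
      ⟨fun j hj => ?_, ⟨a, t, ha, ht, st.next + i, hlt, hwi.trans hsub, hsub, hpr⟩,
        fun j b u hj hb hu => ?_⟩, fun j b hj hb hf => ?_⟩
    · rw [hrun, evalTest_ne_of_unbound n hsub hgt, pure_map, Outcome.pure_bind]
      exact close_eq (st := st.setStore (s'.prohibit (st.next + i) t)) hgood
        (fun p hp' => (hkeep.trans hkp).groundLit (hr.pending p hp')) _ _ _
    · obtain ⟨y, hy, h₁, h₂, h₃⟩ := hf' b u (hsf b u hb)
      exact ⟨y, by change y < s'.next; omega, h₁, h₂, by rw [hpr' y (by omega)]; exact h₃⟩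
    · have hjl : j < l.args.length := by omega
      have hjt : j < ts.length := by omega
      have h₁ := (he' j l.args[j] ts[j] (by simp) (by simp)).1
      rw [hb' j hj ts[j] (by simp)] at h₁
      simp only [List.getElem?_map, List.getElem?_eq_getElem hjl, Option.map_some,
        List.getElem?_eq_getElem hjt]
      exact congrArg some h₁
    · obtain ⟨h₁, h₂⟩ := he' j b u hb hu
      rcases h₂ with h₂ | ⟨h₂, h₃⟩
      · exact Or.inl (h₁.trans h₂)
      · exact Or.inr ⟨st.next + j, hlt' j b hb, h₁.trans h₂, h₂, by
          rw [hpr' _ (by omega)]; exact h₃⟩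
    · have hjl := (List.getElem?_eq_some_iff.1 hb).1
      have hjt : j < ts.length := by omega
      obtain ⟨h₁, h₂⟩ := he' j b ts[j] hb (by simp)
      have h₃ : s'.sub (st.next + j) = .var (st.next + j) := by
        rw [hu' j hj.le hjt]
        exact hsv j b hb hf
      rcases h₂ with h₂ | ⟨-, h₂⟩
      · have := hts ts[j] (by simp)
        rw [← h₂, h₃] at this
        exact absurd this (Term.not_isGround_var _)
      · exact ⟨st.next + j, hlt' j b hb, h₁.trans h₃, h₃, by rw [hpr' _ (by omega)]; exact h₂⟩

/-- The rule for a goal in the body, where the arguments are not all ground. -/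
theorem SimulatesCalls.stably_negRule {k : ℕ} {as : List (Term F)}
    (h : SimulatesCalls P U [(false, .chk k)])
    (hr : StateRel P D st chs) (hl : ArgsOK st.toStore as ts) (hts : ∀ t ∈ ts, t.IsGround)
    (hlen : as.length = ts.length) {g : BodyGoal R F} (hg : g.vars = [])
    (hU : ∀ s a, g = .lit s a → (!s, .atom a) ∈ U) (hD : k ∈ D) :
    Stably (fun st' => (∃ chs', StateRel P D st' chs') ∧ st.toStore.Refines st'.toStore ∧
        as.map st'.walk = ts ∧
        ∀ e ∈ st'.chs, (∃ j, e.sym = .chk j) → e = ⟨false, .chk k, as⟩ ∨ e ∈ st.chs)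
      fun n => runRule P (n + 2) [] ⟨false, .chk k, as⟩ st (negRule ts g) := by
  have hp : (negRule ts g : Rule R F).params =
      (List.range (⟨false, .chk k, as⟩ : Lit R F).args.length).map .var := by
    simp only [hlen]; rfl
  obtain ⟨s, hs, hsg, hsk, hsf, hsn, hse, hsv⟩ :=
    exists_unifyArgs_fresh hr.good hts hlen hl (le_bound hp)
  obtain ⟨s', hs', hg', hn', hk', he', hf', hb', -⟩ :=
    exists_seq_argTests P [⟨false, .chk k, as⟩] (st := st.setStore s) hsg hts hlen hse
      (hlen ▸ hsn) ts.length le_rfl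
  have hs'n : s'.next = s.next := hn'
  have hkeep : st.toStore.Keeps s' := hsk.trans hk'
  have hrun : ∀ n, runRule P (n + 2) [] ⟨false, .chk k, as⟩ st (negRule ts g) =
      (exec P (n + 2) [⟨false, .chk k, as⟩] g.neg.toGoal (st.setStore s')).bind
        (close (n + 2) 0 ⟨false, .chk k, as⟩) := by
    intro n
    have htake : (argTests st.next ts).take ts.length = argTests st.next ts :=
      List.take_of_length_le (by simp [argTests])
    rw [runRule_params P (n + 2) [] _ st hp, hs (n + 1), Outcome.pure_bind,
      shift_negRule _ hts hg, seq_append]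
    have := hs' n
    rw [htake] at this
    erw [this]
    rw [Outcome.pure_bind, seq_singleton]
    rfl
  -- All equality tests have been passed, so every argument, free or not, now has its prescribed
  -- value.
  have hbound : as.map s'.walk = ts := by
    refine List.ext_getElem (by simpa using hlen) fun j h₁ h₂ => ?_
    have hj : j < as.length := by simpa using h₁
    rw [List.getElem_map, (he' j as[j] ts[j] (by simp) (by simp)).1]
    exact hb' j h₂ _ (by simp)
  have href : st.toStore.Refines s' := ⟨hkeep, fun b u hb => by
    obtain ⟨y, hy, h'⟩ := hf' b u (hsf b u hb)
    exact ⟨y, by omega, h'⟩⟩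
  have hrel := hr.keeps hkeep hg'
  simp only [hrun]
  have hok : LitOK s' (⟨false, .chk k, as⟩ : Lit R F) := ⟨fun h => absurd rfl (h k), fun _ => rfl⟩
  have hsim := h.bodyGoal (stk := [⟨false, .chk k, as⟩]) (st := st.setStore s')
    (.cons ⟨hok, Or.inr ⟨k, rfl, rfl⟩⟩ .nil) hrel (g := g.neg) (by rw [BodyGoal.vars_neg, hg])
    (fun s a e => by
      cases g with
      | lit s' a' =>
        simp only [BodyGoal.neg, BodyGoal.lit.injEq] at e
        obtain ⟨rfl, rfl⟩ := e
        exact hU s' a' rfl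
      | test s' b => cases e)
  -- The propositional run is dropped here: it only certifies that the search is finite. When an
  -- argument was unbound, these answers bind it and its for-all will reject them.
  refine (hsim.add 2).stably.bind fun st' ⟨chs', hst'⟩ => ?_
  simp only [close_eq hst'.rel.good hst'.rel.pending]
  have hk₁ : s'.Keeps st'.toStore := hst'.ext.keeps hg'.1
  refine stably_pure ⟨⟨chs', ?_⟩, href.trans (hst'.ext.refines hg'), ?_, ?_⟩
  · exact hst'.rel.closed (lp := none) ⟨fun h => absurd rfl (h k), fun _ => rfl⟩
      (fun j hj => by obtain rfl : k = j := by simpa using hj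
                      exact hD) 0 rfl
  · rw [← hbound]
    refine List.map_congr_left fun a ha => hk₁.walk ?_
    have : s'.walk a ∈ ts := by rw [← hbound]; exact List.mem_map_of_mem ha
    exact hts _ this
  · intro e he hj
    rcases List.mem_cons.1 he with rfl | he
    exacts [Or.inl rfl, Or.inr (hst'.chk e he hj)]

end SubChecks

/-! ### The for-all mechanism for sub-checks -/

section ForAll

variable {R : Type v} {F : Type u} {P : Program R F}
  {U : Finset (Propositional.Lit (Atom R F))} {D : Set ℕ}
  {st : State R F} {chs : List (Propositional.Lit (Atom R F))} {as ts : List (Term F)} {k : ℕ}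

/-- The calls of the sub-check in the coinductive hypothesis set have the arguments `as`, up to their
number, or cannot match `as`. -/
def Covered (k : ℕ) (ts as : List (Term F)) (st : State R F) : Prop :=
  ∀ e ∈ st.chs, e.sym = .chk k →
    Blocked st.toStore as ts e.args ∨ (e.args.map st.walk).take as.length = as.map st.walk

/-- A transition by the execution of a sub-check. -/
structure ChkStep (P : Program R F) (D : Set ℕ) (k : ℕ) (ts as : List (Term F)) (st st' : State R F)
    (chs' : List (Propositional.Lit (Atom R F))) : Prop where
  rel : StateRel P D st' chs'
  keeps : st.toStore.Keeps st'.toStore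
  covered : Covered k ts as st'

theorem StateRel.cons_chk (h : StateRel P D st chs) (hk : k ∈ D) :
    StateRel P D st ((false, .chk k) :: chs) :=
  { h with
    abs := by rw [h.abs]; simp
    dom := by
      rintro j (hj | ⟨d, hd, hj⟩)
      · exact h.dom j (Or.inl hj)
      · rcases List.mem_cons.1 hd with rfl | hd
        · obtain rfl : k = j := by simpa using hj
          exact hk
        · exact h.dom j (Or.inr ⟨d, hd, hj⟩) }

/-- The relation compares the two sets without the heads of sub-checks. Removing these heads gives a
propositional set to which the specification of a sub-check call applies, even when the original one
is only known to exist. -/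
theorem StateRel.filter_chk (h : StateRel P D st chs) :
    StateRel P D st (chs.filter fun l => ∀ k, l.2 ≠ .chk k) :=
  { h with
    abs := by rw [h.abs]; simp
    dom := by
      rintro j (hj | ⟨d, hd, hj⟩)
      · exact h.dom j (Or.inl hj)
      · exact h.dom j (Or.inr ⟨d, (List.mem_filter.1 hd).1, hj⟩) }

theorem map_walk_of_keeps {s s' : Store F} (h : s.Keeps s') (hts : ∀ t ∈ ts, t.IsGround) {m : ℕ}
    (ha : as.map s.walk = ts.take m) : as.map s'.walk = ts.take m := by
  rw [← ha]
  refine List.map_congr_left fun a ha' => h.walk ?_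
  have : s.walk a ∈ ts.take m := by rw [← ha]; exact List.mem_map_of_mem ha'
  exact hts _ (List.mem_of_mem_take this)

/-- Earlier entries stay blocked under refinement, and the only new one is the call itself. -/
theorem covered_of_refines {st' : State R F}
    (hb : ∀ e ∈ st.chs, e.sym = .chk k → Blocked st.toStore as ts e.args)
    (hts : ∀ t ∈ ts, t.IsGround) (hr : st.toStore.Refines st'.toStore)
    (hc : ∀ e ∈ st'.chs, (∃ j, e.sym = .chk j) → e = ⟨false, .chk k, as⟩ ∨ e ∈ st.chs) :
    Covered k ts as st' := by
  intro e he hk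
  rcases hc e he ⟨k, hk⟩ with rfl | h
  · exact Or.inr (List.take_of_length_le (by simp))
  · exact Or.inl ((hb e h hk).refines hts hr)

/-- What is known before the execution of a sub-check, the first arguments being `as`. -/
structure ChkPre (P : Program R F) (D : Set ℕ) (k : ℕ) (ts as : List (Term F)) (st : State R F)
    (chs : List (Propositional.Lit (Atom R F))) : Prop where
  rel : StateRel P D st chs
  args : ArgsOK st.toStore as ts
  vars : ∀ a ∈ as, ∀ x ∈ a.vars, ts.length ≤ x
  next : ts.length ≤ st.next
  blocked : ∀ e ∈ st.chs, e.sym = .chk k → Blocked st.toStore as ts e.args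

/-- The first answer of a sub-check of whose arguments the `m`-th is the first one that is not
ground. -/
structure FirstAnswer (P : Program R F) (D : Set ℕ) (k : ℕ) (ts as : List (Term F)) (m : ℕ)
    (st : State R F) (chs : List (Propositional.Lit (Atom R F))) (st' : State R F) : Prop where
  step : ChkStep P D k ts as st st' chs
  forbids : ForbidsAt st'.toStore as ts m
  free : ∀ (i : ℕ) (a : Term F), m < i → as[i]? = some a → st.Free a → st'.Free a

/-- The other answers of a sub-check of whose arguments the `m`-th is the first one that is not
ground. -/
structure OtherAnswer (P : Program R F) (D : Set ℕ) (k : ℕ) (ts as : List (Term F)) (m : ℕ)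
    (st st' : State R F) : Prop where
  step : ∃ chs', ChkStep P D k ts as st st' chs'
  bound : (as.map st'.walk)[m]? = ts[m]?
  args : as.map st'.walk = ts.take as.length ∨ ∃ m', ForbidsAt st'.toStore as ts m'

/-- The execution of a goal behaves like that of a sub-check. -/
structure ChkSpec (P : Program R F) (D : Set ℕ) (k : ℕ) (ts as : List (Term F)) (st : State R F)
    (chs : List (Propositional.Lit (Atom R F))) (g : Goal R F) : Prop where
  bound : as.map st.walk = ts.take as.length → (∀ d ∈ chs, d.2 ≠ .chk k) →
    Simulates (fun st' chs' => ChkStep P D k ts as st st' chs') (fun n => exec P n [] g st)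
      (fun n => propExec P n [] (.lit false (.chk k)) chs)
  unbound : ∀ (m : ℕ) (a : Term F), as[m]? = some a → st.Free a →
    (∀ i < m, (as.map st.walk)[i]? = ts[i]?) →
    StablyFirst (FirstAnswer P D k ts as m st chs) (OtherAnswer P D k ts as m st)
      fun n => exec P n [] g st

/-- With no for-all left, ground arguments lead to the dual of a ground clause. Otherwise let the
`m`-th argument be the first unbound one. The rules for differences before `m` fail, the rule at `m`
gives the first answer, and all later rules test the `m`-th argument for equality with its
prescribed value and so bind it. -/
theorem chkSpec_lit {c : Clause R F} (hPc : P[k]? = some c) (hc : c.toCheck.IsGround)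
    (hts : c.toCheck.headArgs = ts) (h : SimulatesCalls P U [(false, .chk k)]) (hkD : k ∈ D)
    (hU : ∀ s a, BodyGoal.lit s a ∈ c.toCheck.body → (!s, .atom a) ∈ U)
    (hlen : as.length = ts.length) (hp : ChkPre P D k ts as st chs) :
    ChkSpec P D k ts as st chs (.lit ⟨false, .chk k, as⟩) := by
  have hgts : ∀ t ∈ ts, t.IsGround := hts ▸ hc.headArgs
  have hrules : rulesFor P ⟨false, .chk k, as⟩ = c.toCheck.dualRules := by simp [rulesFor, hPc]
  have hexec : ∀ n, exec P (n + 2 + 1) [] (.lit ⟨false, .chk k, as⟩) st =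
      alts (c.toCheck.dualRules.map (runRule P (n + 2) [] ⟨false, .chk k, as⟩ st)) := by
    intro n
    rw [exec_lit_eq, call_chk n hgts hp.rel.ok hp.blocked, hrules]
  have hgood := hp.rel.good
  constructor
  · intro hb hchs
    rw [hlen, List.take_length] at hb
    have hgl : st.toStore.GroundLit (⟨false, .chk k, as⟩ : Lit R F) := by
      intro a ha
      have : st.walk a ∈ ts := by rw [← hb]; exact List.mem_map_of_mem ha
      exact hgts _ this
    refine Simulates.of_succ (Simulates.of_succ (Simulates.of_succ ?_))
    simp only [hexec, propExec_chk P _ hPc hchs]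
    refine (h.dualRules (stk := []) .nil hp.rel hgl
      ⟨⟨fun _ => hgl, fun _ => rfl⟩, Or.inr ⟨k, rfl, rfl⟩⟩ hc (hb.trans hts.symm) hU).mono ?_
    rintro st' chs' ⟨st₁, chs₁, hs, rfl, rfl⟩
    have hr := hs.ext.refines hgood
    refine ⟨StateRel.cons_chk (hs.rel.closed (lp := none)
      (l := ⟨false, .chk k, as⟩) ⟨fun _ => hr.1.groundLit hgl, fun _ => rfl⟩
      (fun j hj => by obtain rfl : k = j := by simpa using hj
                      exact hkD) 0 rfl) hkD, hr.1,
      covered_of_refines hp.blocked hgts hr fun e he hj => ?_⟩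
    rcases List.mem_cons.1 he with rfl | he
    exacts [Or.inl rfl, Or.inr (hs.chk e he hj)]
  · intro m a ham hfree hbef
    refine StablyFirst.of_succ (StablyFirst.of_succ (StablyFirst.of_succ ?_))
    have hm : m < ts.length := by rw [← hlen]; exact (List.getElem?_eq_some_iff.1 ham).1
    have hsplit : (ts.mapIdx fun i t => (differRule ts i t : Rule R F)) =
        (ts.mapIdx fun i t => differRule ts i t).take m ++ differRule ts m ts[m] ::
          (ts.mapIdx fun i t => differRule ts i t).drop (m + 1) := by
      conv_lhs => rw [← List.take_append_drop m
        (ts.mapIdx fun i t => (differRule ts i t : Rule R F)),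
        List.drop_eq_getElem_cons (by simpa using hm)]
      simp
    have htake : ∀ n, alts (((ts.mapIdx fun i t => differRule ts i t).take m).map
        (runRule P (n + 2) [] ⟨false, .chk k, as⟩ st)) = fail := by
      intro n
      refine alts_eq_fail fun o ho => ?_
      obtain ⟨r, hr, rfl⟩ := List.mem_map.1 ho
      obtain ⟨i, hi, rfl⟩ := List.mem_take_iff_getElem.1 hr
      simp only [List.length_mapIdx, lt_min_iff] at hi
      have hia : i < as.length := by omega
      have hit : i < ts.length := hi.2
      rw [List.getElem_mapIdx]
      refine (exists_runRule_differRule_unbound hp.rel [] (l := ⟨false, .chk k, as⟩) hp.args hgts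
        hlen (a := as[i]) (t := ts[i]) (List.getElem?_eq_getElem hia)
        (List.getElem?_eq_getElem hit)).1 ?_ n
      have := hbef i hi.1
      rw [List.getElem?_eq_getElem hit, List.getElem?_map, List.getElem?_eq_getElem hia] at this
      simpa using this
    have hclosed : ∀ {s : Store F}, s.Good → st.toStore.Refines s →
        ChkStep P D k ts as st ((st.setStore s).closed 0 ⟨false, .chk k, as⟩) chs := by
      intro s hs hr
      refine ⟨(hp.rel.keeps hr.1 hs).closed (lp := none) ⟨fun h => absurd rfl (h k), fun _ => rfl⟩
        (fun j hj => by obtain rfl : k = j := by simpa using hj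
                        exact hkD) 0 rfl, hr.1,
        covered_of_refines hp.blocked hgts hr fun e he hj => List.mem_cons.1 he⟩
    have hfirst : StablyFirst (FirstAnswer P D k ts as m st chs) (OtherAnswer P D k ts as m st)
        fun n => runRule P (n + 2) [] ⟨false, .chk k, as⟩ st (differRule ts m ts[m]) := by
      obtain ⟨s, hs, hsg, hsr, hsf, hsv⟩ :=
        (exists_runRule_differRule_unbound hp.rel [] (l := ⟨false, .chk k, as⟩) hp.args hgts
          hlen ham (List.getElem?_eq_getElem hm)).2 hfree
      simp only [hs]
      exact stablyFirst_pure _ ⟨hclosed hsg hsr, hsf, hsv⟩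
    -- A rule for a difference after `m` has bound the `m`-th argument before it prohibits a value.
    have hrest : Stably (OtherAnswer P D k ts as m st) fun n =>
        alts (((ts.mapIdx fun i t => differRule ts i t).drop (m + 1)).map
          (runRule P (n + 2) [] ⟨false, .chk k, as⟩ st)) := by
      refine Stably.alts fun r hr => ?_
      obtain ⟨i, hi, rfl⟩ := List.mem_drop_iff_getElem.1 hr
      simp only [List.length_mapIdx] at hi
      have hia : m + 1 + i < as.length := by omega
      have hit : m + 1 + i < ts.length := by omega
      rw [List.getElem_mapIdx]
      obtain ⟨h₁, h₂⟩ := exists_runRule_differRule_unbound hp.rel []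
        (l := ⟨false, .chk k, as⟩) hp.args hgts hlen
        (a := as[m + 1 + i]) (t := ts[m + 1 + i]) (List.getElem?_eq_getElem hia)
        (List.getElem?_eq_getElem hit)
      rcases hp.args.ok (m + 1 + i) as[m + 1 + i] ts[m + 1 + i] (List.getElem?_eq_getElem hia)
        (List.getElem?_eq_getElem hit) with hb | hf
      · simp only [h₁ hb]
        exact stably_fail _
      · obtain ⟨s, hs, hsg, hsr, hsf, -⟩ := h₂ hf
        simp only [hs]
        exact stably_pure ⟨⟨chs, hclosed hsg hsr⟩, hsf.before m (by omega), Or.inr ⟨_, hsf⟩⟩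
    have hneg : Stably (OtherAnswer P D k ts as m st) fun n =>
        alts ((c.toCheck.body.map (negRule ts)).map
          (runRule P (n + 2) [] ⟨false, .chk k, as⟩ st)) := by
      refine Stably.alts fun r hr => ?_
      obtain ⟨g, hg, rfl⟩ := List.mem_map.1 hr
      refine (h.stably_negRule hp.rel hp.args hgts hlen (hc.body g hg)
        (fun s a e => hU s a (e ▸ hg)) hkD).mono ?_
      rintro st' ⟨⟨chs', h₁⟩, h₂, h₃, h₄⟩
      refine ⟨⟨chs', h₁, h₂.1, covered_of_refines hp.blocked hgts h₂ h₄⟩, by rw [h₃], Or.inl ?_⟩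
      rw [h₃, hlen, List.take_length]
    simp only [hexec, hc.dualRules, hts]
    rw [hsplit]
    simp only [List.map_append, alts_append, htake, fail_orElse, List.map_cons, alts_cons,
      orElse_assoc]
    exact hfirst.orElse (hrest.orElse hneg)

end ForAll

/-! ### Nested for-alls over the arguments of a sub-check. -/

section ForAll

variable {R : Type v} {F : Type u} {P : Program R F}
  {U : Finset (Propositional.Lit (Atom R F))} {D : Set ℕ}
  {st : State R F} {chs : List (Propositional.Lit (Atom R F))} {as ts : List (Term F)} {k : ℕ}

/-- The call of `sym` with the arguments `as` and the variables `j, …, j + r - 1`, which are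
universally quantified. -/
def allFrom (sym : Sym R) : ℕ → ℕ → List (Term F) → Goal R F
  | 0, _, as => .lit ⟨false, sym, as⟩
  | r + 1, j, as => .all j (allFrom sym r (j + 1) (as ++ [.var j]))

theorem quantified_eq_allFrom (sym : Sym R) (m r : ℕ) :
    (quantified sym m r : Goal R F) = allFrom sym r m ((List.range m).map .var) := by
  unfold quantified
  induction r generalizing m with
  | zero => rfl
  | succ r ih =>
    rw [List.range_succ_eq_map, List.foldr_cons, List.foldr_map, allFrom, Nat.add_zero]
    have := ih (m + 1)
    rw [List.range_succ, List.map_append, List.map_singleton] at this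
    rw [← this]
    simp only [Nat.succ_eq_add_one, Nat.add_assoc, Nat.add_comm 1]

theorem inst_allFrom (sym : Sym R) (r : ℕ) {j x : ℕ} (hx : x < j) (as : List (Term F))
    (t : Term F) :
    (allFrom sym r j as).inst x t = allFrom sym r j (as.map (Term.subst (Term.single x t))) := by
  induction r generalizing j as with
  | zero => rfl
  | succ r ih =>
    rw [allFrom, Goal.inst, if_neg (by omega), ih (by omega), allFrom, List.map_append,
      List.map_singleton]
    rw [Term.subst, Term.single_of_ne (by omega)]

/-- Instantiation affects the last argument only, as the earlier ones do not contain the quantified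
variable. -/
theorem inst_allFrom_append (sym : Sym R) (r : ℕ) {j : ℕ} {as : List (Term F)}
    (has : ∀ a ∈ as, j ∉ a.vars) (t : Term F) :
    (allFrom sym r (j + 1) (as ++ [.var j])).inst j t = allFrom sym r (j + 1) (as ++ [t]) := by
  rw [inst_allFrom sym r (Nat.lt_succ_self j), List.map_append, List.map_singleton, Term.subst,
    Term.single_self]
  congr 2
  conv_rhs => rw [← List.map_id as]
  exact List.map_congr_left fun a ha => Term.subst_single_of_notMem (has a ha) t

theorem vars_allFrom (sym : Sym R) (r j : ℕ) (as : List (Term F)) :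
    ∀ i < r, j + i ∈ (allFrom sym r j as).vars := by
  induction r generalizing j as with
  | zero => simp
  | succ r ih =>
    intro i hi
    rw [allFrom, Goal.vars]
    rcases i with _ | i
    · simp
    · have := ih (j + 1) (as ++ [.var j]) i (by omega)
      rw [show j + (i + 1) = j + 1 + i by omega]
      exact List.mem_cons_of_mem _ this

/-- The for-all mechanism after an answer for the variable `v`. -/
def forallCont (P : Program R F) (n : ℕ) (stk : List (Lit R F)) (x : ℕ) (g : Goal R F) (v : ℕ)
    (st' : State R F) : Outcome (State R F) :=
  match st'.sub v with
  | .var y =>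
    (seq (exec P n stk) ((st'.proh y).map fun c => g.inst x (st'.walk c))
      (st'.addGoal (g.inst x (.var v)))).map fun st'' => st''.closeAll y fun t => g.inst x t
  | _ => fail

theorem exec_all (P : Program R F) (n : ℕ) (stk : List (Lit R F)) (x : ℕ) (g : Goal R F)
    (st : State R F) :
    exec P (n + 1) stk (.all x g) st =
      (exec P n stk (g.inst x (.var st.next)) { st with next := st.next + 1 }).bind
        (forallCont P n stk x g st.next) := by
  rw [exec]
  rfl

theorem forallCont_of_isGround (P : Program R F) (n : ℕ) (stk : List (Lit R F)) (x : ℕ)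
    (g : Goal R F) {v : ℕ} {st' : State R F} (h : (st'.sub v).IsGround) :
    forallCont P n stk x g v st' = fail := by
  unfold forallCont
  cases e : st'.sub v with
  | var y => rw [e] at h; exact absurd h (Term.not_isGround_var y)
  | _ => rfl

theorem forallCont_of_var (P : Program R F) (n : ℕ) (stk : List (Lit R F)) (x : ℕ)
    (g : Goal R F) {v y : ℕ} {st' : State R F} (h : st'.sub v = .var y) :
    forallCont P n stk x g v st' =
      (seq (exec P n stk) ((st'.proh y).map fun c => g.inst x (st'.walk c))
        (st'.addGoal (g.inst x (.var v)))).map fun st'' =>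
          st''.closeAll y fun t => g.inst x t := by
  unfold forallCont
  rw [h]

theorem addGoal_toStore (st : State R F) (g : Goal R F) : (st.addGoal g).toStore = st.toStore := by
  cases g <;> rfl

theorem mem_addGoal_allFrom {r j : ℕ} {e : Lit R F}
    (h : e ∈ (st.addGoal (allFrom (.chk k) r j as)).chs) :
    e = ⟨false, .chk k, as⟩ ∨ e ∈ st.chs := by
  cases r with
  | zero => exact List.mem_cons.1 h
  | succ r => exact Or.inr h

theorem StateRel.addGoal (h : StateRel P D st chs) (hk : k ∈ D) (r j : ℕ) (as : List (Term F)) :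
    StateRel P D (st.addGoal (allFrom (.chk k) r j as)) chs := by
  cases r with
  | succ r => exact h
  | zero =>
    refine ⟨h.good, h.pending, ?_, ?_, ?_⟩
    · intro d hd
      rcases List.mem_cons.1 hd with rfl | hd
      exacts [⟨fun h => absurd rfl (h k), fun _ => rfl⟩, h.ok d hd]
    · rw [← h.abs]
      exact List.filterMap_cons_none rfl
    · rintro i (⟨d, hd, hi⟩ | hi)
      · rcases List.mem_cons.1 hd with rfl | hd
        · obtain rfl : k = i := by simpa using hi
          exact hk
        · exact h.dom i (Or.inl ⟨d, hd, hi⟩)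
      · exact h.dom i (Or.inr hi)

/-- The store has the same values, and possibly additional fresh variables. -/
structure Store.Widens (s s' : Store F) : Prop where
  sub : s'.sub = s.sub
  proh : s'.proh = s.proh
  next : s.next ≤ s'.next

theorem Store.Widens.walk {s s' : Store F} (h : s.Widens s') (a : Term F) :
    s'.walk a = s.walk a := by
  rw [Store.walk, h.sub, Store.walk]

theorem Store.Widens.keeps {s s' : Store F} (h : s.Widens s') : s.Keeps s' :=
  ⟨h.next, fun x _ => by rw [h.sub]⟩

theorem Store.Widens.free {s s' : Store F} (h : s.Widens s') {a : Term F} (ha : s.Free a) :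
    s'.Free a := by
  obtain ⟨y, hy, h₁, h₂, h₃⟩ := ha
  exact ⟨y, hy.trans_le h.next, by rw [h.walk, h₁], by rw [h.sub, h₂], by rw [h.proh, h₃]⟩

theorem Store.Widens.forbids {s s' : Store F} (h : s.Widens s') {a t : Term F}
    (ha : s.Forbids a t) : s'.Forbids a t := by
  obtain ⟨y, hy, h₁, h₂, h₃⟩ := ha
  exact ⟨y, hy.trans_le h.next, by rw [h.walk, h₁], by rw [h.sub, h₂], by rw [h.proh, h₃]⟩

theorem Store.Widens.map_walk {s s' : Store F} (h : s.Widens s') (as : List (Term F)) :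
    as.map s'.walk = as.map s.walk := List.map_congr_left fun a _ => h.walk a

theorem ForbidsAt.widens {s s' : Store F} {m : ℕ} (h : ForbidsAt s as ts m) (hw : s.Widens s') :
    ForbidsAt s' as ts m where
  before := by rw [hw.map_walk]; exact h.before
  forbids := by
    obtain ⟨a, t, ha, ht, hf⟩ := h.forbids
    exact ⟨a, t, ha, ht, hw.forbids hf⟩
  after i a t hi ha ht := by
    rw [hw.walk]
    exact (h.after i a t hi ha ht).imp_right hw.free

theorem closeAll_widens (st : State R F) (y : ℕ) (g : Term F → Goal R F) :
    st.toStore.Widens (st.closeAll y g).toStore := by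
  rw [State.closeAll, addGoal_toStore]
  exact ⟨rfl, rfl, Nat.le_succ _⟩

/-- The for-all over the argument after `as` has succeeded. -/
theorem ChkStep.closeAll {st' : State R F} {g : Term F → Goal R F} {r j : ℕ}
    (hg : ∀ t, g t = allFrom (.chk k) r j (as ++ [t])) (hts : ∀ t ∈ ts, t.IsGround) (hk : k ∈ D)
    (hr : StateRel P D st' chs) (hkeep : st.toStore.Keeps st'.toStore)
    (hc : Covered k ts as st') (y : ℕ) :
    ChkStep P D k ts as st (st'.closeAll y g) chs := by
  have hw := closeAll_widens st' y g
  have hgood := hr.good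
  set st₁ : State R F := st'.setStore
    { st'.toStore with next := st'.next + 1, loop := st'.loop.filter fun x => st'.sub x ≠ .var y }
    with hst₁
  have hst₁w : st'.toStore.Widens st₁.toStore := ⟨rfl, rfl, Nat.le_succ _⟩
  have e : st'.closeAll y g = st₁.addGoal (allFrom (.chk k) r j (as ++ [.var st'.next])) := by
    rw [State.closeAll, hg]
    rfl
  have hrel₁ : StateRel P D st₁ chs := hr.keeps hst₁w.keeps
    ⟨(hgood.1.mono (Nat.le_succ _)), by simp [hgood.2]⟩
  refine ⟨by rw [e]; exact hrel₁.addGoal hk r j _, hkeep.trans hw.keeps, ?_⟩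
  intro d hd hdk
  have hwalk : (st'.closeAll y g).walk = st'.walk := by funext a; exact hw.walk a
  rw [e] at hd
  rcases mem_addGoal_allFrom hd with rfl | hd
  · right
    simp
  · refine (hc d hd hdk).imp (fun hb => hb.refines hts ⟨hw.keeps, fun a t => hw.forbids⟩)
      fun h => ?_
    rw [hwalk]
    exact h

/-- An entry that is blocked at the position of `x` agrees with `as` on all earlier positions, and
this is the second alternative for the shorter list. -/
theorem Covered.of_append {x : Term F} (h : Covered k ts (as ++ [x]) st) : Covered k ts as st := by
  intro e he hk
  rcases h e he hk with ⟨i, t, hi, h₁, h₂, hb⟩ | h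
  · have hlt : i < as.length + 1 := by
      have := h₁ i le_rfl
      rw [hi] at this
      simpa using (List.getElem?_eq_some_iff.1 this).1
    have hpre : ∀ j < as.length, ((as ++ [x]).map st.walk)[j]? = (as.map st.walk)[j]? := by
      intro j hj
      rw [List.map_append, List.getElem?_append_left (by simpa using hj)]
    rcases Nat.lt_succ_iff_lt_or_eq.1 hlt with h' | rfl
    · exact Or.inl ⟨i, t, hi, fun j hj => by rw [← hpre j (by omega)]; exact h₁ j hj, h₂, hb⟩
    · right
      refine List.ext_getElem? fun j => ?_
      rcases lt_or_ge j as.length with hj | hj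
      · rw [List.getElem?_take_of_lt hj, ← hpre j hj, h₁ j hj.le, h₂ j hj]
      · rw [List.getElem?_eq_none (by simp; omega), List.getElem?_eq_none (by simpa using hj)]
  · right
    have := congrArg (List.take as.length) h
    rw [List.take_take, List.map_append, List.take_left' (by simp)] at this
    simpa using this

/-- Earlier calls cannot match the prohibited value. -/
theorem Covered.blocked {a t : Term F} (h : Covered k ts (as ++ [a]) st)
    (hts : ∀ t ∈ ts, t.IsGround) (has : as.map st.walk = ts.take as.length)
    (ht : ts[as.length]? = some t) (ha : st.Forbids a t) :
    ∀ e ∈ st.chs, e.sym = .chk k → Blocked st.toStore (as ++ [t]) ts e.args := by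
  have hlt := (List.getElem?_eq_some_iff.1 ht).1
  have hbound : ∀ j ≤ as.length, ((as ++ [t]).map st.walk)[j]? = ts[j]? := by
    intro j hj
    rcases hj.lt_or_eq with hj | rfl
    · rw [List.map_append, List.getElem?_append_left (by simpa using hj), has,
        List.getElem?_take_of_lt hj]
    · rw [ht, List.map_append, List.getElem?_append_right (by simp)]
      simp [Store.walk_ground (hts t (List.mem_of_getElem? ht))]
  intro e he hk
  rcases h e he hk with ⟨i, u, hi, h₁, h₂, hb⟩ | h
  · refine ⟨i, u, hi, fun j hj => hbound j ?_, h₂, hb⟩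
    by_contra! h'
    have := h₁ i le_rfl
    have h'' : i < as.length + 1 := by
      rw [hi] at this
      simpa using (List.getElem?_eq_some_iff.1 this).1
    omega
  -- An entry that agrees with `as ++ [a]` has the same variable as `a` at this position. As `t` is
  -- prohibited for it, the entry is blocked there.
  · rw [List.map_append, List.map_singleton, has, List.length_append, List.length_singleton] at h
    have hlen : as.length < e.args.length := by
      have := congrArg List.length h
      simp at this
      omega
    refine ⟨as.length, t, ht, fun j hj => hbound j hj, fun j hj => ?_, e.args[as.length],
      List.getElem?_eq_getElem hlen, ?_⟩
    · have := congrArg (fun l => l[j]?) h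
      rw [List.getElem?_take_of_lt (by omega),
        List.getElem?_append_left (by simp; omega), List.getElem?_take_of_lt hj] at this
      exact this
    · have := congrArg (fun l => l[as.length]?) h
      rw [List.getElem?_take_of_lt (by omega),
        List.getElem?_append_right (by simp)] at this
      have hw : st.walk e.args[as.length] = st.walk a := by
        have hmin : as.length - min as.length ts.length = 0 := by omega
        simpa [hlen, hmin] using this
      obtain ⟨y, hy, h₁, h₂⟩ := ha
      exact ⟨y, hy, by rw [hw, h₁], h₂⟩

end ForAll

/-! ### Induction on the number of for-alls. -/

section ForAll

variable {R : Type v} {F : Type u} {P : Program R F}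
  {U : Finset (Propositional.Lit (Atom R F))} {D : Set ℕ}
  {st : State R F} {chs : List (Propositional.Lit (Atom R F))} {as ts : List (Term F)} {k : ℕ}

theorem ChkStep.of_keeps {st' st'' : State R F} (h : ChkStep P D k ts as st' st'' chs)
    (hk : st.toStore.Keeps st'.toStore) : ChkStep P D k ts as st st'' chs :=
  ⟨h.rel, hk.trans h.keeps, h.covered⟩

theorem ArgsOK.of_bound {s : Store F} (hts : ∀ t ∈ ts, t.IsGround)
    (h : as.map s.walk = ts.take as.length) : ArgsOK s as ts := by
  constructor
  · intro i a t ha ht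
    have hi := (List.getElem?_eq_some_iff.1 ha).1
    have := congrArg (fun l => l[i]?) h
    rw [List.getElem?_take_of_lt hi, List.getElem?_map, ha, ht] at this
    exact Or.inl (by simpa using this)
  · refine List.pairwise_of_forall_mem_list fun a ha b _ y hy => ?_
    have : s.walk a ∈ ts.take as.length := by rw [← h]; exact List.mem_map_of_mem ha
    have := hts _ (List.mem_of_mem_take this)
    rw [hy] at this
    exact absurd this (Term.not_isGround_var y)

theorem Covered.addGoal (h : Covered k ts as st) (r j : ℕ) :
    Covered k ts as (st.addGoal (allFrom (.chk k) r j as)) := by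
  intro e he hk
  rw [addGoal_toStore]
  rcases mem_addGoal_allFrom he with rfl | he
  · exact Or.inr (List.take_of_length_le (by simp))
  · exact h e he hk

theorem map_walk_append {s : Store F} {a t : Term F} (ht : ts[as.length]? = some t)
    (h : as.map s.walk = ts.take as.length) (ha : s.walk a = t) :
    (as ++ [a]).map s.walk = ts.take (as ++ [a]).length := by
  rw [List.length_append, List.length_singleton, List.take_add_one, ht, List.map_append, h,
    List.map_singleton, ha]
  rfl

/-- The execution of a sub-check with a new variable as the next argument. -/
theorem ChkPre.fresh (h : ChkPre P D k ts as st chs) (hts : ∀ t ∈ ts, t.IsGround) (hlen : as.length < ts.length) :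
    ChkPre P D k ts (as ++ [Term.var st.next]) ({ st with next := st.next + 1 } : State R F) chs := by
  have hw : st.toStore.Widens { st.toStore with next := st.next + 1 } := ⟨rfl, rfl, Nat.le_succ _⟩
  have hgood := h.rel.good
  have hnew := hgood.1.1 st.next le_rfl
  refine ⟨h.rel.keeps hw.keeps (hgood.with_next (Nat.le_succ _)), ⟨?_, ?_⟩, ?_, ?_, ?_⟩
  · intro i a t ha ht
    rcases lt_or_ge i as.length with hi | hi
    · rw [List.getElem?_append_left hi] at ha
      exact (h.args.ok i a t ha ht).imp (fun e => e) hw.free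
    · rw [List.getElem?_append_right hi] at ha
      obtain rfl : a = .var st.next := by
        have := List.mem_of_getElem? ha
        simpa using this
      exact Or.inr ⟨st.next, Nat.lt_succ_self _, hnew.1, hnew.1, hnew.2⟩
  · refine List.pairwise_append.2 ⟨h.args.distinct, List.pairwise_singleton _ _, ?_⟩
    intro a ha b hb y hy hy'
    obtain rfl : b = .var st.next := by simpa using hb
    have e : st.next = y := by
      have : st.sub st.next = .var y := hy'
      rw [hnew.1] at this
      simpa using this
    subst e
    obtain ⟨i, hi, rfl⟩ := List.getElem_of_mem ha
    have hy : st.walk as[i] = .var st.next := hy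
    have hit : i < ts.length := by omega
    rcases h.args.ok i as[i] ts[i] (by simp) (by simp) with h' | ⟨z, hz, h', -⟩
    · have := hts ts[i] (by simp)
      rw [← h', hy] at this
      exact Term.not_isGround_var _ this
    · rw [h'] at hy
      obtain rfl : z = st.next := by simpa using hy
      omega
  · intro a ha x hx
    rcases List.mem_append.1 ha with ha | ha
    · exact h.vars a ha x hx
    · obtain rfl : a = .var st.next := by simpa using ha
      obtain rfl : x = st.next := by simpa [Term.vars] using hx
      exact h.next
  · exact h.next.trans (Nat.le_succ _)
  · intro e he hk
    obtain ⟨i, t, hi, h₁, h₂, b, hb, hf⟩ := h.blocked e he hk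
    refine ⟨i, t, hi, fun j hj => ?_, h₂, b, hb, hw.forbids hf⟩
    have hlt : i < as.length := by
      have := h₁ i le_rfl
      rw [hi] at this
      simpa using (List.getElem?_eq_some_iff.1 this).1
    rw [List.map_append, List.getElem?_append_left (by rw [List.length_map]; omega)]
    exact h₁ j hj

theorem ForbidsAt.of_append {s : Store F} {a : Term F} {m : ℕ} (h : ForbidsAt s (as ++ [a]) ts m)
    (hm : m < as.length) : ForbidsAt s as ts m where
  before i hi := by
    rw [← h.before i hi, List.map_append,
      List.getElem?_append_left (by rw [List.length_map]; exact hi.trans hm)]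
  forbids := by
    obtain ⟨b, t, hb, ht, hf⟩ := h.forbids
    exact ⟨b, t, by rwa [List.getElem?_append_left hm] at hb, ht, hf⟩
  after i b t hi hb ht := by
    have := (List.getElem?_eq_some_iff.1 hb).1
    exact h.after i b t hi (by rwa [List.getElem?_append_left this]) ht

/-- Let `v` be the new variable for the outermost for-all. If the arguments before it are bound, the
first answer prohibits the prescribed value `t` for `v`, the for-all retries with `t`, and this
retry is the bound case with one for-all less; every other answer binds `v` and is rejected. If an
earlier argument is unbound, the first answer leaves `v` unconstrained, so this for-all succeeds
without a retry and the decision is left to an outer one. -/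
theorem chkSpec_allFrom {c : Clause R F} (hPc : P[k]? = some c) (hc : c.toCheck.IsGround)
    (hts : c.toCheck.headArgs = ts) (h : SimulatesCalls P U [(false, .chk k)]) (hkD : k ∈ D)
    (hU : ∀ s a, BodyGoal.lit s a ∈ c.toCheck.body → (!s, .atom a) ∈ U) (r : ℕ)
    (hlen : as.length + r = ts.length) (hp : ChkPre P D k ts as st chs) :
    ChkSpec P D k ts as st chs (allFrom (.chk k) r as.length as) := by
  induction r generalizing as st chs with
  | zero => exact chkSpec_lit hPc hc hts h hkD hU hlen hp
  | succ r ih =>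
  have hgts : ∀ t ∈ ts, t.IsGround := hts ▸ hc.headArgs
  have hj : as.length < ts.length := by omega
  obtain ⟨t, ht⟩ : ∃ t, ts[as.length]? = some t := ⟨_, List.getElem?_eq_getElem hj⟩
  have hgt := hgts t (List.mem_of_getElem? ht)
  -- The quantified variables are `0, …, ts.length - 1`, whereas variables in the arguments at run
  -- time are at least `ts.length`. Hence there is no clash.
  have hinst : ∀ b, (allFrom (.chk k) r (as.length + 1) (as ++ [Term.var as.length]) : Goal R F).inst
      as.length b = allFrom (.chk k) r (as ++ [b]).length (as ++ [b]) := by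
    intro b
    rw [inst_allFrom_append _ _ (fun a ha hx => ?_), List.length_append, List.length_singleton]
    have := hp.vars a ha _ hx
    omega
  have hinner := ih (as := as ++ [Term.var st.next]) (st := { st with next := st.next + 1 })
    (by simp; omega) (hp.fresh hgts hj)
  have hw₁ : st.toStore.Widens { st.toStore with next := st.next + 1 } :=
    ⟨rfl, rfl, Nat.le_succ _⟩
  have hkeep₁ := hw₁.keeps
  have hvar : (as ++ [Term.var st.next])[as.length]? = some (.var st.next : Term F) := by simp
  have hvfree : ({ st.toStore with next := st.next + 1 } : Store F).Free (.var st.next) := by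
    have hnew := hp.rel.good.1.1 st.next le_rfl
    exact ⟨st.next, Nat.lt_succ_self _, hnew.1, hnew.1, hnew.2⟩
  have hpre : ∀ (s : Store F) (b : Term F), ∀ i < as.length,
      ((as ++ [b]).map s.walk)[i]? = (as.map s.walk)[i]? := by
    intro s b i hi
    rw [List.map_append, List.getElem?_append_left (by simpa using hi)]
  have hpre' : ∀ (b : Term F), ∀ i < as.length, (as ++ [b])[i]? = as[i]? := by
    intro b i hi
    rw [List.getElem?_append_left hi]
  -- the new variable is bound
  have hcont_bound : ∀ st' : State R F, st'.walk (.var st.next) = t → ∀ n,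
      forallCont P n [] as.length (allFrom (.chk k) r (as.length + 1) (as ++ [Term.var as.length]))
        st.next st' = fail := by
    intro st' he n
    refine forallCont_of_isGround P n [] _ _ ?_
    rw [Store.walk_var] at he
    rw [he]
    exact hgt
  -- the prescribed value is prohibited for the new variable
  have hcont_forbids : ∀ (st' : State R F) (chs' : List (Propositional.Lit (Atom R F))),
      ChkStep P D k ts (as ++ [Term.var st.next]) { st with next := st.next + 1 } st' chs' →
      as.map st'.walk = ts.take as.length → st'.Forbids (.var st.next) t →
      (∀ d ∈ chs', d.2 ≠ .chk k) →
      Simulates (fun st'' chs'' => ChkStep P D k ts as st' st'' chs'')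
        (fun n => forallCont P n [] as.length
          (allFrom (.chk k) r (as.length + 1) (as ++ [Term.var as.length])) st.next st')
        (fun n => propExec P n [] (.lit false (.chk k)) chs') := by
    intro st' chs' hs hb hf hchs
    obtain ⟨y, hy, hw, hyy, hyp⟩ := hf
    rw [Store.walk_var] at hw
    have hcont := fun n => forallCont_of_var P n [] as.length
      (allFrom (.chk k) r (as.length + 1) (as ++ [Term.var as.length])) hw
    simp only [hyp, List.map_singleton, seq_singleton, Store.walk_ground hgt, hinst] at hcont
    simp only [hcont]
    set st₂ := st'.addGoal (allFrom (.chk k) r (as ++ [Term.var st.next]).length (as ++ [Term.var st.next]))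
      with hst₂
    have hst₂s : st₂.toStore = st'.toStore := addGoal_toStore _ _
    have hrel₂ : StateRel P D st₂ chs' := hs.rel.addGoal hkD _ _ _
    have hcov₂ : Covered k ts (as ++ [Term.var st.next]) st₂ := hs.covered.addGoal _ _
    have hb₂ : as.map st₂.walk = ts.take as.length := by rw [hst₂s]; exact hb
    have hbt := map_walk_append ht hb₂ (Store.walk_ground hgt _)
    have hpre₂ : ChkPre P D k ts (as ++ [t]) st₂ chs' := by
      refine ⟨hrel₂, .of_bound hgts hbt, ?_, ?_, ?_⟩
      · intro a ha x hx
        rcases List.mem_append.1 ha with ha | ha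
        · exact hp.vars a ha x hx
        · obtain rfl : a = t := by simpa using ha
          rw [show a.vars = [] from hgt] at hx
          simp at hx
      · rw [hst₂s]
        exact hp.next.trans ((Nat.le_succ _).trans hs.keeps.1)
      · refine hcov₂.blocked hgts hb₂ ht ?_
        rw [hst₂s]
        exact ⟨y, hy, hw, hyy, hyp⟩
    have hsim := ((ih (by simp; omega) hpre₂).bound hbt hchs).map
      (fun st'' => st''.closeAll y fun b => allFrom (.chk k) r (as ++ [b]).length (as ++ [b])) id
      (s := fun st'' chs'' => ChkStep P D k ts as st' st'' chs'') fun st'' chs'' h'' => by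
        refine ChkStep.closeAll (r := r) (j := as.length + 1) (fun b => ?_) hgts hkD h''.rel ?_
          h''.covered.of_append y
        · simp
        · have := h''.keeps
          rwa [hst₂s] at this
    have hid : ∀ o : Outcome (List (Propositional.Lit (Atom R F))), o.map id = o := by
      intro o
      simp [Outcome.map]
    simpa only [hid, hst₂] using hsim
  -- the new variable is not constrained
  have hcont_free : ∀ (st' : State R F) (chs' : List (Propositional.Lit (Atom R F))),
      ChkStep P D k ts (as ++ [Term.var st.next]) { st with next := st.next + 1 } st' chs' →
      st'.Free (.var st.next) → ∃ st'' : State R F,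
        (∀ n, forallCont P n [] as.length
          (allFrom (.chk k) r (as.length + 1) (as ++ [Term.var as.length])) st.next st' =
            Outcome.pure st'') ∧
        ChkStep P D k ts as st st'' chs' ∧ st'.toStore.Widens st''.toStore := by
    rintro st' chs' hs ⟨y, hy, hw, hyy, hyp⟩
    rw [Store.walk_var] at hw
    have hcont := fun n => forallCont_of_var P n [] as.length
      (allFrom (.chk k) r (as.length + 1) (as ++ [Term.var as.length])) hw
    simp only [hyp, List.map_nil, seq_nil, pure_map, hinst] at hcont
    refine ⟨_, hcont, ?_, ?_⟩
    · refine ChkStep.closeAll (r := r) (j := as.length + 1) (fun b => ?_) hgts hkD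
        (hs.rel.addGoal hkD _ _ _) ?_ (hs.covered.addGoal _ _).of_append y
      · simp
      · rw [addGoal_toStore]
        exact hkeep₁.trans hs.keeps
    · have := closeAll_widens (st'.addGoal
        (allFrom (.chk k) r (as ++ [Term.var st.next]).length (as ++ [Term.var st.next]))) y
        fun b => allFrom (.chk k) r (as ++ [b]).length (as ++ [b])
      rwa [addGoal_toStore] at this
  have hexec : ∀ n, exec P (n + 1) [] (allFrom (.chk k) (r + 1) as.length as) st =
      (exec P n [] (allFrom (.chk k) r (as ++ [Term.var st.next]).length (as ++ [Term.var st.next]))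
        { st with next := st.next + 1 }).bind (forallCont P n [] as.length
          (allFrom (.chk k) r (as.length + 1) (as ++ [Term.var as.length])) st.next) := by
    intro n
    rw [allFrom, exec_all, hinst]
  constructor
  · intro hb hchs
    refine Simulates.of_succ_left ?_
    simp only [hexec]
    have hbef : ∀ i < as.length, ((as ++ [Term.var st.next]).map
        ({ st.toStore with next := st.next + 1 } : Store F).walk)[i]? = ts[i]? := by
      intro i hi
      rw [hpre _ _ i hi]
      have := congrArg (fun l => l[i]?) hb
      rw [List.getElem?_take_of_lt hi] at this
      exact this
    -- The first unbound argument is the new variable itself, at position `as.length`.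
    refine (hinner.unbound as.length _ hvar hvfree hbef).simulates_bind (fun st' h' => ?_)
      fun st' h' => ?_
    · obtain ⟨a, u, ha, hu, hf⟩ := h'.forbids.forbids
      obtain rfl : Term.var st.next = a := by simpa using ha
      obtain rfl : t = u := by simpa [ht] using hu
      have hk : st.toStore.Keeps st'.toStore := hkeep₁.trans h'.step.keeps
      refine (hcont_forbids st' chs h'.step (map_walk_of_keeps hk hgts hb) hf hchs).mono
        fun _ _ hs => hs.of_keeps hk
    · refine hcont_bound st' ?_
      have := h'.bound
      rw [ht, List.getElem?_map, hvar] at this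
      simpa using this
  · intro m a ham hfree hbef
    refine StablyFirst.of_succ ?_
    simp only [hexec]
    have hm : m < as.length := (List.getElem?_eq_some_iff.1 ham).1
    refine (hinner.unbound m a (by rw [hpre' _ m hm, ham])
      (hw₁.free hfree) fun i hi => ?_).bind (fun st' h' => ?_) fun st' h' => ?_
    · rw [hpre _ _ i (by omega)]
      exact hbef i hi
    · obtain ⟨st'', hs, hstep, hw⟩ := hcont_free st' chs h'.step (h'.free as.length _ hm hvar hvfree)
      simp only [hs]
      exact stablyFirst_pure _ ⟨hstep, (h'.forbids.of_append hm).widens hw, fun i b hi hb hf =>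
        hw.free (h'.free i b hi
          (by rw [hpre' _ i (List.getElem?_eq_some_iff.1 hb).1, hb]) (hw₁.free hf))⟩
    · obtain ⟨chs', hstep⟩ := h'.step
      have hk : st.toStore.Keeps st'.toStore := hkeep₁.trans hstep.keeps
      have hbm : (as.map st'.walk)[m]? = ts[m]? := by
        rw [← hpre _ (Term.var st.next) m hm]
        exact h'.bound
      have hvw : ∀ u : Option (Term F), ((as ++ [Term.var st.next]).map st'.walk)[as.length]? = u →
          u = some t → st'.walk (.var st.next) = t := by
        rintro _ rfl e
        rw [List.getElem?_map, hvar] at e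
        simpa using e
      -- Another answer either binds all arguments or prohibits a value at some position `m'`. What
      -- this for-all does depends on whether `m'` comes before, at or after the position of the new
      -- variable.
      rcases h'.args with hb | ⟨m', hf⟩
      · simp only [hcont_bound st' (hvw _ rfl (by
          rw [hb, List.length_append, List.length_singleton,
            List.getElem?_take_of_lt (Nat.lt_succ_self _), ht]))]
        exact stably_fail _
      rcases lt_trichotomy as.length m' with hlt | rfl | hlt
      · simp only [hcont_bound st' (hvw _ rfl (by rw [hf.before _ hlt, ht]))]
        exact stably_fail _
      · obtain ⟨a, u, ha, hu, hv⟩ := hf.forbids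
        obtain rfl : Term.var st.next = a := by simpa using ha
        obtain rfl : t = u := by simpa [ht] using hu
        have hb : as.map st'.walk = ts.take as.length := by
          refine List.ext_getElem? fun i => ?_
          rcases lt_or_ge i as.length with hi | hi
          · rw [← hpre _ (Term.var st.next) i hi, hf.before i hi, List.getElem?_take_of_lt hi]
          · rw [List.getElem?_eq_none (by simpa using hi),
              List.getElem?_eq_none (by rw [List.length_take]; omega)]
        -- The prohibited value is that of the new variable, and the for-all retries with it
        -- although the answer is of no use to the outer for-all over position `m`. The bound case
        -- shows that the retry terminates; the heads of sub-checks are removed from the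
        -- propositional set to meet its hypothesis.
        refine (hcont_forbids st' _ ⟨hstep.rel.filter_chk, hstep.keeps, hstep.covered⟩ hb hv
          fun d hd => ?_).stably.mono fun st'' ⟨chs'', hs⟩ => ?_
        · have := (List.mem_filter.1 hd).2
          simp only [decide_eq_true_eq] at this
          exact this k
        · have hb' := map_walk_of_keeps hs.keeps hgts hb
          exact ⟨⟨chs'', hs.of_keeps hk⟩, by rw [hb', List.getElem?_take_of_lt hm], Or.inl hb'⟩
      · rcases hf.after as.length _ t hlt hvar ht with hb | hfr
        · simp only [hcont_bound st' hb]
          exact stably_fail _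
        · obtain ⟨st'', hs, hstep', hw⟩ := hcont_free st' chs' hstep hfr
          simp only [hs]
          exact stably_pure ⟨⟨chs', hstep'⟩, by rw [hw.map_walk, hbm],
            Or.inr ⟨m', (hf.of_append hlt).widens hw⟩⟩

end ForAll

/-! ### The call graph of a ground program -/

section CallGraph

/-- An odd loop only compares sources with sources and targets with sources of edges, so the two
relations need to agree on such pairs alone. -/
theorem isOLON_congr {α : Type u} {same same' : α → α → Prop}
    {cs : List (Option α × List (Bool × α))}
    (hs : ∀ e e', IsEdge cs e → IsEdge cs e' → (same e.src e'.src ↔ same' e.src e'.src))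
    (ht : ∀ e e', IsEdge cs e → IsEdge cs e' → (same e.tgt e'.src ↔ same' e.tgt e'.src)) (k : ℕ) :
    IsOLON same cs k ↔ IsOLON same' cs k := by
  refine or_congr_right (exists_congr fun cyc => and_congr_left' ?_)
  refine and_congr_right fun _ => and_congr_right fun he => ?_
  have he' : ∀ e ∈ cyc ++ cyc.take 1, IsEdge cs e := by
    intro e h
    rcases List.mem_append.1 h with h | h
    exacts [he e h, he e (List.mem_of_mem_take h)]
  refine and_congr ?_ (and_congr_left' ?_)
  · exact List.IsChain.iff_of_mem_imp fun e e' h h' => ht e e' (he' e h) (he' e' h')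
  · exact List.Pairwise.iff_of_mem fun h h' => not_congr (hs _ _ (he _ h) (he _ h'))

variable {R : Type v} {F : Type u}

/-- Substitutions do not change ground atoms, so unifiability with variables renamed apart is
equality. -/
theorem Granularity.same_iff_sameProp (γ : Granularity) {a b : Atom R F} (ha : a.vars = [])
    (hb : b.vars = []) : γ.Same a b ↔ γ.SameProp a b := by
  cases γ with
  | predicates => rfl
  | atoms =>
    have hid : ∀ {c : Atom R F} (σ : ℕ → Term F), c.vars = [] →
        c.args.map (Term.subst σ) = c.args := by
      intro c σ hc
      conv_rhs => rw [← List.map_id c.args]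
      exact List.map_congr_left fun t ht =>
        Term.IsGround.subst (List.flatMap_eq_nil_iff.1 hc t ht) σ
    have : Nonempty (ℕ → Term F) := ⟨.var⟩
    simp only [Same, SameProp, hid _ ha, hid _ hb, exists_const]
    cases a; cases b
    simp

theorem skeleton_toProp (P : Program R F) :
    Propositional.skeleton (P.map Clause.toProp) = skeleton P := by
  simp only [Propositional.skeleton, skeleton, List.map_map]
  refine List.map_congr_left fun c _ => ?_
  simp only [Function.comp_apply, Clause.toProp, List.filterMap_map, Prod.mk.injEq, true_and]
  refine List.filterMap_congr fun g _ => ?_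
  cases g <;> rfl

theorem Clause.IsGround.head_vars {c : Clause R F} (hc : c.IsGround) {a : Atom R F}
    (h : c.head = some a) : a.vars = [] := by
  have := (List.append_eq_nil_iff.1 hc).1
  simpa [Clause.headArgs, h, Atom.vars] using this

theorem vars_eq_nil_of_isEdge {P : Program R F} (hP : P.IsGround) {e : Edge (Atom R F)}
    (h : IsEdge (skeleton P) e) : e.src.vars = [] ∧ e.tgt.vars = [] := by
  obtain ⟨body, h₁, h₂⟩ := h
  simp only [skeleton, List.getElem?_map, Option.map_eq_some_iff, Prod.mk.injEq] at h₁
  obtain ⟨c, hc, hh, rfl⟩ := h₁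
  have hg := hP c (List.mem_of_getElem? hc)
  refine ⟨hg.head_vars hh, ?_⟩
  obtain ⟨g, hg', e'⟩ := List.mem_filterMap.1 h₂
  cases g with
  | lit s a =>
    simp only [BodyGoal.literal?, Option.some.injEq, Prod.mk.injEq] at e'
    rw [← e'.2]
    exact hg.body _ hg'
  | test s b => cases e'

theorem olonRules_toProp (γ : Granularity) {P : Program R F} (hP : P.IsGround) :
    olonRules γ.SameProp (Propositional.skeleton (P.map Clause.toProp)) =
      olonRules γ.Same (skeleton P) := by
  rw [skeleton_toProp, olonRules, olonRules]
  refine List.filter_congr fun k _ => ?_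
  rw [decide_eq_decide]
  refine (isOLON_congr (fun e e' h h' => ?_) (fun e e' h h' => ?_) k).symm
  · exact γ.same_iff_sameProp (vars_eq_nil_of_isEdge hP h).1 (vars_eq_nil_of_isEdge hP h').1
  · exact γ.same_iff_sameProp (vars_eq_nil_of_isEdge hP h).2 (vars_eq_nil_of_isEdge hP h').1

end CallGraph

/-! ### Executions of ground programs -/

/-- This disposes of the final check of the domains of loop variables: related states have none, so
no answer is discarded. -/
theorem Simulates.filter {α β : Type*} {r : α → β → Prop} {f : ℕ → Outcome α}
    {f' : ℕ → Outcome β} (h : Simulates r f f') (p : α → Prop) (hp : ∀ a b, r a b → p a) :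
    Simulates r (fun n => (f n).filter p) f' := by
  obtain ⟨o, o', h, h', h₁, h₂, hr⟩ := h
  refine ⟨o, o', ?_, h', h₁, h₂, hr⟩
  filter_upwards [h] with n e
  rw [e, Outcome.filter, List.filter_eq_self.2]
  intro a ha
  obtain ⟨i, hi, rfl⟩ := List.getElem_of_mem ha
  simpa using hp _ _ ((List.forall₂_iff_get.1 hr).2 i hi (by rw [← hr.length_eq]; exact hi))

section Ground

variable {R : Type v} {F : Type u} {P : Program R F}
  {U : Finset (Propositional.Lit (Atom R F))} {D : Set ℕ}
  {st : State R F} {chs : List (Propositional.Lit (Atom R F))}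

theorem Clause.mem_body_toCheck {c : Clause R F} {s : Bool} {a : Atom R F}
    (h : BodyGoal.lit s a ∈ c.toCheck.body) : BodyGoal.lit s a ∈ c.body ∨ c.head = some a := by
  unfold Clause.toCheck at h
  split at h
  · exact Or.inl h
  · rename_i b hb
    split_ifs at h with hh
    · exact Or.inl h
    · rcases List.mem_append.1 h with h | h
      · exact Or.inl h
      · simp only [List.mem_singleton, BodyGoal.lit.injEq] at h
        rw [h.2]
        exact Or.inr hb

/-- Literals called in the execution of a query. -/
theorem exists_callClosed (P : Program R F) (Q : List (BodyGoal R F)) :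
    ∃ U, CallClosed P U ∧ ∀ s a, BodyGoal.lit s a ∈ Q → (s, .atom a) ∈ U := by
  let A : List (Atom R F) := P.filterMap Clause.head ++
    (P.flatMap Clause.body ++ Q).filterMap fun g => g.literal?.map Prod.snd
  have hA : ∀ s a, BodyGoal.lit s a ∈ P.flatMap Clause.body ++ Q → a ∈ A := fun s a h =>
    List.mem_append_right _ (List.mem_filterMap.2 ⟨_, h, rfl⟩)
  let L : List (Propositional.Lit (Atom R F)) :=
    A.flatMap (fun a => [(true, .atom a), (false, .atom a)]) ++
      (List.range P.length).map fun k => (false, .dual k)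
  have hL : ∀ a ∈ A, ∀ s, (s, .atom a) ∈ L.toFinset := by
    intro a ha s
    rw [List.mem_toFinset]
    refine List.mem_append_left _ (List.mem_flatMap.2 ⟨a, ha, ?_⟩)
    cases s <;> simp
  refine ⟨L.toFinset, ⟨fun c hc s a h s' => hL a (hA s a ?_) s', fun c hc a h s' => hL a ?_ s',
    fun k hk => ?_⟩, fun s a h => hL a (hA s a (List.mem_append_right _ h)) s⟩
  · exact List.mem_append_left _ (List.mem_flatMap.2 ⟨c, hc, h⟩)
  · exact List.mem_append_left _ (List.mem_filterMap.2 ⟨c, hc, h⟩)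
  · rw [List.mem_toFinset]
    exact List.mem_append_right _ (List.mem_map.2 ⟨k, List.mem_range.2 hk, rfl⟩)

/-- The call of the sub-check for the `k`-th clause. -/
def subCheck (P : Program R F) (k : ℕ) : Option (Goal R F) :=
  P[k]?.map fun c =>
    quantified (.chk k) 0 (c.toCheck.headVars.length + c.toCheck.bodyVars.length)

theorem subCheck_eq (hP : P.IsGround) {k : ℕ} {c : Clause R F} (hc : P[k]? = some c) :
    subCheck P k = some (allFrom (.chk k) c.headArgs.length 0 []) := by
  have hg := (hP c (List.mem_of_getElem? hc)).toCheck
  rw [subCheck, hc, Option.map_some, hg.headVars, hg.bodyVars, Clause.toCheck_headArgs]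
  simp [quantified_eq_allFrom]

/-- The NMR check. -/
theorem simulates_subChecks (hP : P.IsGround) (hU : CallClosed P U) {L : List ℕ} (hL : L.Nodup)
    (hD : ∀ k ∈ L, k ∉ D) (hlt : ∀ k ∈ L, k < P.length)
    (hn : ∀ k ∈ L, ∀ c, P[k]? = some c → c.headArgs.length ≤ st.next)
    (hr : StateRel P D st chs) :
    Simulates (fun st' chs' => ∃ D', StateRel P D' st' chs')
      (fun n => seq (exec P n []) (L.filterMap (subCheck P)) st)
      (fun n => seq (propExec P n []) (L.map fun k => .lit false (.chk k)) chs) := by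
  induction L generalizing st chs D with
  | nil => exact simulates_pure ⟨D, hr⟩
  | cons k L ih =>
    have hk := hlt k (by simp)
    obtain ⟨c, hc⟩ : ∃ c, P[k]? = some c := ⟨_, List.getElem?_eq_getElem hk⟩
    have hcP := List.mem_of_getElem? hc
    rw [List.nodup_cons] at hL
    rw [List.filterMap_cons_some (subCheck_eq hP hc)]
    simp only [List.map_cons, seq_cons]
    have hkD : k ∉ D := hD k (by simp)
    -- The index `k` joins `D` only now. Neither CHS contains an entry for this sub-check yet, since
    -- each sub-check occurs once in the list; so nothing has to be blocked at the start.
    have hspec := chkSpec_allFrom (D := insert k D) (as := []) (st := st) (chs := chs) hc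
      (hP c hcP).toCheck (Clause.toCheck_headArgs c) (simulatesCalls hP hU [(false, .chk k)])
      (Set.mem_insert _ _)
      (fun s a h => (Clause.mem_body_toCheck h).elim (fun h => hU.body c hcP s a h _)
        fun h => hU.head c hcP a h _) c.headArgs.length (by simp)
      ⟨hr.mono (Set.subset_insert _ _), ⟨by simp, .nil⟩, by simp, hn k (by simp) c hc,
        fun e he hek => absurd (hr.dom k (Or.inl ⟨e, he, hek⟩)) hkD⟩
    refine (hspec.bound rfl fun d hd hdk => hkD (hr.dom k (Or.inr ⟨d, hd, hdk⟩))).bind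
      fun st' chs' hs => ?_
    refine ih hL.2 (fun j hj h => ?_) (fun j hj => hlt j (by simp [hj]))
      (fun j hj c hc => (hn j (by simp [hj]) c hc).trans hs.keeps.1) hs.rel
    rcases h with rfl | h
    exacts [hL.1 hj, hD j (by simp [hj]) h]

theorem stateRel_initial (P : Program R F) (gs : List (Goal R F)) :
    StateRel P ∅ (State.initial gs) [] where
  good := ⟨⟨fun x _ => ⟨rfl, rfl⟩, fun x hx z hz => by
    obtain rfl : z = x := by simpa [State.initial, Term.vars] using hz
    exact hx⟩, rfl⟩
  pending := by simp [State.initial]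
  ok := by simp [State.initial]
  abs := rfl
  dom := by simp [State.initial]

/-- The entries on which the two sets differ are sub-checks and duals with undefined image. Answers
contain neither, and literals of the program always have an image. -/
theorem StateRel.lits_eq (h : StateRel P D st chs) : st.lits = Propositional.model chs := by
  have e : Propositional.model chs =
      Propositional.model (chs.filter fun l => ∀ k, l.2 ≠ .chk k) := by
    unfold Propositional.model
    rw [List.filterMap_filter]
    refine List.filterMap_congr fun l _ => ?_
    rcases l with ⟨s, a | k | k⟩ <;> simp
  rw [e, ← h.abs, Propositional.model, List.filterMap_filterMap, State.lits]
  refine List.filterMap_congr fun l hl => ?_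
  unfold absLit
  cases hs : l.sym with
  | user g r => simp
  | chk k => simp
  | dual k =>
    simp only
    split_ifs <;> simp

theorem StateRel.toAnswer_eq (h : StateRel P D st chs) :
    st.toAnswer = Answer.ofGround (Propositional.model chs) := by
  have hv : st.lits.flatMap (fun l => l.2.vars) = [] := by
    rw [List.flatMap_eq_nil_iff]
    intro l hl
    obtain ⟨d, hd, e⟩ := List.mem_filterMap.1 hl
    cases hs : d.sym with
    | user g r =>
      simp only [hs, Option.some.injEq] at e
      subst e
      refine List.flatMap_eq_nil_iff.2 fun t ht => ?_
      obtain ⟨a, ha, rfl⟩ := List.mem_map.1 ht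
      exact (h.ok d hd).ground (by simp [hs]) a ha
    | dual k => simp [hs] at e
    | chk k => simp [hs] at e
  rw [State.toAnswer, Answer.ofGround, hv, h.lits_eq]
  simp

theorem shift_zero_allFrom (sym : Sym R) (r j : ℕ) (as : List (Term F)) :
    (allFrom sym r j as).shift 0 = allFrom sym r j as := by
  induction r generalizing j as with
  | zero =>
    have : (Term.subst fun x => .var (x + 0) : Term F → Term F) = id := funext Term.subst_var
    simp only [allFrom, Goal.shift, Lit.subst, this, List.map_id]
  | succ r ih => rw [allFrom, Goal.shift, ih, Nat.add_zero]

/-- The query has no variables, so the renaming of the NMR check is a shift by `0`. -/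
theorem initialGoals_eq (γ : Granularity) (hP : P.IsGround) {Q : List (BodyGoal R F)}
    (hQ : IsGroundQuery Q) :
    initialGoals γ P Q =
      Q.map BodyGoal.toGoal ++ (olonRules γ.Same (skeleton P)).filterMap (subCheck P) := by
  have hv : varBound (Q.flatMap BodyGoal.vars) = 0 := by
    rw [List.flatMap_eq_nil_iff.2 hQ]
    rfl
  rw [initialGoals, hv]
  change _ ++ ((olonRules γ.Same (skeleton P)).filterMap (subCheck P)).map _ = _
  congr 1
  conv_rhs => rw [← List.map_id ((olonRules γ.Same (skeleton P)).filterMap (subCheck P))]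
  refine List.map_congr_left fun g hg => ?_
  obtain ⟨k, -, hk⟩ := List.mem_filterMap.1 hg
  obtain ⟨c, hc, -⟩ := Option.map_eq_some_iff.1 hk
  rw [subCheck_eq hP hc, Option.some.injEq] at hk
  rw [← hk, shift_zero_allFrom]
  rfl

theorem simulates_sasp (γ : Granularity) (hP : P.IsGround) {Q : List (BodyGoal R F)}
    (hQ : IsGroundQuery Q) :
    Simulates (fun a b => a = Answer.ofGround b) (sasp γ P Q) (propositional γ P Q) := by
  obtain ⟨U, hU, hUQ⟩ := exists_callClosed P Q
  unfold sasp propositional Propositional.run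
  refine Simulates.map (r := fun st chs => ∃ D, StateRel P D st chs) ?_ _ _
    fun st chs ⟨D, h⟩ => h.toAnswer_eq
  refine Simulates.filter ?_ _ fun st chs ⟨D, h⟩ x hx => absurd hx (h.good.not_isLoop x)
  have hlt : ∀ k ∈ olonRules γ.Same (skeleton P), k < P.length := by
    intro k hk
    have := List.mem_range.1 (List.mem_filter.1 hk).1
    simpa [skeleton] using this
  have hnext : ∀ k ∈ olonRules γ.Same (skeleton P), ∀ c, P[k]? = some c →
      c.headArgs.length ≤ (State.initial (initialGoals γ P Q)).next := by
    intro k hk c hc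
    -- The last quantified variable `K` occurs in the initial goals, hence lies below `next`.
    -- Variables created at run time are therefore different from all quantified ones.
    rcases hK : c.headArgs.length with _ | K
    · exact Nat.zero_le _
    · refine lt_varBound (List.mem_flatMap.2 ⟨allFrom (.chk k) c.headArgs.length 0 [], ?_, ?_⟩)
      · rw [initialGoals_eq γ hP hQ]
        exact List.mem_append_right _ (List.mem_filterMap.2 ⟨k, hk, subCheck_eq hP hc⟩)
      · have := vars_allFrom (F := F) (Sym.chk k : Sym R) c.headArgs.length 0 [] K (by omega)
        rwa [Nat.zero_add] at this
  have hprop : (Q.map BodyGoal.toProp).map Propositional.Goal.toInternal =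
      Q.map fun g => g.toProp.toInternal := by
    rw [List.map_map]
    rfl
  rw [olonRules_toProp γ hP, hprop]
  have hinit := stateRel_initial P (initialGoals γ P Q)
  set st := State.initial (initialGoals γ P Q) with hst
  rw [initialGoals_eq γ hP hQ]
  simp only [seq_append]
  refine ((simulatesCalls hP hU []).body Q .nil hinit hQ hUQ).bind fun st' chs' hs => ?_
  exact simulates_subChecks hP hU (List.nodup_range.filter _) (by simp) hlt
    (fun k hk c hc => (hnext k hk c hc).trans hs.ext.1) hs.rel

end Ground

end

end SASP

theorem mainTheorem4 {R : Type*} {F : Type*} (γ : SASP.Granularity) (P : SASP.Program R F)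
    (hP : P.IsGround) (Q : List (SASP.BodyGoal R F)) (hQ : SASP.IsGroundQuery Q) :
    SASP.SameBehaviour SASP.Answer.ofGround (SASP.sasp γ P Q) (SASP.propositional γ P Q) := by
  exact (SASP.simulates_sasp γ hP hQ).sameBehaviour
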